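/- Let $\varkappa\geq 1$ and let $\bm s=(s_1,\dots,s_\varkappa)$ and $\bm\varepsilon=(\varepsilon_1,\dots,\varepsilon_\varkappa)$ be sequences with all $s_i,\varepsilon_i\in\{1,-1\}$. Define parities $|i|\in\{0,1\}$ by $s_i=(-1)^{|i|}$, and put $\rho_k=\sum_{a=k}^{\varkappa}s_a$, with $\rho_{\varkappa+1}=0$. The twisted super Yangian $\mathscr B_{\bm s,\bm\varepsilon}$ of type AIII is the unital associative superalgebra over $\mathbb C$ with generators $b_{ij}^{(r)}$ ($1\leq i,j\leq\varkappa$, $r\geq 1$) of parity $|i|+|j|$ and the following defining relations, where $b_{ij}(u)=\delta_{ij}\varepsilon_i+\sum_{r\geq 1}b_{ij}^{(r)}u^{-r}$ and $[\cdot,\cdot]$ is the supercommutator: $$\begin{aligned}{}[b_{ij}(u),b_{kl}(v)]={}&\frac{(-1)^{|i||j|+|i||k|+|j||k|}}{u-v}\big(b_{kj}(u)b_{il}(v)-b_{kj}(v)b_{il}(u)\big)\\&+\frac{(-1)^{|i||j|+|i||k|+|j||k|}}{u+v}\Big(\delta_{kj}\sum_{a=1}^{\varkappa}b_{ia}(u)b_{al}(v)-\delta_{il}\sum_{a=1}^{\varkappa}b_{ka}(v)b_{aj}(u)\Big)\\&-\frac{\delta_{ij}}{u^2-v^2}\Big(\sum_{a=1}^{\varkappa}b_{ka}(u)b_{al}(v)-\sum_{a=1}^{\varkappa}b_{ka}(v)b_{al}(u)\Big),\end{aligned}$$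 $$\sum_{a=1}^{\varkappa}b_{ia}(u)b_{aj}(-u)=\delta_{ij}.$$ For a tuple $\bm\mu(u)=(\mu_i(u))_{1\leq i\leq\varkappa}$ with $\mu_i(u)\in\varepsilon_i+u^{-1}\mathbb C[[u^{-1}]]$, the Verma module $M(\bm\mu(u))$ is the quotient of $\mathscr B_{\bm s,\bm\varepsilon}$ by the left ideal generated by all coefficients of the series $b_{ij}(u)$ for $1\leq i<j\leq\varkappa$ and $b_{ii}(u)-\mu_i(u)$ for $1\leq i\leq\varkappa$. Put $$\tilde\mu_i(u)=(2u-\rho_{i+1})\mu_i(u)+\sum_{a=i+1}^{\varkappa}s_a\mu_a(u),\qquad 1\leq i\leq\varkappa.$$ Theorem. The Verma module $M(\bm\mu(u))$ is nonzero if and only if $\mu_\varkappa(u)\mu_\varkappa(-u)=1$ and, for every $1\leq i<\varkappa$, $$\tilde\mu_i(u)\,\tilde\mu_i(-u+\rho_{i+1})=\tilde\mu_{i+1}(u)\,\tilde\mu_{i+1}(-u+\rho_{i+1}),$$ as identities of formal Laurent series in $u^{-1}$. -/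

import Mathlib

namespace TwistedSuperYangian

/-! ### Parity data

`Fin (N + 1)` is the index set `{1, …, ϰ}` with `ϰ = N + 1`.  A parity sequence is a map
`s : Fin (N + 1) → ℤˣ`, and `ε : Fin (N + 1) → ℤˣ` is the sequence of signs on the diagonal of
the matrix `G`. -/

/-- The parity `|i|`, determined by `s i = (-1) ^ |i|`. -/
def parity {N : ℕ} (s : Fin (N + 1) → ℤˣ) (i : Fin (N + 1)) : ℕ :=
  if s i = 1 then 0 else 1

theorem neg_one_pow_parity {N : ℕ} (s : Fin (N + 1) → ℤˣ) (i : Fin (N + 1)) :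
    (-1 : ℤˣ) ^ parity s i = s i := by
  unfold parity
  rcases Int.units_eq_one_or (s i) with h | h <;> simp [h]

/-- For `i`, the number `∑_{a > i} s_a`, that is, `ρ_{i+1}` where `ρ_k = ∑_{a ≥ k} s_a`.
It vanishes for the last index. -/
def rhoSucc {N : ℕ} (s : Fin (N + 1) → ℤˣ) (i : Fin (N + 1)) : ℤ :=
  ∑ a ∈ Finset.Ioi i, ((s a : ℤˣ) : ℤ)

/-! ### The twisted super Yangian by generators and relations -/

/-- The free algebra on the symbols `b_{ij}^{(r+1)}`, encoded as triples `(i, j, r)`, `r : ℕ`. -/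
abbrev FreeAlg (N : ℕ) : Type :=
  FreeAlgebra ℂ (Fin (N + 1) × Fin (N + 1) × ℕ)

/-- The coefficient of `u ^ (-r)` in `b_{ij}(u) = δ_{ij} ε_i + ∑_{r ≥ 1} b_{ij}^{(r)} u ^ (-r)`. -/
noncomputable def freeCoeff {N : ℕ} (ε : Fin (N + 1) → ℤˣ) (i j : Fin (N + 1)) :
    ℕ → FreeAlg N
  | 0 => if i = j then algebraMap ℂ (FreeAlg N) (((ε i : ℤˣ) : ℤ) : ℂ) else 0
  | r + 1 => FreeAlgebra.ι ℂ (i, j, r)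

/-- Formal series in `x = u⁻¹` and `y = v⁻¹` with coefficients in the free algebra; the
(central) variable `x` is number `0`, and `y` is number `1`. -/
abbrev FreeSeries₂ (N : ℕ) : Type :=
  MvPowerSeries (Fin 2) (FreeAlg N)

/-- `b_{ij}(u)` as a series in `u⁻¹, v⁻¹`. -/
noncomputable def bU {N : ℕ} (ε : Fin (N + 1) → ℤˣ) (i j : Fin (N + 1)) : FreeSeries₂ N :=
  fun m => if m 1 = 0 then freeCoeff ε i j (m 0) else 0

/-- `b_{ij}(v)` as a series in `u⁻¹, v⁻¹`. -/
noncomputable def bV {N : ℕ} (ε : Fin (N + 1) → ℤˣ) (i j : Fin (N + 1)) : FreeSeries₂ N :=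
  fun m => if m 0 = 0 then freeCoeff ε i j (m 1) else 0

/-- The super-commutator `[b_{ij}(u), b_{kl}(v)]`; `b_{ij}(u)` has parity `|i| + |j|`. -/
noncomputable def superBracket {N : ℕ} (s ε : Fin (N + 1) → ℤˣ) (i j k l : Fin (N + 1)) :
    FreeSeries₂ N :=
  bU ε i j * bV ε k l
    - (-1) ^ ((parity s i + parity s j) * (parity s k + parity s l)) * (bV ε k l * bU ε i j)

/-- The sign `(-1)^{|i||j| + |i||k| + |j||k|}`. -/
noncomputable def sign₃ {N : ℕ} (s : Fin (N + 1) → ℤˣ) (i j k : Fin (N + 1)) : FreeSeries₂ N :=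
  (-1) ^ (parity s i * parity s j + parity s i * parity s k + parity s j * parity s k)

/-- Left-hand side of the reflection relation
`[b_{ij}(u), b_{kl}(v)] = (σ / (u - v)) (…) + (σ / (u + v)) (…) - (1 / (u² - v²)) (…)`
after multiplication by the (non-zero-divisor) `u⁻² v⁻² (u² - v²) = y² - x²`, where
`x = u⁻¹`, `y = v⁻¹`. -/
noncomputable def reflectionLHS {N : ℕ} (s ε : Fin (N + 1) → ℤˣ) (i j k l : Fin (N + 1)) :
    FreeSeries₂ N :=
  (MvPowerSeries.X 1 ^ 2 - MvPowerSeries.X 0 ^ 2) * superBracket s ε i j k l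

/-- Right-hand side of the reflection relation after the same multiplication. Here
`(y² - x²) / (u - v) = x y (x + y)`, `(y² - x²) / (u + v) = x y (y - x)` and
`(y² - x²) / (u² - v²) = x² y²`. -/
noncomputable def reflectionRHS {N : ℕ} (s ε : Fin (N + 1) → ℤˣ) (i j k l : Fin (N + 1)) :
    FreeSeries₂ N :=
  let x : FreeSeries₂ N := MvPowerSeries.X 0
  let y : FreeSeries₂ N := MvPowerSeries.X 1
  x * y * (x + y) * (sign₃ s i j k * (bU ε k j * bV ε i l - bV ε k j * bU ε i l))
    + x * y * (y - x) * (sign₃ s i j k *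
        ((if k = j then ∑ a, bU ε i a * bV ε a l else 0)
          - (if i = l then ∑ a, bV ε k a * bU ε a j else 0)))
    - x ^ 2 * y ^ 2 *
        (if i = j then (∑ a, bU ε k a * bV ε a l) - ∑ a, bV ε k a * bU ε a l else 0)

/-- `b_{ij}(u)` as a series in `u⁻¹` alone. -/
noncomputable def bSeries {N : ℕ} (ε : Fin (N + 1) → ℤˣ) (i j : Fin (N + 1)) :
    PowerSeries (FreeAlg N) :=
  PowerSeries.mk fun r => freeCoeff ε i j r

/-- `b_{ij}(-u)` as a series in `u⁻¹`. -/
noncomputable def bSeriesNeg {N : ℕ} (ε : Fin (N + 1) → ℤˣ) (i j : Fin (N + 1)) :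
    PowerSeries (FreeAlg N) :=
  PowerSeries.mk fun r => (-1) ^ r * freeCoeff ε i j r

/-- The defining relations: all coefficients of the reflection relation and of the unitary
condition `∑_a b_{ia}(u) b_{aj}(-u) = δ_{ij}`. -/
inductive Rel {N : ℕ} (s ε : Fin (N + 1) → ℤˣ) : FreeAlg N → FreeAlg N → Prop
  | reflection (i j k l : Fin (N + 1)) (m : Fin 2 →₀ ℕ) :
      Rel s ε (MvPowerSeries.coeff m (reflectionLHS s ε i j k l))
        (MvPowerSeries.coeff m (reflectionRHS s ε i j k l))
  | unitary (i j : Fin (N + 1)) (r : ℕ) :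
      Rel s ε (PowerSeries.coeff r (∑ a, bSeries ε i a * bSeriesNeg ε a j))
        (PowerSeries.coeff r (if i = j then 1 else 0))

/-- The (algebra underlying the) twisted super Yangian `ℬ_{s,ε}` of type AIII. -/
abbrev Alg {N : ℕ} (s ε : Fin (N + 1) → ℤˣ) : Type :=
  RingQuot (Rel s ε)

/-- The coefficient of `u ^ (-r)` of `b_{ij}(u)`, as an element of the twisted super Yangian. -/
noncomputable def bCoeff {N : ℕ} (s ε : Fin (N + 1) → ℤˣ) (i j : Fin (N + 1)) (r : ℕ) :
    Alg s ε :=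
  RingQuot.mkAlgHom ℂ (Rel s ε) (freeCoeff ε i j r)

/-! ### Verma modules

A tuple of series `μ_i(u)` in `u⁻¹` is given by `μ : Fin (N + 1) → PowerSeries ℂ`, the variable of
the power series being `u⁻¹`. -/

/-- The left ideal generated by all coefficients of `b_{ij}(u)` for `i < j` and of
`b_{ii}(u) - μ_i(u)` for all `i`. (For a noncommutative ring, `Ideal` means left ideal.) -/
noncomputable def vermaIdeal {N : ℕ} (s ε : Fin (N + 1) → ℤˣ)
    (μ : Fin (N + 1) → PowerSeries ℂ) : Ideal (Alg s ε) :=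
  Ideal.span
    ({x | ∃ (i j : Fin (N + 1)) (r : ℕ), i < j ∧ x = bCoeff s ε i j r} ∪
      {x | ∃ (i : Fin (N + 1)) (r : ℕ),
        x = bCoeff s ε i i r - algebraMap ℂ (Alg s ε) (PowerSeries.coeff r (μ i))})

/-- The Verma module `M(μ(u))`, a left module over the twisted super Yangian. -/
abbrev VermaModule {N : ℕ} (s ε : Fin (N + 1) → ℤˣ) (μ : Fin (N + 1) → PowerSeries ℂ) : Type :=
  Alg s ε ⧸ vermaIdeal s ε μ

/-! ### Scalar series evaluated at `σ u + c` -/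

/-- `(σ u + c)⁻¹` as a power series in `x = u⁻¹`, namely `x (σ + c x)⁻¹`, for `σ ≠ 0`. -/
noncomputable def affineInv (σ c : ℂ) : PowerSeries ℂ :=
  PowerSeries.X * (PowerSeries.C σ + PowerSeries.C c * PowerSeries.X)⁻¹

/-- `f(σ u + c)` as a power series in `u⁻¹`, where `f(u) = ∑_r f_r u ^ (-r)`, for `σ ≠ 0`. -/
noncomputable def evalAffine (σ c : ℂ) (f : PowerSeries ℂ) : PowerSeries ℂ :=
  PowerSeries.subst (affineInv σ c) f

/-- The element `u` of `ℂ((u⁻¹))`; the variable of `LaurentSeries ℂ` is `u⁻¹`. -/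
noncomputable def uL : LaurentSeries ℂ := HahnSeries.single (-1 : ℤ) (1 : ℂ)

/-- The value at `w = σ u + c` of
`μ̃_i(w) = (2 w - ρ_{i+1}) μ_i(w) + ∑_{a > i} s_a μ_a(w)`, as an element of `ℂ((u⁻¹))`. -/
noncomputable def tildeMu {N : ℕ} (s : Fin (N + 1) → ℤˣ) (μ : Fin (N + 1) → PowerSeries ℂ)
    (i : Fin (N + 1)) (σ c : ℂ) : LaurentSeries ℂ :=
  (2 * (HahnSeries.C σ * uL + HahnSeries.C c) - HahnSeries.C (rhoSucc s i : ℂ)) *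
      (evalAffine σ c (μ i) : LaurentSeries ℂ)
    + ∑ a ∈ Finset.Ioi i,
        HahnSeries.C (((s a : ℤˣ) : ℤ) : ℂ) * (evalAffine σ c (μ a) : LaurentSeries ℂ)

end TwistedSuperYangian

/-!
The Verma module is nonzero exactly when its highest weight occurs in some representation, so the
theorem asks which tuples `μ` are highest weights. Put `x = u⁻¹`, `y = v⁻¹`, and let
`ν_i = x μ̃_i` (`nu`). Multiplied by `u⁻¹ (ρ_{i+1} - u)⁻¹`, the condition on `μ̃_i` and `μ̃_{i+1}`
becomes the identity of power series `ν_i σ(ν_i) = ν_{i+1} σ(ν_{i+1})` (`IsBalanced`,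
`tildeMu_iff_isBalanced`), where `σ` is the substitution `u ↦ ρ_{i+1} - u` (`reflect`).

Necessity. Let `1_μ` be the highest weight vector, `φ` a functional with `φ(1_μ) = 1`, and
`A_i(u, v) = φ(∑_a b_{ia}(u) b_{ai}(v) 1_μ)` (`pairing`). Since `b_{ii}(u)` and `b_{ii}(v)` act on
`1_μ` by scalars, their commutator shows that `A_i` is symmetric. Commuting `b_{ia}(u)` past
`b_{ai}(v)` for `a > i` gives a linear equation between `A_i`, the `A_a` with `a > i`, and the
`μ_a` (`IsHighest.pairing_eq`). In the difference of the equations for `i` and `i + 1` the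
unknowns enter only through `(u + v - ρ_{i+1}) (A_i - A_{i+1})`, so they disappear at
`v = ρ_{i+1} - u`; if `ρ_{i+1} = 0`, the common factor `u + v` is cancelled and the unitary
condition `A_i(u, -u) = 1` is used instead (`IsHighest.balance`). The condition on the last weight
is the unitary condition for `A_ϰ(u, v) = μ_ϰ(u) μ_ϰ(v)`.

Sufficiency. In matrix form (`reflectionEq_iff`) the reflection relation reads
`R(u - v) b₁(u) R(u + v) b₂(v) = b₂(v) R(u + v) b₁(u) R(u - v)` with `R(u) = 1 - P / u`. Let
`E_{ij}` be operators with the relations of the general linear Lie superalgebra and `E² = θ E`.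
Then `L(u) = 1 + E / (u - p)` obeys the exchange relations with `R`, and for `p + q = θ` the
matrix `(1 + E / (u - p)) b(u) (1 + E / (u - q))` again satisfies all defining relations
(`IsRep.dress`). As all algebras here are treated as ungraded, the signs between `E` and `b(u)`
are produced by involutions `Z_k` acting on the space of `E`. Suitable `E` are `s_j c_i a_j` for
bosonic and fermionic oscillators `c_i`, `a_j` on an eigenspace of the number operator (`IsFock`,
`exists_vacuum`). The vacuum can be given any weight `β` at a chosen index `h` and weight zero
after it. Then dressing keeps `μ_i` for `i > h` and multiplies `ν_h` by `(1 + β ζ) / (1 - β ζ)`,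
where `ζ = 1 / (u - ρ_{h+1} / 2)` satisfies `σ(ζ) = -ζ` (`exists_dressed`).

These weights suffice, because the statement that `1` lies in the left ideal defining the Verma
module involves only finitely many coefficients of `μ`: it is enough to realize `μ` modulo every
power `x ^ R` (`nontrivial_of_approx`). One starts with a one-dimensional representation that has
the right last weight (`nontrivial_of_scalar`) and corrects `μ_h` for `h` from the last but one
index downwards. At each level, the quotient `f` of the prescribed and the present `ν_h` satisfies
`f σ(f) ≡ 1`, because the present weight satisfies the necessary conditions. Approximating
`(1 + f) / 2` by a polynomial `∏ (1 + β ζ)` in `ζ` gives `f ≡ ∏ (1 + β ζ) / ∏ (1 - β ζ)`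
(`exists_quotient`), and a finite number of dressings produces this factor (`exists_approx_step`).
-/

namespace TwistedSuperYangian

open TensorProduct

/-! ### Dressing a solution of the reflection equation -/

/-- If `a b` and `a' b'` satisfy exchange relations with `r = R(u - v)` and `t = R(u + v)`, and
`k, l` solve the reflection equation and commute with them crosswise, then `a k a'` and `b l b'`
solve the reflection equation. -/
theorem reflection_dress {M : Type*} [Monoid M] {r t a b k l a' b' : M}
    (hrab : r * a * b = b * a * r) (hrab' : r * a' * b' = b' * a' * r)
    (ha'b : a' * t * b = b * t * a') (hab' : a * t * b' = b' * t * a)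
    (hkl : r * k * t * l = l * t * k * r)
    (hkb : k * b = b * k) (hal : a * l = l * a) (hal' : a' * l = l * a') (hkb' : k * b' = b' * k) :
    r * (a * k * a') * t * (b * l * b') = b * l * b' * t * (a * k * a') * r := by
  have e1 : r * (a * k * a') * t * (b * l * b') = r * a * (k * (a' * t * b) * (l * b')) := by
    simp only [mul_assoc]
  have e2 : r * a * (k * (a' * t * b) * (l * b')) = r * a * (k * b) * (t * (a' * l) * b') := by
    rw [ha'b]; simp only [mul_assoc]
  have e3 : r * a * (k * b) * (t * (a' * l) * b') = (r * a * b) * (k * t * l * (a' * b')) := by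
    rw [hkb, hal']; simp only [mul_assoc]
  have e4 : (r * a * b) * (k * t * l * (a' * b')) = b * a * (r * k * t * l) * (a' * b') := by
    rw [hrab]; simp only [mul_assoc]
  have e5 : b * a * (r * k * t * l) * (a' * b') = b * (a * l) * t * k * (r * a' * b') := by
    rw [hkl]; simp only [mul_assoc]
  have e6 : b * (a * l) * t * k * (r * a' * b') = b * l * a * t * (k * b') * a' * r := by
    rw [hal, hrab']; simp only [mul_assoc]
  have e7 : b * l * a * t * (k * b') * a' * r = b * l * (a * t * b') * k * a' * r := by
    rw [hkb']; simp only [mul_assoc]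
  rw [e1, e2, e3, e4, e5, e6, e7, hab']
  simp only [mul_assoc]

section Exchange

variable {R A : Type*} [CommRing R] [Ring A] [Algebra R A]

/-- The exchange relation `R(u - v) L₁(u) L₂(v) = L₂(v) L₁(u) R(u - v)` for `L = 1 + X E`,
where `X = 1 / (u - p)` and `X' = 1 / (v - p)`. Here `P` is the permutation of the two tensor
factors, `E` acts on the first factor, and `x = u⁻¹`, `y = v⁻¹`. -/
theorem exchange_same {P E : A} (hP : P * P = 1)
    (hE : E * (P * E * P) - P * E * P * E = E * P - P * E)
    (x y X X' : R) (h : (y - x) * (X * X') = x * y * (X' - X)) :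
    (algebraMap R A (y - x) - algebraMap R A (x * y) * P) * (1 + algebraMap R A X * E)
        * (P * (1 + algebraMap R A X' * E) * P)
      = P * (1 + algebraMap R A X' * E) * P * (1 + algebraMap R A X * E)
        * (algebraMap R A (y - x) - algebraMap R A (x * y) * P) := by
  have q1 : ∀ z : A, P * (P * z) = z := fun z => by rw [← mul_assoc, hP, one_mul]
  simp only [mul_add, add_mul, mul_sub, sub_mul, smul_mul_assoc,
    mul_smul_comm, smul_smul, mul_assoc, mul_one, one_mul, smul_add,
    hP, q1, Algebra.algebraMap_eq_smul_one, smul_sub] at hE ⊢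
  have h2 : (y - x) • ((X * X') • (E * (P * (E * P)) - P * (E * (P * E))))
      = (x * y * (X' - X)) • (E * P - P * E) := by rw [hE, smul_smul, h]
  rw [← sub_eq_zero] at h2 ⊢
  refine Eq.trans ?_ h2
  module

/-- The exchange relation `L₁(u) R(u + v) L₂(v) = L₂(v) R(u + v) L₁(u)` for `L = 1 + X E` and
different spectral shifts in the two factors that add up to the eigenvalue `θ` of `E`. -/
theorem exchange_cross {P E : A} (hP : P * P = 1)
    (hE : E * (P * E * P) - P * E * P * E = E * P - P * E) (θ : R)
    (hθ : E * E = algebraMap R A θ * E)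
    (x y X X' : R) (h : (x + y) * (X * X') = x * y * (X + X' + θ * (X * X'))) :
    (1 + algebraMap R A X * E) * (algebraMap R A (x + y) - algebraMap R A (x * y) * P)
        * (P * (1 + algebraMap R A X' * E) * P)
      = P * (1 + algebraMap R A X' * E) * P
        * (algebraMap R A (x + y) - algebraMap R A (x * y) * P) * (1 + algebraMap R A X * E) := by
  have q1 : ∀ z : A, P * (P * z) = z := fun z => by rw [← mul_assoc, hP, one_mul]
  have q2 : ∀ z : A, E * (E * z) = θ • (E * z) := fun z => by
    rw [← mul_assoc, hθ, ← Algebra.smul_def, smul_mul_assoc]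
  rw [← Algebra.smul_def] at hθ
  simp only [mul_add, add_mul, mul_sub, sub_mul, smul_mul_assoc,
    mul_smul_comm, smul_smul, mul_assoc, mul_one, one_mul, smul_add,
    hP, q1, q2, hθ, Algebra.algebraMap_eq_smul_one, smul_sub] at hE ⊢
  have h2 : (x + y) • ((X * X') • (E * (P * (E * P)) - P * (E * (P * E))))
      = (x * y * (X + X' + θ * (X * X'))) • (E * P - P * E) := by rw [hE, smul_smul, h]
  rw [← sub_eq_zero] at h2 ⊢
  refine Eq.trans ?_ h2
  module

end Exchange

/-! ### Matrix form of the reflection relation -/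

section Embed

variable {D : Type*} [Ring D]

/-- The underlying function of `embed`. -/
noncomputable def embedFun (k : Fin 2) (f : PowerSeries D) : MvPowerSeries (Fin 2) D :=
  fun m => if m = Finsupp.single k (m k) then PowerSeries.coeff (m k) f else 0

theorem coeff_embedFun (k : Fin 2) (f : PowerSeries D) (m : Fin 2 →₀ ℕ) :
    MvPowerSeries.coeff m (embedFun k f)
      = if m = Finsupp.single k (m k) then PowerSeries.coeff (m k) f else 0 := rfl

/-- A series in one variable regarded as a series in the variable number `k` of two variables:
`embed 0 f = f(u)` and `embed 1 f = f(v)`. -/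
noncomputable def embed (k : Fin 2) : PowerSeries D →+* MvPowerSeries (Fin 2) D where
  toFun := embedFun k
  map_zero' := by
    ext m
    simp [coeff_embedFun]
  map_add' f g := by
    ext m
    simp only [map_add, coeff_embedFun]
    split_ifs <;> simp
  map_one' := by
    classical
    ext m
    rw [MvPowerSeries.coeff_one, coeff_embedFun, PowerSeries.coeff_one]
    by_cases h : m = Finsupp.single k (m k)
    · by_cases h2 : m k = 0
      · rw [h2, Finsupp.single_zero] at h
        simp [h]
      · have : m ≠ 0 := fun h3 => h2 (by simp [h3])
        simp [h2, this]
    · have : m ≠ 0 := fun h3 => h (by simp [h3])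
      simp [h, this]
  map_mul' f g := by
    classical
    ext m
    rw [MvPowerSeries.coeff_mul]
    simp only [coeff_embedFun]
    by_cases h : m = Finsupp.single k (m k)
    · rw [if_pos h]
      generalize m k = r at h
      subst h
      rw [Finsupp.antidiagonal_single, Finset.sum_map, PowerSeries.coeff_mul]
      refine Finset.sum_congr rfl fun p _ => ?_
      simp
    · rw [if_neg h]
      symm
      refine Finset.sum_eq_zero fun p hp => ?_
      rw [Finset.HasAntidiagonal.mem_antidiagonal] at hp
      by_cases h1 : p.1 = Finsupp.single k (p.1 k)
      · by_cases h2 : p.2 = Finsupp.single k (p.2 k)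
        · exfalso
          apply h
          rw [← hp, h1, h2]
          simp
        · simp [h2]
      · simp [h1]

theorem coeff_embed (k : Fin 2) (f : PowerSeries D) (m : Fin 2 →₀ ℕ) :
    MvPowerSeries.coeff m (embed k f)
      = if m = Finsupp.single k (m k) then PowerSeries.coeff (m k) f else 0 := rfl

theorem embed_C (k : Fin 2) (d : D) : embed k (PowerSeries.C d) = MvPowerSeries.C d := by
  classical
  ext m
  rw [coeff_embed, MvPowerSeries.coeff_C, PowerSeries.coeff_C]
  by_cases h : m = Finsupp.single k (m k)
  · by_cases h2 : m k = 0
    · rw [h2, Finsupp.single_zero] at h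
      simp [h]
    · have : m ≠ 0 := fun h3 => h2 (by simp [h3])
      simp [h2, this]
  · have : m ≠ 0 := fun h3 => h (by simp [h3])
    simp [h, this]

theorem embed_X (k : Fin 2) : embed k (PowerSeries.X : PowerSeries D) = MvPowerSeries.X k := by
  classical
  ext m
  rw [coeff_embed, MvPowerSeries.coeff_X, PowerSeries.coeff_X]
  by_cases h : m = Finsupp.single k (m k)
  · rw [if_pos h]
    by_cases h2 : m k = 1
    · rw [h2] at h
      simp [h]
    · have : m ≠ Finsupp.single k 1 := fun h3 => h2 (by simp [h3])
      simp [h2, this]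
  · have : m ≠ Finsupp.single k 1 := fun h3 => h (by simp [h3])
    simp [h, this]

theorem map_embed {D' : Type*} [Ring D'] (φ : D →+* D') (k : Fin 2) (f : PowerSeries D) :
    MvPowerSeries.map φ (embed k f) = embed k (PowerSeries.map φ f) := by
  ext m
  rw [MvPowerSeries.coeff_map, coeff_embed, coeff_embed, PowerSeries.coeff_map]
  split_ifs <;> simp

end Embed

/-- Series with coefficients in a `ℂ`-algebra form an algebra over the series with complex
coefficients. -/
noncomputable instance seriesAlgebra (D : Type*) [Ring D] [Algebra ℂ D] :
    Algebra (MvPowerSeries (Fin 2) ℂ) (MvPowerSeries (Fin 2) D) :=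
  (MvPowerSeries.map (algebraMap ℂ D)).toAlgebra' fun c f => by
    classical
    ext m
    rw [MvPowerSeries.coeff_mul, MvPowerSeries.coeff_mul]
    refine Finset.sum_nbij' Prod.swap Prod.swap ?_ ?_ (fun _ _ => rfl) (fun _ _ => rfl) ?_
    · intro p hp
      simpa [add_comm] using hp
    · intro p hp
      simpa [add_comm] using hp
    · intro p _
      simp only [MvPowerSeries.coeff_map, Prod.fst_swap, Prod.snd_swap]
      exact Algebra.commutes _ _

theorem seriesAlgebra_algebraMap {D : Type*} [Ring D] [Algebra ℂ D] (f : MvPowerSeries (Fin 2) ℂ) :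
    algebraMap (MvPowerSeries (Fin 2) ℂ) (MvPowerSeries (Fin 2) D) f
      = MvPowerSeries.map (algebraMap ℂ D) f := rfl

variable {N : ℕ}

/-- The sign `(-1)^{|i||j|}`. -/
def sgn (s : Fin (N + 1) → ℤˣ) (i j : Fin (N + 1)) : ℤ := (-1) ^ (parity s i * parity s j)

theorem parity_cases (s : Fin (N + 1) → ℤˣ) (i : Fin (N + 1)) : parity s i = 0 ∨ parity s i = 1 := by
  unfold parity
  split_ifs <;> simp

theorem sgn_comm (s : Fin (N + 1) → ℤˣ) (i j : Fin (N + 1)) : sgn s i j = sgn s j i := by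
  rw [sgn, sgn, mul_comm]

theorem sgn_mul_self (s : Fin (N + 1) → ℤˣ) (i j : Fin (N + 1)) : sgn s i j * sgn s i j = 1 := by
  rw [sgn, ← pow_add, ← two_mul, pow_mul]
  simp

theorem sgn_self (s : Fin (N + 1) → ℤˣ) (i : Fin (N + 1)) : sgn s i i = (s i : ℤ) := by
  rcases Int.units_eq_one_or (s i) with h | h <;> simp [sgn, parity, h]

section Braid

variable {S : Type*} [Ring S] (s : Fin (N + 1) → ℤˣ)

/-- The super permutation operator `e_i ⊗ e_k ↦ (-1)^{|i||k|} e_k ⊗ e_i`. -/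
def braid (S : Type*) [Ring S] (s : Fin (N + 1) → ℤˣ) :
    Matrix (Fin (N + 1) × Fin (N + 1)) (Fin (N + 1) × Fin (N + 1)) S :=
  fun p q => if q = (p.2, p.1) then (sgn s p.1 p.2 : S) else 0

theorem braid_mul_apply (M : Matrix (Fin (N + 1) × Fin (N + 1)) (Fin (N + 1) × Fin (N + 1)) S)
    (i k : Fin (N + 1)) (q : Fin (N + 1) × Fin (N + 1)) :
    (braid S s * M) (i, k) q = sgn s i k • M (k, i) q := by
  rw [Matrix.mul_apply, Finset.sum_eq_single (k, i)]
  · simp [braid, zsmul_eq_mul]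
  · intro b _ hb
    simp [braid, hb]
  · simp

theorem mul_braid_apply (M : Matrix (Fin (N + 1) × Fin (N + 1)) (Fin (N + 1) × Fin (N + 1)) S)
    (p : Fin (N + 1) × Fin (N + 1)) (j l : Fin (N + 1)) :
    (M * braid S s) p (j, l) = sgn s j l • M p (l, j) := by
  rw [Matrix.mul_apply, Finset.sum_eq_single (l, j)]
  · simp only [braid, if_true]
    rw [zsmul_eq_mul, sgn_comm]
    exact (Int.cast_commute _ _).eq.symm
  · intro b _ hb
    have : ¬ ((j, l) = (b.2, b.1)) := by
      intro h
      apply hb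
      rw [Prod.ext_iff] at h
      exact Prod.ext h.2.symm h.1.symm
    simp [braid, this]
  · simp

theorem braid_mul_braid : braid S s * braid S s = 1 := by
  ext ⟨i, k⟩ ⟨j, l⟩
  rw [braid_mul_apply]
  by_cases h : i = j ∧ k = l
  · obtain ⟨rfl, rfl⟩ := h
    simp only [braid, if_true, Matrix.one_apply_eq, zsmul_eq_mul, ← Int.cast_mul]
    rw [sgn_comm s k i, sgn_mul_self, Int.cast_one]
  · have h1 : ¬ ((j, l) = (i, k)) := fun h2 =>
      h ⟨(Prod.ext_iff.1 h2).1.symm, (Prod.ext_iff.1 h2).2.symm⟩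
    rw [Matrix.one_apply_ne (fun h2 => h1 h2.symm)]
    simp [braid, h1]

/-- A matrix acting on the first tensor factor, `M ⊗ 1`. -/
noncomputable def side (S : Type*) [Ring S] (N : ℕ) :
    Matrix (Fin (N + 1)) (Fin (N + 1)) S →+*
      Matrix (Fin (N + 1) × Fin (N + 1)) (Fin (N + 1) × Fin (N + 1)) S :=
  (Matrix.blockDiagonalRingHom (Fin (N + 1)) (Fin (N + 1)) S).comp
    (Pi.constRingHom (Fin (N + 1)) (Matrix (Fin (N + 1)) (Fin (N + 1)) S))

theorem side_apply (M : Matrix (Fin (N + 1)) (Fin (N + 1)) S) (i k j l : Fin (N + 1)) :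
    side S N M (i, k) (j, l) = if k = l then M i j else 0 := by
  simp [side, Matrix.blockDiagonal_apply]

theorem side_mul_apply (M : Matrix (Fin (N + 1)) (Fin (N + 1)) S)
    (M' : Matrix (Fin (N + 1) × Fin (N + 1)) (Fin (N + 1) × Fin (N + 1)) S) (i k : Fin (N + 1))
    (q : Fin (N + 1) × Fin (N + 1)) :
    (side S N M * M') (i, k) q = ∑ a, M i a * M' (a, k) q := by
  rw [Matrix.mul_apply, Fintype.sum_prod_type]
  refine Finset.sum_congr rfl fun a _ => ?_
  rw [Finset.sum_eq_single k]
  · rw [side_apply, if_pos rfl]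
  · intro b _ hb
    rw [side_apply, if_neg hb.symm, zero_mul]
  · simp

/-- The entries of `P M₁ P = M₂`, which acts on the second tensor factor. -/
theorem braid_side_braid_apply (M : Matrix (Fin (N + 1)) (Fin (N + 1)) S) (i k j l : Fin (N + 1)) :
    (braid S s * side S N M * braid S s) (i, k) (j, l)
      = if i = j then (sgn s i k * sgn s j l) • M k l else 0 := by
  rw [mul_braid_apply, braid_mul_apply, side_apply]
  split_ifs
  · rw [smul_smul, mul_comm]
  · simp

theorem side_mul_second_apply (U V : Matrix (Fin (N + 1)) (Fin (N + 1)) S) (i k j l : Fin (N + 1)) :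
    (side S N U * (braid S s * side S N V * braid S s)) (i, k) (j, l)
      = (sgn s j k * sgn s j l) • (U i j * V k l) := by
  simp only [side_mul_apply, braid_side_braid_apply]
  rw [Finset.sum_eq_single j]
  · rw [if_pos rfl, mul_smul_comm]
  · intro b _ hb
    rw [if_neg hb, mul_zero]
  · simp

theorem second_mul_side_apply (U V : Matrix (Fin (N + 1)) (Fin (N + 1)) S) (i k j l : Fin (N + 1)) :
    (braid S s * side S N V * braid S s * side S N U) (i, k) (j, l)
      = (sgn s i k * sgn s i l) • (V k l * U i j) := by
  rw [mul_assoc, mul_assoc, braid_mul_apply, side_mul_apply]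
  simp only [braid_mul_apply, side_apply]
  rw [Finset.sum_eq_single l]
  · rw [if_pos rfl, mul_smul_comm, smul_smul, sgn_comm s l i]
  · intro b _ hb
    rw [if_neg hb, smul_zero, mul_zero]
  · simp

/-- Commutation of `U₁` with `V₂` amounts to sign commutation of the entries. -/
theorem side_commute_second {U V : Matrix (Fin (N + 1)) (Fin (N + 1)) S}
    (h : ∀ i j k l, (sgn s j k * sgn s j l) • (U i j * V k l)
      = (sgn s i k * sgn s i l) • (V k l * U i j)) :
    side S N U * (braid S s * side S N V * braid S s)
      = braid S s * side S N V * braid S s * side S N U := by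
  ext ⟨i, k⟩ ⟨j, l⟩
  rw [side_mul_second_apply, second_mul_side_apply, h]

end Braid

section Reflection

variable {D : Type*} [Ring D] [Algebra ℂ D]

/-- The reflection relation for the entries of matrices `U = b(u)` and `V = b(v)`, in the cleared
form of `reflectionLHS` and `reflectionRHS`. -/
def ReflectionRel (s : Fin (N + 1) → ℤˣ)
    (U V : Matrix (Fin (N + 1)) (Fin (N + 1)) (MvPowerSeries (Fin 2) D))
    (i j k l : Fin (N + 1)) : Prop :=
  let x : MvPowerSeries (Fin 2) D := MvPowerSeries.X 0
  let y : MvPowerSeries (Fin 2) D := MvPowerSeries.X 1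
  let τ : MvPowerSeries (Fin 2) D :=
    (-1) ^ (parity s i * parity s j + parity s i * parity s k + parity s j * parity s k)
  (y ^ 2 - x ^ 2) * (U i j * V k l
      - (-1) ^ ((parity s i + parity s j) * (parity s k + parity s l)) * (V k l * U i j))
    = x * y * (x + y) * (τ * (U k j * V i l - V k j * U i l))
      + x * y * (y - x) * (τ * ((if k = j then ∑ a, U i a * V a l else 0)
          - (if i = l then ∑ a, V k a * U a j else 0)))
      - x ^ 2 * y ^ 2 * (if i = j then (∑ a, U k a * V a l) - ∑ a, V k a * U a l else 0)

/-- The matrix form `R(u - v) b₁(u) R(u + v) b₂(v) = b₂(v) R(u + v) b₁(u) R(u - v)` of the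
reflection relation, with denominators cleared. -/
def ReflectionEq (s : Fin (N + 1) → ℤˣ)
    (U V : Matrix (Fin (N + 1)) (Fin (N + 1)) (MvPowerSeries (Fin 2) D)) : Prop :=
  let 𝓐 := Matrix (Fin (N + 1) × Fin (N + 1)) (Fin (N + 1) × Fin (N + 1)) (MvPowerSeries (Fin 2) D)
  let x : MvPowerSeries (Fin 2) ℂ := MvPowerSeries.X 0
  let y : MvPowerSeries (Fin 2) ℂ := MvPowerSeries.X 1
  let P : 𝓐 := braid _ s
  let rm : 𝓐 := algebraMap _ 𝓐 (y - x) - algebraMap _ 𝓐 (x * y) * P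
  let rp : 𝓐 := algebraMap _ 𝓐 (x + y) - algebraMap _ 𝓐 (x * y) * P
  rm * side _ N U * rp * (P * side _ N V * P) = P * side _ N V * P * rp * side _ N U * rm

/-- Expansion of the reflection equation, with `P² = 1` used to bring every term to a form whose
entries can be read off. -/
theorem reflection_expand {R A : Type*} [CommRing R] [Ring A] [Algebra R A] {P K L : A}
    (hP : P * P = 1) (a b e : R) :
    (algebraMap R A a - algebraMap R A e * P) * K * (algebraMap R A b - algebraMap R A e * P)
        * (P * L * P)
      - P * L * P * (algebraMap R A b - algebraMap R A e * P) * K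
        * (algebraMap R A a - algebraMap R A e * P)
      = (a * b) • (K * (P * L * P) - P * L * P * K)
        - (e * b) • (P * (K * (P * L * P)) - P * L * P * K * P)
        - (e * a) • (K * L * P - P * (L * K)) + (e * e) • (P * (K * L - L * K) * P) := by
  have q1 : ∀ z : A, P * (P * z) = z := fun z => by rw [← mul_assoc, hP, one_mul]
  simp only [mul_sub, sub_mul, smul_mul_assoc, mul_smul_comm, smul_smul, mul_assoc, mul_one,
    one_mul, hP, q1, Algebra.algebraMap_eq_smul_one, smul_sub]
  module

theorem X_eq_algebraMap (k : Fin 2) : (MvPowerSeries.X k : MvPowerSeries (Fin 2) D)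
    = algebraMap (MvPowerSeries (Fin 2) ℂ) _ (MvPowerSeries.X k) := by
  rw [seriesAlgebra_algebraMap, MvPowerSeries.map_X]

/-- The entries of the right-hand side of `reflection_expand`. -/
theorem reflection_entry (s : Fin (N + 1) → ℤˣ)
    (U V : Matrix (Fin (N + 1)) (Fin (N + 1)) (MvPowerSeries (Fin 2) D))
    (a b e : MvPowerSeries (Fin 2) ℂ) (i j k l : Fin (N + 1)) :
    ((a * b) • (side _ N U * (braid _ s * side _ N V * braid _ s)
            - braid _ s * side _ N V * braid _ s * side _ N U)
        - (e * b) • (braid _ s * (side _ N U * (braid _ s * side _ N V * braid _ s))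
            - braid _ s * side _ N V * braid _ s * side _ N U * braid _ s)
        - (e * a) • (side _ N U * side _ N V * braid _ s - braid _ s * (side _ N V * side _ N U))
        + (e * e) • (braid _ s * (side _ N U * side _ N V - side _ N V * side _ N U) * braid _ s) :
        Matrix (Fin (N + 1) × Fin (N + 1)) (Fin (N + 1) × Fin (N + 1)) (MvPowerSeries (Fin 2) D))
        (i, k) (j, l)
      = (a * b) • ((sgn s j k * sgn s j l) • (U i j * V k l)
            - (sgn s i k * sgn s i l) • (V k l * U i j))
        - (e * b) • (sgn s i k • (sgn s j i * sgn s j l) • (U k j * V i l)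
            - sgn s j l • (sgn s i k * sgn s i j) • (V k j * U i l))
        - (e * a) • (sgn s j l • (if k = j then (∑ a, U i a * V a l) else 0)
            - sgn s i k • (if i = l then (∑ a, V k a * U a j) else 0))
        + (e * e) • (if i = j then (sgn s i k * sgn s j l) •
            ((∑ a, U k a * V a l) - ∑ a, V k a * U a l) else 0) := by
  rw [← map_mul, ← map_mul, ← map_sub]
  simp only [Matrix.add_apply, Matrix.sub_apply, Matrix.smul_apply, braid_side_braid_apply]
  rw [side_mul_second_apply, second_mul_side_apply, braid_mul_apply, side_mul_second_apply,
    mul_braid_apply, second_mul_side_apply, mul_braid_apply, side_apply, braid_mul_apply,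
    side_apply]
  simp only [Matrix.mul_apply]

omit [Algebra ℂ D] in
theorem neg_one_pow_mul (n : ℕ) (z : MvPowerSeries (Fin 2) D) :
    (-1) ^ n * z = ((-1 : ℤ) ^ n) • z := by
  rw [zsmul_eq_mul]
  simp

/-- The bookkeeping of signs in `reflectionEq_iff`: the terms of the matrix entry carry the signs
`κ, a₂, …, a₇`, those of the reflection relation the signs `β` and `τ`. The hypotheses `h₅`, `h₆`
and `h₇` compare signs only where the Kronecker deltas in `T₅`, `T₆` and `T₇` do not vanish. -/
theorem reflection_signs {R M : Type*} [CommRing R] [AddCommGroup M] [Module R M] (x y : R)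
    {T₁ T₂ T₃ T₄ T₅ T₆ T₇ : M} {κ τ β a₂ a₃ a₄ a₅ a₆ a₇ : ℤ} (h₁ : κ * κ = 1) (h₂ : β = κ * a₂)
    (h₃ : τ = κ * a₃) (h₄ : τ = κ * a₄) (h₅ : τ • T₅ = (κ * a₅) • T₅)
    (h₆ : τ • T₆ = (κ * a₆) • T₆) (h₇ : T₇ = (κ * a₇) • T₇) :
    (y ^ 2 - x ^ 2) • (T₁ - β • T₂)
        - ((x * y * (x + y)) • τ • (T₃ - T₄) + (x * y * (y - x)) • τ • (T₅ - T₆)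
          - (x ^ 2 * y ^ 2) • T₇)
      = κ • (((y - x) * (x + y)) • (κ • T₁ - a₂ • T₂) - (x * y * (x + y)) • (a₃ • T₃ - a₄ • T₄)
          - (x * y * (y - x)) • (a₅ • T₅ - a₆ • T₆) + (x * y * (x * y)) • a₇ • T₇) := by
  have e1 : T₁ = κ • κ • T₁ := by rw [smul_smul, h₁, one_smul]
  have e3 : τ • T₃ = κ • a₃ • T₃ := by rw [smul_smul, h₃]
  have e4 : τ • T₄ = κ • a₄ • T₄ := by rw [smul_smul, h₄]
  rw [smul_sub τ, smul_sub τ, h₅, h₆, e3, e4, h₂]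
  nth_rewrite 1 [e1]
  nth_rewrite 1 [h₇]
  module

/-- The matrix reflection equation is equivalent to the reflection relation for all entries: the
entry `((i, k), (j, l))` of the former is the latter up to the sign `(-1)^{|j||k| + |j||l|}`. -/
theorem reflectionEq_iff (s : Fin (N + 1) → ℤˣ)
    (U V : Matrix (Fin (N + 1)) (Fin (N + 1)) (MvPowerSeries (Fin 2) D)) :
    ReflectionEq s U V ↔ ∀ i j k l, ReflectionRel s U V i j k l := by
  unfold ReflectionEq
  simp only []
  rw [← sub_eq_zero, reflection_expand (braid_mul_braid s), ← Matrix.ext_iff]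
  simp only [Prod.forall, reflection_entry, Matrix.zero_apply]
  have hκ : ∀ (j k l : Fin (N + 1)) (z : MvPowerSeries (Fin 2) D),
      z = 0 ↔ (sgn s j k * sgn s j l) • z = 0 := fun j k l z => by
    constructor
    · rintro rfl
      rw [smul_zero]
    · intro h
      have h1 : (sgn s j k * sgn s j l) • (sgn s j k * sgn s j l) • z = 0 := by rw [h, smul_zero]
      rwa [smul_smul, mul_mul_mul_comm, sgn_mul_self, sgn_mul_self, one_mul, one_smul] at h1
  have comm : ∀ p : Fin (N + 1) → Fin (N + 1) → Fin (N + 1) → Fin (N + 1) → Prop,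
      (∀ i k j l, p i k j l) ↔ ∀ i j k l, p i k j l :=
    fun p => ⟨fun h i j k l => h i k j l, fun h i k j l => h i j k l⟩
  rw [comm]
  refine forall_congr' fun i => forall_congr' fun j => forall_congr' fun k =>
    forall_congr' fun l => ?_
  rw [hκ j k l]
  unfold ReflectionRel
  simp only [X_eq_algebraMap (D := D), ← map_pow, ← map_mul, ← map_add, ← map_sub,
    ← Algebra.smul_def, neg_one_pow_mul]
  rw [← sub_eq_zero (b := _ - _)]
  refine Eq.congr ?_ rfl
  have hite : ∀ (p : Prop) [Decidable p] (n : ℤ) (z : MvPowerSeries (Fin 2) D),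
      (if p then n • z else 0) = n • (if p then z else 0) := fun p _ n z => by
    split_ifs <;> simp
  rw [hite]
  simp only [smul_smul (sgn s i k), smul_smul (sgn s j l)]
  symm
  apply reflection_signs
  · rw [mul_mul_mul_comm, sgn_mul_self, sgn_mul_self, one_mul]
  · rcases parity_cases s i with hi | hi <;> rcases parity_cases s j with hj | hj <;>
    rcases parity_cases s k with hk | hk <;> rcases parity_cases s l with hl | hl <;>
    simp [sgn, hi, hj, hk, hl]
  · rcases parity_cases s i with hi | hi <;> rcases parity_cases s j with hj | hj <;>
    rcases parity_cases s k with hk | hk <;> rcases parity_cases s l with hl | hl <;>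
    simp [sgn, hi, hj, hk, hl]
  · rcases parity_cases s i with hi | hi <;> rcases parity_cases s j with hj | hj <;>
    rcases parity_cases s k with hk | hk <;> rcases parity_cases s l with hl | hl <;>
    simp [sgn, hi, hj, hk, hl]
  · split_ifs with h
    · subst h
      congr 1
      rcases parity_cases s i with hi | hi <;>
      rcases parity_cases s k with hk | hk <;> rcases parity_cases s l with hl | hl <;>
      simp [sgn, hi, hk, hl]
    · simp
  · split_ifs with h
    · subst h
      congr 1
      rcases parity_cases s i with hi | hi <;> rcases parity_cases s j with hj | hj <;>
      rcases parity_cases s k with hk | hk <;>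
      simp [sgn, hi, hk, hj]
    · simp
  · split_ifs with h
    · subst h
      rw [mul_mul_mul_comm, sgn_mul_self, sgn_mul_self, one_mul, one_smul]
    · simp

end Reflection

/-! ### Matrices satisfying the defining relations -/

section Negate

variable {D : Type*} [Ring D]

/-- The substitution `u ↦ -u` in series with noncommutative coefficients. -/
noncomputable def negate : PowerSeries D →+* PowerSeries D where
  toFun f := PowerSeries.mk fun r => (-1) ^ r * PowerSeries.coeff r f
  map_zero' := by ext; simp
  map_add' f g := by ext; simp [mul_add]
  map_one' := by
    ext n
    rw [PowerSeries.coeff_mk, PowerSeries.coeff_one]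
    split_ifs with h
    · simp [h]
    · simp
  map_mul' f g := by
    ext n
    rw [PowerSeries.coeff_mk, PowerSeries.coeff_mul, PowerSeries.coeff_mul, Finset.mul_sum]
    refine Finset.sum_congr rfl fun p hp => ?_
    rw [Finset.HasAntidiagonal.mem_antidiagonal] at hp
    rw [PowerSeries.coeff_mk, PowerSeries.coeff_mk, ← hp, pow_add]
    have h : (-1 : D) ^ p.2 * PowerSeries.coeff p.1 f = PowerSeries.coeff p.1 f * (-1) ^ p.2 :=
      ((Commute.neg_one_left _).pow_left _).eq
    simp only [mul_assoc]
    rw [← mul_assoc (_ ^ p.2) _ _, h, mul_assoc]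

theorem coeff_negate (r : ℕ) (f : PowerSeries D) :
    PowerSeries.coeff r (negate f) = (-1) ^ r * PowerSeries.coeff r f := by
  simp [negate]

theorem negate_C (d : D) : negate (PowerSeries.C d) = PowerSeries.C d := by
  ext n
  rw [coeff_negate, PowerSeries.coeff_C]
  split_ifs with h
  · simp [h]
  · simp

theorem negate_X : negate (PowerSeries.X : PowerSeries D) = -PowerSeries.X := by
  ext n
  rw [coeff_negate, map_neg, PowerSeries.coeff_X]
  split_ifs with h
  · simp [h]
  · simp

theorem map_negate {D' : Type*} [Ring D'] (φ : D →+* D') (f : PowerSeries D) :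
    PowerSeries.map φ (negate f) = negate (PowerSeries.map φ f) := by
  ext n
  simp [coeff_negate]

end Negate

section Representation

variable {D : Type*} [Ring D] [Algebra ℂ D]

/-- A matrix of series over `D` satisfying the defining relations of the twisted super Yangian. The
reflection relation is required in matrix form, with `u⁻¹` and `v⁻¹` as the two variables. -/
structure IsRep (s ε : Fin (N + 1) → ℤˣ) (b : Matrix (Fin (N + 1)) (Fin (N + 1)) (PowerSeries D)) :
    Prop where
  const : ∀ i j, PowerSeries.constantCoeff (b i j) = if i = j then ((ε i : ℤ) : D) else 0
  refl : ReflectionEq s ((embed 0).mapMatrix b) ((embed 1).mapMatrix b)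
  unit : b * negate.mapMatrix b = 1

theorem freeAlg_lift_freeCoeff {s ε : Fin (N + 1) → ℤˣ}
    {b : Matrix (Fin (N + 1)) (Fin (N + 1)) (PowerSeries D)} (hb : IsRep s ε b)
    (i j : Fin (N + 1)) (r : ℕ) :
    FreeAlgebra.lift ℂ (fun p : Fin (N + 1) × Fin (N + 1) × ℕ =>
      PowerSeries.coeff (p.2.2 + 1) (b p.1 p.2.1)) (freeCoeff ε i j r)
      = PowerSeries.coeff r (b i j) := by
  cases r with
  | zero =>
    rw [PowerSeries.coeff_zero_eq_constantCoeff_apply, hb.const, freeCoeff]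
    split_ifs <;> simp
  | succ r => simp [freeCoeff]

theorem bU_eq (ε : Fin (N + 1) → ℤˣ) (i j : Fin (N + 1)) :
    bU ε i j = embed 0 (bSeries ε i j) := by
  ext m
  rw [coeff_embed, bSeries, PowerSeries.coeff_mk]
  change (if _ then _ else _) = _
  refine if_congr ?_ rfl rfl
  rw [Finsupp.ext_iff]
  simp [Fin.forall_fin_two]

theorem bV_eq (ε : Fin (N + 1) → ℤˣ) (i j : Fin (N + 1)) :
    bV ε i j = embed 1 (bSeries ε i j) := by
  ext m
  rw [coeff_embed, bSeries, PowerSeries.coeff_mk]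
  change (if _ then _ else _) = _
  refine if_congr ?_ rfl rfl
  rw [Finsupp.ext_iff]
  simp [Fin.forall_fin_two]

theorem bSeriesNeg_eq (ε : Fin (N + 1) → ℤˣ) (i j : Fin (N + 1)) :
    bSeriesNeg ε i j = negate (bSeries ε i j) := by
  ext m
  rw [coeff_negate, bSeries, bSeriesNeg, PowerSeries.coeff_mk, PowerSeries.coeff_mk]

omit [Algebra ℂ D] in
/-- Under a ring homomorphism from the free algebra, the cleared reflection relation between the
formal generators becomes the relation between their images. -/
theorem map_reflection_iff (s ε : Fin (N + 1) → ℤˣ) (φ : FreeAlg N →+* D) (i j k l : Fin (N + 1)) :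
    MvPowerSeries.map φ (reflectionLHS s ε i j k l) = MvPowerSeries.map φ (reflectionRHS s ε i j k l)
      ↔ ReflectionRel s
        (Matrix.of fun i j => embed 0 (PowerSeries.map φ (bSeries ε i j)))
        (Matrix.of fun i j => embed 1 (PowerSeries.map φ (bSeries ε i j))) i j k l := by
  have hite : ∀ (p : Prop) [Decidable p] (z : FreeSeries₂ N),
      MvPowerSeries.map φ (if p then z else 0) = if p then MvPowerSeries.map φ z else 0 :=
    fun p _ z => by split_ifs <;> simp
  unfold ReflectionRel reflectionLHS reflectionRHS superBracket sign₃
  simp only [bU_eq, bV_eq, map_mul, map_add, map_sub, map_pow, map_neg, map_one, map_sum, hite,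
    map_embed, MvPowerSeries.map_X, Matrix.of_apply]

/-- A matrix satisfying the defining relations gives a homomorphism from the twisted super
Yangian. -/
theorem IsRep.exists_algHom {s ε : Fin (N + 1) → ℤˣ}
    {b : Matrix (Fin (N + 1)) (Fin (N + 1)) (PowerSeries D)} (hb : IsRep s ε b) :
    ∃ φ : Alg s ε →ₐ[ℂ] D, ∀ i j r, φ (bCoeff s ε i j r) = PowerSeries.coeff r (b i j) := by
  set ψ := FreeAlgebra.lift ℂ (fun p : Fin (N + 1) × Fin (N + 1) × ℕ =>
      PowerSeries.coeff (p.2.2 + 1) (b p.1 p.2.1)) with hψ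
  have hser : ∀ i j, PowerSeries.map (ψ : FreeAlg N →+* D) (bSeries ε i j) = b i j := by
    intro i j
    ext r
    rw [PowerSeries.coeff_map, bSeries, PowerSeries.coeff_mk]
    exact freeAlg_lift_freeCoeff hb i j r
  have hrel : ∀ ⦃x y : FreeAlg N⦄, Rel s ε x y → ψ x = ψ y := by
    intro x y h
    cases h with
    | reflection i j k l m =>
      have h1 := (reflectionEq_iff s _ _).1 hb.refl i j k l
      have h2 := (map_reflection_iff s ε (ψ : FreeAlg N →+* D) i j k l).2
      simp only [hser] at h2
      have h3 := congrArg (MvPowerSeries.coeff m) (h2 h1)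
      rw [MvPowerSeries.coeff_map, MvPowerSeries.coeff_map] at h3
      exact h3
    | unitary i j r =>
      have h1 : PowerSeries.map (ψ : FreeAlg N →+* D) (∑ a, bSeries ε i a * bSeriesNeg ε a j)
          = PowerSeries.map (ψ : FreeAlg N →+* D) (if i = j then 1 else 0) := by
        have h2 := congrFun (congrFun hb.unit i) j
        rw [Matrix.mul_apply] at h2
        simp only [map_sum, map_mul, bSeriesNeg_eq, map_negate, hser]
        refine Eq.trans h2 ?_
        rw [Matrix.one_apply]
        split_ifs <;> simp
      have h3 := congrArg (PowerSeries.coeff r) h1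
      rw [PowerSeries.coeff_map, PowerSeries.coeff_map] at h3
      exact h3
  refine ⟨RingQuot.liftAlgHom ℂ ⟨ψ, hrel⟩, fun i j r => ?_⟩
  rw [bCoeff, RingQuot.liftAlgHom_mkAlgHom_apply]
  exact freeAlg_lift_freeCoeff hb i j r

/-- The matrix of generating series of the twisted super Yangian. -/
noncomputable def genMatrix (s ε : Fin (N + 1) → ℤˣ) :
    Matrix (Fin (N + 1)) (Fin (N + 1)) (PowerSeries (Alg s ε)) :=
  Matrix.of fun i j => PowerSeries.mk fun r => bCoeff s ε i j r

theorem genMatrix_eq (s ε : Fin (N + 1) → ℤˣ) (i j : Fin (N + 1)) :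
    genMatrix s ε i j
      = PowerSeries.map (RingQuot.mkAlgHom ℂ (Rel s ε) : FreeAlg N →+* Alg s ε) (bSeries ε i j) := by
  ext r
  simp only [genMatrix, bSeries, bCoeff, Matrix.of_apply, PowerSeries.coeff_mk,
    PowerSeries.coeff_map]
  rfl

theorem isRep_genMatrix (s ε : Fin (N + 1) → ℤˣ) : IsRep s ε (genMatrix s ε) where
  const i j := by
    rw [← PowerSeries.coeff_zero_eq_constantCoeff_apply, genMatrix, Matrix.of_apply,
      PowerSeries.coeff_mk, bCoeff, freeCoeff]
    split_ifs <;> simp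
  refl := by
    rw [reflectionEq_iff]
    intro i j k l
    have h := (map_reflection_iff s ε
      (RingQuot.mkAlgHom ℂ (Rel s ε) : FreeAlg N →+* Alg s ε) i j k l).1 ?_
    · simp only [← genMatrix_eq] at h
      exact h
    · ext m
      rw [MvPowerSeries.coeff_map, MvPowerSeries.coeff_map]
      exact RingQuot.mkAlgHom_rel ℂ (Rel.reflection i j k l m)
  unit := by
    ext i j r
    rw [Matrix.mul_apply]
    have h := RingQuot.mkAlgHom_rel ℂ (Rel.unitary (s := s) (ε := ε) i j r)
    have h2 : ∀ f : PowerSeries (FreeAlg N), RingQuot.mkAlgHom ℂ (Rel s ε) (PowerSeries.coeff r f)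
        = PowerSeries.coeff r
          (PowerSeries.map (RingQuot.mkAlgHom ℂ (Rel s ε) : FreeAlg N →+* Alg s ε) f) := fun f => by
      rw [PowerSeries.coeff_map]; rfl
    rw [h2, h2] at h
    simp only [map_sum, map_mul, bSeriesNeg_eq, map_negate, ← genMatrix_eq] at h
    rw [map_sum]
    refine Eq.trans h ?_
    rw [Matrix.one_apply]
    split_ifs <;> simp

end Representation

/-! ### Dressing a representation by an oscillator-type operator matrix -/

/-- The series `1 / (u - p)` in `u⁻¹`. -/
noncomputable def invShift (p : ℂ) : PowerSeries ℂ :=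
  PowerSeries.X * (1 - PowerSeries.C p * PowerSeries.X)⁻¹

theorem invShift_mul (p : ℂ) :
    invShift p * (1 - PowerSeries.C p * PowerSeries.X) = PowerSeries.X := by
  rw [invShift, mul_assoc, PowerSeries.inv_mul_cancel, mul_one]
  simp

theorem constantCoeff_invShift (p : ℂ) : PowerSeries.constantCoeff (invShift p) = 0 := by
  simp [invShift]

theorem one_sub_C_mul_X_ne_zero (k : Fin 2) (p : ℂ) :
    (1 - MvPowerSeries.C p * MvPowerSeries.X k : MvPowerSeries (Fin 2) ℂ) ≠ 0 := by
  intro h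
  have := congrArg MvPowerSeries.constantCoeff h
  simp at this

theorem embed_invShift_mul (k : Fin 2) (p : ℂ) :
    embed k (invShift p) * (1 - MvPowerSeries.C p * MvPowerSeries.X k) = MvPowerSeries.X k := by
  have h := congrArg (embed k) (invShift_mul p)
  simpa only [map_mul, map_sub, map_one, embed_C, embed_X] using h

/-- The partial fraction identity behind `exchange_same`. -/
theorem invShift_same (p : ℂ) :
    ((MvPowerSeries.X 1 - MvPowerSeries.X 0) * (embed 0 (invShift p) * embed 1 (invShift p)) :
      MvPowerSeries (Fin 2) ℂ)
      = MvPowerSeries.X 0 * MvPowerSeries.X 1 * (embed 1 (invShift p) - embed 0 (invShift p)) := by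
  have h0 := embed_invShift_mul 0 p
  have h1 := embed_invShift_mul 1 p
  apply mul_left_cancel₀ (mul_ne_zero (one_sub_C_mul_X_ne_zero 0 p) (one_sub_C_mul_X_ne_zero 1 p))
  generalize embed 0 (invShift p) = a at *
  generalize embed 1 (invShift p) = b at *
  generalize (MvPowerSeries.X 0 : MvPowerSeries (Fin 2) ℂ) = x at *
  generalize (MvPowerSeries.X 1 : MvPowerSeries (Fin 2) ℂ) = y at *
  generalize (MvPowerSeries.C p : MvPowerSeries (Fin 2) ℂ) = c at *
  linear_combination ((y - x) * b * (1 - c * y) + x * y * (1 - c * y)) * h0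
    + ((y - x) * x - x * y * (1 - c * x)) * h1

/-- The partial fraction identity behind `exchange_cross`. -/
theorem invShift_cross (p q : ℂ) (k l : Fin 2) :
    ((MvPowerSeries.X k + MvPowerSeries.X l) * (embed k (invShift p) * embed l (invShift q)) :
      MvPowerSeries (Fin 2) ℂ)
      = MvPowerSeries.X k * MvPowerSeries.X l * (embed k (invShift p) + embed l (invShift q)
        + MvPowerSeries.C (p + q) * (embed k (invShift p) * embed l (invShift q))) := by
  have h0 := embed_invShift_mul k p
  have h1 := embed_invShift_mul l q
  apply mul_left_cancel₀ (mul_ne_zero (one_sub_C_mul_X_ne_zero k p) (one_sub_C_mul_X_ne_zero l q))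
  rw [map_add]
  generalize embed k (invShift p) = a at *
  generalize embed l (invShift q) = b at *
  generalize (MvPowerSeries.X k : MvPowerSeries (Fin 2) ℂ) = x at *
  generalize (MvPowerSeries.X l : MvPowerSeries (Fin 2) ℂ) = y at *
  generalize (MvPowerSeries.C p : MvPowerSeries (Fin 2) ℂ) = c at *
  generalize (MvPowerSeries.C q : MvPowerSeries (Fin 2) ℂ) = d at *
  linear_combination ((x + y - x * y * (c + d)) * b * (1 - d * y) - x * y * (1 - d * y)) * h0
    + ((x + y - x * y * (c + d)) * x - x * y * (1 - c * x)) * h1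

/-- `1 / (u - p)` and `1 / (-u - q)` satisfy the relation that makes `1 + E / (u - p)` and
`1 + E / (-u - q)` inverse to each other when `E² = (p + q) E`. -/
theorem invShift_negate (p q : ℂ) :
    invShift p + negate (invShift q)
      + PowerSeries.C (p + q) * (invShift p * negate (invShift q)) = 0 := by
  have h0 := invShift_mul p
  have h1 := congrArg negate (invShift_mul q)
  simp only [map_mul, map_sub, map_one, negate_C, negate_X] at h1
  have hne : ∀ z : ℂ, (1 - PowerSeries.C z * PowerSeries.X : PowerSeries ℂ) ≠ 0 := by
    intro z h
    have := congrArg PowerSeries.constantCoeff h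
    simp at this
  have hne2 : (1 - PowerSeries.C q * -PowerSeries.X : PowerSeries ℂ) ≠ 0 := by
    have := hne (-q)
    simpa using this
  apply mul_left_cancel₀ (mul_ne_zero (hne p) hne2)
  rw [map_add]
  generalize invShift p = a at *
  generalize negate (invShift q) = b at *
  generalize (PowerSeries.X : PowerSeries ℂ) = x at *
  generalize (PowerSeries.C p : PowerSeries ℂ) = c at *
  generalize (PowerSeries.C q : PowerSeries ℂ) = d at *
  linear_combination (1 + d * x + (c + d) * b * (1 - d * -x)) * h0 + (1 - c * x + (c + d) * x) * h1

section Dress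

variable {D : Type*} [Ring D] [Algebra ℂ D]

/-- Operators `E_{ij}` satisfying the relations of `𝔤𝔩` with the parity sequence `s`, with
`E² = θ E`, together with operators `Z_k` implementing the sign `(-1)^{|k| |·|}` of the grading. -/
structure IsOscillator (s : Fin (N + 1) → ℤˣ) (θ : ℂ)
    (E : Matrix (Fin (N + 1)) (Fin (N + 1)) D) (Z : Fin (N + 1) → D) : Prop where
  comm : ∀ i j k l, E i j * E k l
      - (sgn s i k * sgn s i l * sgn s j k * sgn s j l) • (E k l * E i j)
    = (sgn s i j * sgn s i k * sgn s j k) • ((if k = j then E i l else 0)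
        - (if i = l then E k j else 0))
  quad : ∀ i k, ∑ j, E i j * E j k = θ • E i k
  sq : ∀ k, Z k * Z k = 1
  signs : ∀ k l, Z k * Z l = Z l * Z k
  grade : ∀ k i j, Z k * E i j = (sgn s k i * sgn s k j) • (E i j * Z k)

/-- The scalar series `f`, with coefficients in `D`. -/
noncomputable def scalar (D : Type*) [Ring D] [Algebra ℂ D] : PowerSeries ℂ →+* PowerSeries D :=
  PowerSeries.map (algebraMap ℂ D)

theorem scalar_commute (f : PowerSeries ℂ) (g : PowerSeries D) :
    scalar D f * g = g * scalar D f := by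
  ext n
  rw [PowerSeries.coeff_mul, PowerSeries.coeff_mul]
  refine Finset.sum_nbij' Prod.swap Prod.swap ?_ ?_ (fun _ _ => rfl) (fun _ _ => rfl) ?_
  · intro p hp
    simpa [add_comm] using hp
  · intro p hp
    simpa [add_comm] using hp
  · intro p _
    simp only [scalar, PowerSeries.coeff_map, Prod.fst_swap, Prod.snd_swap]
    exact Algebra.commutes _ _

/-- The matrix `1 + f E` for a scalar series `f`. -/
noncomputable def onePlus (f : PowerSeries ℂ) (E : Matrix (Fin (N + 1)) (Fin (N + 1)) D) :
    Matrix (Fin (N + 1)) (Fin (N + 1)) (PowerSeries D) :=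
  1 + scalar D f • PowerSeries.C.mapMatrix E

/-- The matrix with entries `Z_i b_{ij}(u) Z_j`. -/
noncomputable def conj (Z : Fin (N + 1) → D)
    (b : Matrix (Fin (N + 1)) (Fin (N + 1)) (PowerSeries D)) :
    Matrix (Fin (N + 1)) (Fin (N + 1)) (PowerSeries D) :=
  Matrix.diagonal (fun i => PowerSeries.C (Z i)) * b * Matrix.diagonal (fun i => PowerSeries.C (Z i))

/-- The dressed matrix `(1 + E / (u - p)) Z b(u) Z (1 + E / (u - q))`. -/
noncomputable def dress (p q : ℂ) (E : Matrix (Fin (N + 1)) (Fin (N + 1)) D) (Z : Fin (N + 1) → D)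
    (b : Matrix (Fin (N + 1)) (Fin (N + 1)) (PowerSeries D)) :
    Matrix (Fin (N + 1)) (Fin (N + 1)) (PowerSeries D) :=
  onePlus (invShift p) E * conj Z b * onePlus (invShift q) E

/-- Conjugating both factors of a solution of the reflection equation by commuting involutions whose
product commutes with both `R`-matrices gives a solution again. -/
theorem reflection_conj {M : Type*} [Monoid M] {r t k l d e : M}
    (hd : d * d = 1) (he : e * e = 1) (hde : d * e = e * d)
    (hr : r * (d * e) = d * e * r) (ht : t * (d * e) = d * e * t)
    (hk : e * k = k * e) (hl : d * l = l * d) (hkl : r * k * t * l = l * t * k * r) :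
    r * (d * k * d) * t * (e * l * e) = e * l * e * t * (d * k * d) * r := by
  have q1 : ∀ z, d * (d * z) = z := fun z => by rw [← mul_assoc, hd, one_mul]
  have q2 : ∀ z, e * (e * z) = z := fun z => by rw [← mul_assoc, he, one_mul]
  have q3 : ∀ z, e * (d * z) = d * (e * z) := fun z => by rw [← mul_assoc, ← hde, mul_assoc]
  have q4 : ∀ z, e * (k * z) = k * (e * z) := fun z => by rw [← mul_assoc, hk, mul_assoc]
  have q5 : ∀ z, d * (l * z) = l * (d * z) := fun z => by rw [← mul_assoc, hl, mul_assoc]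
  have q6 : ∀ z, r * (d * (e * z)) = d * (e * (r * z)) := fun z => by
    rw [← mul_assoc d e z, ← mul_assoc r, hr]; simp only [mul_assoc]
  have q7 : ∀ z, t * (d * (e * z)) = d * (e * (t * z)) := fun z => by
    rw [← mul_assoc d e z, ← mul_assoc t, ht]; simp only [mul_assoc]
  have e1 : r * (d * k * d) * t * (e * l * e) = d * (e * (r * (k * (t * (l * (d * e)))))) := by
    rw [← q6]
    have : d * (t * (e * (l * e))) = e * (t * (l * (d * e))) := by
      rw [← q2 (d * (t * (e * (l * e)))), q3, ← q7, q2, q5]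
    simp only [mul_assoc]
    rw [this, q4]
  have e2 : e * l * e * t * (d * k * d) * r = d * (e * (l * (t * (k * (r * (d * e)))))) := by
    have h1 : k * (d * r) = e * (k * (r * (d * e))) := by
      rw [hr, q4]
      congr 1
      rw [mul_assoc, q3, q2]
    have h2 : e * (l * (e * (t * (d * (e * (k * (r * (d * e))))))))
        = d * (e * (l * (t * (k * (r * (d * e)))))) := by
      rw [q7, q3, q2, ← q5, q3]
    simp only [mul_assoc]
    rw [h1, h2]
  have e3 : r * (k * (t * (l * (d * e)))) = l * (t * (k * (r * (d * e)))) := by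
    have := congrArg (· * (d * e)) hkl
    simpa only [mul_assoc] using this
  rw [e1, e2, e3]

/-- The image of a matrix of series acting on the first tensor factor at the variable `k`. -/
noncomputable def sideAt (D : Type*) [Ring D] (N : ℕ) (k : Fin 2) :
    Matrix (Fin (N + 1)) (Fin (N + 1)) (PowerSeries D) →+*
      Matrix (Fin (N + 1) × Fin (N + 1)) (Fin (N + 1) × Fin (N + 1)) (MvPowerSeries (Fin 2) D) :=
  (side _ N).comp (embed k).mapMatrix

omit [Algebra ℂ D] in
theorem sideAt_const (k : Fin 2) (E : Matrix (Fin (N + 1)) (Fin (N + 1)) D) :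
    sideAt D N k (PowerSeries.C.mapMatrix E) = side _ N (MvPowerSeries.C.mapMatrix E) := by
  rw [sideAt, RingHom.comp_apply]
  congr 1
  ext i j : 1
  simp [embed_C]

theorem sideAt_onePlus (k : Fin 2) (f : PowerSeries ℂ)
    (E : Matrix (Fin (N + 1)) (Fin (N + 1)) D) :
    sideAt D N k (onePlus f E) = 1 + algebraMap (MvPowerSeries (Fin 2) ℂ) _ (embed k f)
      * side _ N (MvPowerSeries.C.mapMatrix E) := by
  rw [onePlus, map_add, map_one, ← sideAt_const k]
  congr 1
  rw [← Algebra.smul_def, sideAt, RingHom.comp_apply]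
  ext ⟨i, k'⟩ ⟨j, l⟩ : 1
  rw [Matrix.smul_apply, RingHom.comp_apply, side_apply, side_apply]
  split_ifs
  · rw [Algebra.smul_def, seriesAlgebra_algebraMap, map_embed]
    simp [scalar]
  · rw [smul_zero]

variable {s ε : Fin (N + 1) → ℤˣ} {θ : ℂ} {E : Matrix (Fin (N + 1)) (Fin (N + 1)) D}
  {Z : Fin (N + 1) → D} {b : Matrix (Fin (N + 1)) (Fin (N + 1)) (PowerSeries D)}

/-- The relations of `𝔤𝔩` in matrix form, `E₁ E₂ - E₂ E₁ = E₁ P - P E₁`. -/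
theorem IsOscillator.exchange (h : IsOscillator s θ E Z) :
    let 𝓔 := side _ N (MvPowerSeries.C (σ := Fin 2).mapMatrix E)
    let P := braid (MvPowerSeries (Fin 2) D) s
    𝓔 * (P * 𝓔 * P) - P * 𝓔 * P * 𝓔 = 𝓔 * P - P * 𝓔 := by
  dsimp only
  ext ⟨i, k⟩ ⟨j, l⟩ : 1
  rw [Matrix.sub_apply, Matrix.sub_apply, side_mul_second_apply, second_mul_side_apply,
    mul_braid_apply, braid_mul_apply, side_apply, side_apply]
  have h1 := congrArg (fun z => (sgn s j k * sgn s j l) • MvPowerSeries.C (σ := Fin 2) z)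
    (h.comm i j k l)
  have hite : ∀ (p : Prop) [Decidable p] (z : D), MvPowerSeries.C (σ := Fin 2) (if p then z else 0)
      = if p then MvPowerSeries.C z else 0 := fun p _ z => by split_ifs <;> simp
  simp only [map_sub, map_zsmul, map_mul, smul_sub, smul_smul, hite] at h1
  simp only [RingHom.mapMatrix_apply, Matrix.map_apply]
  convert h1 using 2
  · congr 1
    rcases parity_cases s i with hi | hi <;> rcases parity_cases s j with hj | hj <;>
    rcases parity_cases s k with hk | hk <;> rcases parity_cases s l with hl | hl <;>
    simp [sgn, hi, hj, hk, hl]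
  · split_ifs with hkj
    · subst hkj
      congr 1
      rcases parity_cases s i with hi | hi <;> rcases parity_cases s k with hk | hk <;>
      rcases parity_cases s l with hl | hl <;> simp [sgn, hi, hk, hl]
    · simp
  · split_ifs with hil
    · subst hil
      congr 1
      rcases parity_cases s i with hi | hi <;> rcases parity_cases s k with hk | hk <;>
      rcases parity_cases s j with hl | hl <;> simp [sgn, hi, hk, hl]
    · simp

theorem IsOscillator.side_sq (h : IsOscillator s θ E Z) :
    let 𝓔 := side _ N (MvPowerSeries.C (σ := Fin 2).mapMatrix E)
    𝓔 * 𝓔 = algebraMap (MvPowerSeries (Fin 2) ℂ) _ (MvPowerSeries.C θ) * 𝓔 := by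
  dsimp only
  rw [← Algebra.smul_def, ← map_mul, ← map_mul]
  ext ⟨i, k⟩ ⟨j, l⟩ : 1
  rw [Matrix.smul_apply, side_apply, side_apply]
  split_ifs
  · rw [Algebra.smul_def, seriesAlgebra_algebraMap, MvPowerSeries.map_C]
    simp only [RingHom.mapMatrix_apply, Matrix.map_apply]
    rw [← map_mul, Matrix.mul_apply, h.quad, Algebra.smul_def]
  · rw [smul_zero]

/-- The entries of `Z b Z` sign-commute with the `E_{ij}` as prescribed by the grading. -/
theorem IsOscillator.side_commute (h : IsOscillator s θ E Z)
    (hbE : ∀ i j k l r, Commute (PowerSeries.coeff r (b k l)) (E i j)) (κ : Fin 2) :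
    side _ N (MvPowerSeries.C.mapMatrix E)
        * (braid _ s * sideAt D N κ (conj Z b) * braid _ s)
      = braid _ s * sideAt D N κ (conj Z b) * braid _ s
        * side _ N (MvPowerSeries.C.mapMatrix E) := by
  rw [sideAt, RingHom.comp_apply]
  apply side_commute_second
  intro i j k l
  simp only [RingHom.mapMatrix_apply, Matrix.map_apply, ← embed_C κ, ← map_mul, ← map_zsmul]
  congr 1
  simp only [conj, Matrix.mul_diagonal, Matrix.diagonal_mul]
  ext r
  simp only [map_zsmul, PowerSeries.coeff_C_mul, PowerSeries.coeff_mul_C]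
  have h1 : E i j * (Z k * PowerSeries.coeff r (b k l) * Z l)
      = (sgn s k i * sgn s k j * (sgn s l i * sgn s l j)) •
        (Z k * PowerSeries.coeff r (b k l) * Z l * E i j) := by
    have hZ : ∀ k, E i j * Z k = (sgn s k i * sgn s k j) • (Z k * E i j) := fun k => by
      rw [h.grade, smul_smul, mul_mul_mul_comm, sgn_mul_self, sgn_mul_self, one_mul, one_smul]
    rw [← mul_assoc, ← mul_assoc, hZ, smul_mul_assoc, smul_mul_assoc, mul_assoc (Z k),
      ← (hbE i j k l r).eq, ← mul_assoc, mul_assoc _ (E i j), hZ, mul_smul_comm, smul_smul,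
      mul_assoc (_ * _) (Z l)]
  rw [h1, smul_smul]
  congr 1
  rcases parity_cases s i with hi | hi <;> rcases parity_cases s j with hj | hj <;>
    rcases parity_cases s k with hk | hk <;> rcases parity_cases s l with hl | hl <;>
    simp [sgn, hi, hj, hk, hl]

/-- Conjugation by the `Z_k` preserves the reflection equation, since all of them commute with
`b(u)`. It makes the entries of `b(u)` sign-commute with the `E_{ij}`. -/
theorem reflectionEq_conj (h : IsOscillator s θ E Z)
    (hbZ : ∀ i k l r, Commute (PowerSeries.coeff r (b k l)) (Z i))
    (hb : ReflectionEq s ((embed 0).mapMatrix b) ((embed 1).mapMatrix b)) :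
    ReflectionEq s ((embed 0).mapMatrix (conj Z b)) ((embed 1).mapMatrix (conj Z b)) := by
  unfold ReflectionEq at hb ⊢
  intro 𝓐 x y P rm rp
  set δ : Matrix (Fin (N + 1)) (Fin (N + 1)) (MvPowerSeries (Fin 2) D) :=
    Matrix.diagonal fun i => MvPowerSeries.C (Z i) with hδ
  set d := side _ N δ with hd
  have hPP : P * P = 1 := braid_mul_braid s
  have hK : ∀ κ, side _ N ((embed κ).mapMatrix (conj Z b))
      = d * side _ N ((embed κ).mapMatrix b) * d := by
    intro κ
    rw [hd, ← map_mul, ← map_mul]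
    congr 1
    rw [conj, map_mul, map_mul]
    have : (embed κ).mapMatrix (Matrix.diagonal fun i => PowerSeries.C (Z i)) = δ := by
      rw [RingHom.mapMatrix_apply, Matrix.diagonal_map (map_zero _), hδ]
      simp only [embed_C]
    rw [this]
  have hdd : d * d = 1 := by
    rw [hd, ← map_mul, hδ, Matrix.diagonal_mul_diagonal]
    simp only [← map_mul, h.sq, map_one, Matrix.diagonal_one]
  have hPz : ∀ z, P * (P * z) = z := fun z => by rw [← mul_assoc, hPP, one_mul]
  set e := P * d * P with he
  have hee : e * e = 1 := by
    rw [he]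
    simp only [mul_assoc, hPz]
    rw [← mul_assoc d d, hdd, one_mul, hPP]
  -- both products are the diagonal matrix with entries `Z_i Z_k`
  have hde : d * e = e * d := by
    rw [hd, he]
    apply side_commute_second
    intro i j k l
    simp only [hδ, Matrix.diagonal_apply]
    split_ifs with h1 h2 h2
    · subst h1 h2
      rw [sgn_mul_self, ← map_mul, ← map_mul, h.signs]
    · simp
    · simp
    · simp
  have hPde : P * (d * e) = d * e * P := by
    rw [hde, he]
    simp only [mul_assoc, hPz]
    rw [← mul_assoc P d, ← mul_assoc (P * d), ← he]
    have := hde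
    rw [he] at this
    simp only [mul_assoc] at this
    rw [he]
    simp only [mul_assoc]
    rw [this, hPz]
  have hrp : ∀ a c : MvPowerSeries (Fin 2) ℂ,
      (algebraMap _ 𝓐 a - algebraMap _ 𝓐 c * P) * (d * e)
        = d * e * (algebraMap _ 𝓐 a - algebraMap _ 𝓐 c * P) := by
    intro a c
    rw [sub_mul, mul_sub, Algebra.commutes a (d * e), mul_assoc (algebraMap _ 𝓐 c) P, hPde,
      ← mul_assoc (algebraMap _ 𝓐 c), Algebra.commutes c (d * e), mul_assoc (d * e)]
  have hdl : ∀ κ, d * (P * side _ N ((embed κ).mapMatrix b) * P)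
      = P * side _ N ((embed κ).mapMatrix b) * P * d := by
    intro κ
    apply side_commute_second
    intro i j k l
    simp only [hδ, Matrix.diagonal_apply]
    split_ifs with h1
    · subst h1
      congr 1
      rw [RingHom.mapMatrix_apply, Matrix.map_apply, ← embed_C κ, ← map_mul, ← map_mul]
      congr 1
      ext r
      rw [PowerSeries.coeff_C_mul, PowerSeries.coeff_mul_C, (hbZ i k l r).eq]
    · simp
  have hek : e * side _ N ((embed 0).mapMatrix b) = side _ N ((embed 0).mapMatrix b) * e := by
    have h1 := congrArg (fun z => P * z * P) (hdl 0)
    simp only [mul_assoc, hPz, hPP, mul_one] at h1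
    rw [he]
    simpa only [mul_assoc] using h1
  have hL : P * side _ N ((embed 1).mapMatrix (conj Z b)) * P
      = e * (P * side _ N ((embed 1).mapMatrix b) * P) * e := by
    rw [hK, he]
    simp only [mul_assoc, hPz]
  rw [hL, hK]
  exact reflection_conj hdd hee hde (hrp _ _) (hrp _ _) hek (hdl 1) hb

omit [Algebra ℂ D] in
theorem conj_apply (Z : Fin (N + 1) → D) (b : Matrix (Fin (N + 1)) (Fin (N + 1)) (PowerSeries D))
    (i j : Fin (N + 1)) :
    conj Z b i j = PowerSeries.C (Z i) * b i j * PowerSeries.C (Z j) := by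
  simp [conj, Matrix.mul_diagonal, Matrix.diagonal_mul]

theorem IsOscillator.matrix_sq (h : IsOscillator s θ E Z) :
    PowerSeries.C.mapMatrix E * PowerSeries.C.mapMatrix E
      = scalar D (PowerSeries.C θ) • PowerSeries.C.mapMatrix E := by
  rw [← map_mul]
  ext i j : 1
  rw [Matrix.smul_apply, scalar, PowerSeries.map_C]
  simp only [RingHom.mapMatrix_apply, Matrix.map_apply]
  rw [Matrix.mul_apply, h.quad, Algebra.smul_def, map_mul, smul_eq_mul]

theorem IsOscillator.onePlus_mul (h : IsOscillator s θ E Z) {f g : PowerSeries ℂ}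
    (hfg : f + g + PowerSeries.C θ * (f * g) = 0) : onePlus f E * onePlus g E = 1 := by
  have hc : ∀ (z : PowerSeries ℂ) (M M' : Matrix (Fin (N + 1)) (Fin (N + 1)) (PowerSeries D)),
      M * (scalar D z • M') = scalar D z • (M * M') := by
    intro z M M'
    ext i j : 1
    simp only [Matrix.mul_apply, Matrix.smul_apply, smul_eq_mul, Finset.mul_sum]
    refine Finset.sum_congr rfl fun a _ => ?_
    rw [← mul_assoc, ← mul_assoc, scalar_commute]
  rw [onePlus, onePlus, mul_add, mul_one, add_mul, one_mul, hc, smul_mul_assoc, h.matrix_sq,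
    smul_smul, smul_smul, ← map_mul, ← map_mul, add_assoc, ← add_smul, ← add_smul, ← map_add,
    ← map_add]
  have : f + (g + g * f * PowerSeries.C θ) = 0 := by linear_combination hfg
  rw [this, map_zero, zero_smul, add_zero]

theorem negate_onePlus (f : PowerSeries ℂ) :
    negate.mapMatrix (onePlus f E) = onePlus (negate f) E := by
  rw [onePlus, onePlus, map_add, map_one]
  congr 1
  ext i j : 1
  simp only [RingHom.mapMatrix_apply, Matrix.map_apply, Matrix.smul_apply, smul_eq_mul, map_mul,
    negate_C, scalar, map_negate]

omit [Algebra ℂ D] in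
theorem negate_conj : negate.mapMatrix (conj Z b) = conj Z (negate.mapMatrix b) := by
  ext i j : 1
  simp only [RingHom.mapMatrix_apply, Matrix.map_apply, conj_apply, map_mul, negate_C]

theorem IsOscillator.conj_mul_conj (h : IsOscillator s θ E Z)
    (b b' : Matrix (Fin (N + 1)) (Fin (N + 1)) (PowerSeries D)) :
    conj Z b * conj Z b' = conj Z (b * b') := by
  have hdd : (Matrix.diagonal fun i => (PowerSeries.C (Z i) : PowerSeries D))
      * Matrix.diagonal (fun i => PowerSeries.C (Z i)) = 1 := by
    rw [Matrix.diagonal_mul_diagonal]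
    simp only [← map_mul, h.sq, map_one, Matrix.diagonal_one]
  unfold conj
  rw [mul_assoc, ← mul_assoc (Matrix.diagonal _) (_ * _), ← mul_assoc (Matrix.diagonal _) _ b', hdd,
    one_mul]
  simp only [mul_assoc]

theorem IsOscillator.conj_one (h : IsOscillator s θ E Z) :
    conj Z (1 : Matrix (Fin (N + 1)) (Fin (N + 1)) (PowerSeries D)) = 1 := by
  rw [conj, mul_one, Matrix.diagonal_mul_diagonal]
  simp only [← map_mul, h.sq, map_one, Matrix.diagonal_one]

/-- Dressing preserves the defining relations. The two spectral shifts have to add up to the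
eigenvalue `θ`, since then `1 + E / (u - q)` is the inverse of `1 + E / (-u - p)`. -/
theorem IsRep.dress {p q : ℂ} (hb : IsRep s ε b) (h : IsOscillator s θ E Z) (hpq : p + q = θ)
    (hbE : ∀ i j k l r, Commute (PowerSeries.coeff r (b k l)) (E i j))
    (hbZ : ∀ i k l r, Commute (PowerSeries.coeff r (b k l)) (Z i)) :
    IsRep s ε (dress p q E Z b) where
  const i j := by
    have h1 : ∀ p, (PowerSeries.constantCoeff (R := D)).mapMatrix (onePlus (invShift p) E) = 1 := by
      intro p
      rw [onePlus, map_add, map_one]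
      have : (PowerSeries.constantCoeff (R := D)).mapMatrix
          (scalar D (invShift p) • PowerSeries.C.mapMatrix E) = 0 := by
        ext i j : 1
        have h0 : PowerSeries.constantCoeff (scalar D (invShift p)) = 0 := by
          rw [scalar, ← PowerSeries.coeff_zero_eq_constantCoeff_apply, PowerSeries.coeff_map,
            PowerSeries.coeff_zero_eq_constantCoeff_apply, constantCoeff_invShift, map_zero]
        simp [h0]
      rw [this, add_zero]
    have h2 : PowerSeries.constantCoeff (TwistedSuperYangian.dress p q E Z b i j)
        = (PowerSeries.constantCoeff (R := D)).mapMatrix (TwistedSuperYangian.dress p q E Z b) i j :=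
      rfl
    rw [h2, TwistedSuperYangian.dress, map_mul, map_mul, h1, h1, one_mul, mul_one,
      RingHom.mapMatrix_apply, Matrix.map_apply, conj_apply, map_mul, map_mul, hb.const]
    split_ifs with hij
    · subst hij
      rw [PowerSeries.constantCoeff_C, mul_assoc, Int.cast_comm, ← mul_assoc, h.sq, one_mul]
    · simp
  unit := by
    rw [TwistedSuperYangian.dress, map_mul, map_mul, negate_onePlus, negate_onePlus, negate_conj]
    have h1 : onePlus (invShift q) E * onePlus (negate (invShift p)) E = 1 := by
      apply h.onePlus_mul
      rw [← hpq, add_comm p q]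
      exact invShift_negate q p
    have h2 : onePlus (invShift p) E * onePlus (negate (invShift q)) E = 1 := by
      apply h.onePlus_mul
      rw [← hpq]
      exact invShift_negate p q
    rw [mul_assoc, mul_assoc (onePlus (negate _) E), ← mul_assoc (onePlus (invShift q) E), h1,
      one_mul, mul_assoc, ← mul_assoc (conj Z b), h.conj_mul_conj, hb.unit, h.conj_one, one_mul, h2]
  refl := by
    have hK := reflectionEq_conj h hbZ hb.refl
    unfold ReflectionEq at hK ⊢
    intro 𝓐 x y P rm rp
    have hPP : P * P = 1 := braid_mul_braid s
    have hPz : ∀ z, P * (P * z) = z := fun z => by rw [← mul_assoc, hPP, one_mul]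
    have hs : ∀ κ M, side _ N ((embed κ).mapMatrix M) = sideAt D N κ M := fun _ _ => rfl
    have hd : ∀ κ, sideAt D N κ (TwistedSuperYangian.dress p q E Z b)
        = sideAt D N κ (onePlus (invShift p) E) * sideAt D N κ (conj Z b)
          * sideAt D N κ (onePlus (invShift q) E) := fun κ => by
      rw [TwistedSuperYangian.dress, map_mul, map_mul]
    simp only [hs] at hK ⊢
    have h2 : P * sideAt D N 1 (TwistedSuperYangian.dress p q E Z b) * P
        = (P * sideAt D N 1 (onePlus (invShift p) E) * P) * (P * sideAt D N 1 (conj Z b) * P)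
          * (P * sideAt D N 1 (onePlus (invShift q) E) * P) := by
      rw [hd]
      simp only [mul_assoc, hPz]
    rw [h2, hd]
    have hc : ∀ κ (f : PowerSeries ℂ) κ', sideAt D N κ' (onePlus f E)
        * (P * sideAt D N κ (conj Z b) * P)
        = P * sideAt D N κ (conj Z b) * P * sideAt D N κ' (onePlus f E) := by
      intro κ f κ'
      have hgen : ∀ (a : MvPowerSeries (Fin 2) ℂ) (e k : 𝓐), e * k = k * e →
          (1 + algebraMap _ 𝓐 a * e) * k = k * (1 + algebraMap _ 𝓐 a * e) := by
        intro a e k hek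
        rw [add_mul, mul_add, one_mul, mul_one, mul_assoc, hek, ← mul_assoc, Algebra.commutes,
          mul_assoc]
      rw [sideAt_onePlus]
      exact hgen _ _ _ (h.side_commute hbE κ)
    have hc' : ∀ κ (f : PowerSeries ℂ) κ', sideAt D N κ (conj Z b)
        * (P * sideAt D N κ' (onePlus f E) * P)
        = P * sideAt D N κ' (onePlus f E) * P * sideAt D N κ (conj Z b) := by
      intro κ f κ'
      have h3 := congrArg (fun z => P * z * P) (hc κ f κ')
      simp only [mul_assoc, hPz, hPP, mul_one] at h3
      simp only [mul_assoc]
      exact h3.symm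
    refine reflection_dress ?_ ?_ ?_ ?_ hK (hc' _ _ _) (hc _ _ _) (hc _ _ _) (hc' _ _ _)
    · simp only [sideAt_onePlus]
      exact exchange_same hPP h.exchange x y _ _ (invShift_same p)
    · simp only [sideAt_onePlus]
      exact exchange_same hPP h.exchange x y _ _ (invShift_same q)
    · simp only [sideAt_onePlus]
      refine exchange_cross hPP h.exchange _ h.side_sq x y _ _ ?_
      have := invShift_cross q p 0 1
      rwa [add_comm q p, hpq] at this
    · simp only [sideAt_onePlus]
      refine (exchange_cross hPP h.exchange _ h.side_sq x y _ _ ?_)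
      have := invShift_cross p q 0 1
      rwa [hpq] at this

end Dress

/-! ### Highest weight vectors -/

section Map

variable {D D' : Type*} [Ring D] [Algebra ℂ D] [Ring D'] [Algebra ℂ D'] {s ε : Fin (N + 1) → ℤˣ}

omit [Algebra ℂ D] [Algebra ℂ D'] in
theorem ReflectionRel.map {U V : Matrix (Fin (N + 1)) (Fin (N + 1)) (MvPowerSeries (Fin 2) D)}
    {i j k l : Fin (N + 1)} (h : ReflectionRel s U V i j k l) (φ : D →+* D') :
    ReflectionRel s ((MvPowerSeries.map φ).mapMatrix U) ((MvPowerSeries.map φ).mapMatrix V)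
      i j k l := by
  unfold ReflectionRel at h ⊢
  have h1 := congrArg (MvPowerSeries.map φ) h
  have hite : ∀ (p : Prop) [Decidable p] (z : MvPowerSeries (Fin 2) D),
      MvPowerSeries.map φ (if p then z else 0) = if p then MvPowerSeries.map φ z else 0 :=
    fun p _ z => by split_ifs <;> simp
  simp only [map_mul, map_add, map_sub, map_pow, map_neg, map_one, map_sum, hite,
    MvPowerSeries.map_X] at h1
  simpa only [RingHom.mapMatrix_apply, Matrix.map_apply] using h1

theorem IsRep.map {b : Matrix (Fin (N + 1)) (Fin (N + 1)) (PowerSeries D)} (hb : IsRep s ε b)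
    (φ : D →+* D') : IsRep s ε ((PowerSeries.map φ).mapMatrix b) where
  const i j := by
    rw [RingHom.mapMatrix_apply, Matrix.map_apply, ← PowerSeries.coeff_zero_eq_constantCoeff_apply,
      PowerSeries.coeff_map, PowerSeries.coeff_zero_eq_constantCoeff_apply, hb.const]
    split_ifs <;> simp
  refl := by
    have h1 := (reflectionEq_iff s _ _).1 hb.refl
    rw [reflectionEq_iff]
    intro i j k l
    have h2 := (h1 i j k l).map φ
    have h3 : ∀ κ, (MvPowerSeries.map φ).mapMatrix ((embed κ).mapMatrix b)
        = (embed κ).mapMatrix ((PowerSeries.map φ).mapMatrix b) := by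
      intro κ
      ext i j : 1
      simp only [RingHom.mapMatrix_apply, Matrix.map_apply, map_embed]
    rwa [h3, h3] at h2
  unit := by
    have h1 := congrArg (PowerSeries.map φ).mapMatrix hb.unit
    rw [map_mul, map_one] at h1
    rw [← h1]
    congr 1
    ext i j : 1
    simp only [RingHom.mapMatrix_apply, Matrix.map_apply, map_negate]

theorem IsOscillator.map {θ : ℂ} {E : Matrix (Fin (N + 1)) (Fin (N + 1)) D} {Z : Fin (N + 1) → D}
    (h : IsOscillator s θ E Z) (φ : D →ₐ[ℂ] D') :
    IsOscillator s θ (Matrix.of fun i j => φ (E i j)) (fun k => φ (Z k)) where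
  comm i j k l := by
    have h1 := congrArg φ (h.comm i j k l)
    have hite : ∀ (p : Prop) [Decidable p] (z : D),
      φ (if p then z else 0) = if p then φ z else 0 := fun p _ z => by split_ifs <;> simp
    simpa only [map_sub, map_mul, map_zsmul, hite, Matrix.of_apply] using h1
  quad i k := by
    have h1 := congrArg φ (h.quad i k)
    simpa only [map_sum, map_mul, map_smul, Matrix.of_apply] using h1
  sq k := by rw [← map_mul, h.sq, map_one]
  signs k l := by rw [← map_mul, h.signs, map_mul]
  grade k i j := by
    have h1 := congrArg φ (h.grade k i j)
    simpa only [map_mul, map_zsmul, Matrix.of_apply] using h1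

end Map

section Base

/-- A constant involution `G` that commutes with its copy on the other tensor factor solves the
reflection equation, even after multiplication by scalar series. -/
theorem reflection_scalar {R A : Type*} [CommRing R] [Ring A] [Algebra R A] {P G : A}
    (hP : P * P = 1) (hG : G * G = 1) (hc : G * (P * G * P) = P * G * P * G) (a b e c c' : R) :
    (algebraMap R A a - algebraMap R A e * P) * (c • G) * (algebraMap R A b - algebraMap R A e * P)
        * (P * (c' • G) * P)
      - P * (c' • G) * P * (algebraMap R A b - algebraMap R A e * P) * (c • G)
        * (algebraMap R A a - algebraMap R A e * P) = 0 := by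
  rw [reflection_expand hP]
  simp only [mul_assoc] at hc
  simp only [smul_mul_assoc, mul_smul_comm, hG, mul_assoc, mul_one, mul_sub, sub_mul, one_mul, hc]
  module

variable {D : Type*} [Ring D] [Algebra ℂ D]

/-- The one-dimensional representations: `b(u) = g(u) diag(ε)` with `g(u) g(-u) = 1`. -/
theorem isRep_diagonal (s ε : Fin (N + 1) → ℤˣ) {g : PowerSeries ℂ}
    (hg0 : PowerSeries.constantCoeff g = 1) (hg : g * negate g = 1) :
    IsRep s ε (scalar D g • Matrix.diagonal fun i => ((ε i : ℤ) : PowerSeries D)) where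
  const i j := by
    have h0 : PowerSeries.constantCoeff (scalar D g) = 1 := by
      rw [scalar, ← PowerSeries.coeff_zero_eq_constantCoeff_apply, PowerSeries.coeff_map,
        PowerSeries.coeff_zero_eq_constantCoeff_apply, hg0, map_one]
    rw [Matrix.smul_apply, Matrix.diagonal_apply, smul_eq_mul, map_mul, h0, one_mul]
    split_ifs <;> simp
  unit := by
    have h1 : negate.mapMatrix (scalar D g • Matrix.diagonal fun i => ((ε i : ℤ) : PowerSeries D))
        = scalar D (negate g) • Matrix.diagonal fun i => ((ε i : ℤ) : PowerSeries D) := by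
      ext i j : 1
      simp only [RingHom.mapMatrix_apply, Matrix.map_apply, Matrix.smul_apply, smul_eq_mul, map_mul,
        scalar, map_negate, Matrix.diagonal_apply]
      split_ifs <;> simp
    rw [h1]
    ext i j : 1
    rw [Matrix.mul_apply, Finset.sum_eq_single i]
    · simp only [Matrix.smul_apply, Matrix.diagonal_apply, Matrix.one_apply, smul_eq_mul, if_true]
      split_ifs
      · rw [mul_assoc, Int.cast_comm, mul_assoc, ← Int.cast_mul, ← mul_assoc, ← map_mul, hg]
        rcases Int.units_eq_one_or (ε i) with h | h <;> simp [h]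
      · simp
    · intro a _ ha
      simp [Matrix.diagonal_apply, ha.symm]
    · simp
  refl := by
    unfold ReflectionEq
    simp only []
    set G := side (MvPowerSeries (Fin 2) D) N (Matrix.diagonal fun i => ((ε i : ℤ) : _)) with hG
    set P := braid (MvPowerSeries (Fin 2) D) s with hP
    have hPP : P * P = 1 := braid_mul_braid s
    have hK : ∀ κ, side _ N ((embed κ).mapMatrix
        (scalar D g • Matrix.diagonal fun i => ((ε i : ℤ) : PowerSeries D)))
        = (embed κ g : MvPowerSeries (Fin 2) ℂ) • G := by
      intro κ
      ext ⟨i, k⟩ ⟨j, l⟩ : 1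
      rw [Matrix.smul_apply, hG, side_apply, side_apply]
      split_ifs
      · rw [Algebra.smul_def, seriesAlgebra_algebraMap, map_embed, RingHom.mapMatrix_apply,
          Matrix.map_apply, Matrix.smul_apply, smul_eq_mul, map_mul, scalar, Matrix.diagonal_apply,
          Matrix.diagonal_apply]
        split_ifs <;> simp
      · rw [smul_zero]
    have hGG : G * G = 1 := by
      rw [hG, ← map_mul, Matrix.diagonal_mul_diagonal]
      have : ∀ i, (((ε i : ℤ) : MvPowerSeries (Fin 2) D)) * ((ε i : ℤ) : _) = 1 := by
        intro i
        rcases Int.units_eq_one_or (ε i) with h | h <;> simp [h]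
      simp only [this, Matrix.diagonal_one, map_one]
    have hc : G * (P * G * P) = P * G * P * G := by
      apply side_commute_second
      intro i j k l
      simp only [Matrix.diagonal_apply]
      split_ifs with h1 h2 h2
      · subst h1 h2
        rw [sgn_mul_self, Int.cast_comm]
      · simp
      · simp
      · simp
    rw [← sub_eq_zero, hK, hK]
    exact reflection_scalar hPP hGG hc _ _ _ _ _

end Base

section Highest

variable {M : Type*} [AddCommGroup M] [Module ℂ M] {s ε : Fin (N + 1) → ℤˣ}

/-- The coefficients of the operator series `F` act on `v` by the coefficients of `f`. -/
def ActsBy (v : M) (F : PowerSeries (Module.End ℂ M)) (f : PowerSeries ℂ) : Prop :=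
  ∀ r, PowerSeries.coeff r F v = PowerSeries.coeff r f • v

theorem actsBy_zero_iff {v : M} {F : PowerSeries (Module.End ℂ M)} :
    ActsBy v F 0 ↔ ∀ r, PowerSeries.coeff r F v = 0 := by
  simp [ActsBy]

theorem ActsBy.add {v : M} {F G : PowerSeries (Module.End ℂ M)} {f g : PowerSeries ℂ}
    (hF : ActsBy v F f) (hG : ActsBy v G g) : ActsBy v (F + G) (f + g) := fun r => by
  rw [map_add, LinearMap.add_apply, hF, hG, map_add, add_smul]

theorem ActsBy.sum {ι : Type*} {v : M} (t : Finset ι) {F : ι → PowerSeries (Module.End ℂ M)}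
    {f : ι → PowerSeries ℂ} (h : ∀ a ∈ t, ActsBy v (F a) (f a)) :
    ActsBy v (∑ a ∈ t, F a) (∑ a ∈ t, f a) := fun r => by
  rw [map_sum, map_sum, LinearMap.sum_apply, Finset.sum_smul]
  exact Finset.sum_congr rfl fun a ha => h a ha r

theorem ActsBy.scalar_mul {v : M} {F : PowerSeries (Module.End ℂ M)} {f : PowerSeries ℂ}
    (hF : ActsBy v F f) (g : PowerSeries ℂ) : ActsBy v (scalar _ g * F) (g * f) := fun r => by
  rw [PowerSeries.coeff_mul, PowerSeries.coeff_mul, LinearMap.sum_apply, Finset.sum_smul]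
  refine Finset.sum_congr rfl fun p _ => ?_
  rw [Module.End.mul_apply, hF, scalar, PowerSeries.coeff_map, Module.algebraMap_end_apply,
    smul_smul]

/-- `v` is a highest weight vector of weight `μ` for the operators in `b`. -/
structure IsHighest (b : Matrix (Fin (N + 1)) (Fin (N + 1)) (PowerSeries (Module.End ℂ M)))
    (μ : Fin (N + 1) → PowerSeries ℂ) (v : M) : Prop where
  ne_zero : v ≠ 0
  upper : ∀ i j, i < j → ActsBy v (b i j) 0
  diag : ∀ i, ActsBy v (b i i) (μ i)

/-- A representation with a highest weight vector is a quotient of the Verma module. -/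
theorem IsHighest.nontrivial
    {b : Matrix (Fin (N + 1)) (Fin (N + 1)) (PowerSeries (Module.End ℂ M))}
    {μ : Fin (N + 1) → PowerSeries ℂ} {v : M} (hv : IsHighest b μ v) (hb : IsRep s ε b) :
    Nontrivial (VermaModule s ε μ) := by
  obtain ⟨φ, hφ⟩ := hb.exists_algHom
  have hle : ∀ x ∈ vermaIdeal s ε μ, φ x v = 0 := by
    intro x hx
    refine Submodule.span_induction ?_ ?_ ?_ ?_ hx
    · rintro x (⟨i, j, r, hij, rfl⟩ | ⟨i, r, rfl⟩)
      · rw [hφ, hv.upper i j hij r, map_zero, zero_smul]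
      · rw [map_sub, LinearMap.sub_apply, hφ, hv.diag i r, AlgHom.commutes,
          Module.algebraMap_end_apply, sub_self]
    · simp
    · intro x y _ _ hx hy
      rw [map_add, LinearMap.add_apply, hx, hy, add_zero]
    · intro a x _ hx
      rw [smul_eq_mul, map_mul, Module.End.mul_apply, hx, map_zero]
  apply Submodule.Quotient.nontrivial_iff.2
  intro htop
  have h1 : (1 : Alg s ε) ∈ vermaIdeal s ε μ := by rw [htop]; trivial
  have h2 := hle 1 h1
  rw [map_one, Module.End.one_apply] at h2
  exact hv.ne_zero h2

/-- The action of the generators on the Verma module. -/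
noncomputable def vermaMatrix (s ε : Fin (N + 1) → ℤˣ) (μ : Fin (N + 1) → PowerSeries ℂ) :
    Matrix (Fin (N + 1)) (Fin (N + 1)) (PowerSeries (Module.End ℂ (VermaModule s ε μ))) :=
  (PowerSeries.map (Algebra.lsmul ℂ ℂ (VermaModule s ε μ)).toRingHom).mapMatrix (genMatrix s ε)

theorem isRep_vermaMatrix (s ε : Fin (N + 1) → ℤˣ) (μ : Fin (N + 1) → PowerSeries ℂ) :
    IsRep s ε (vermaMatrix s ε μ) := (isRep_genMatrix s ε).map _

theorem coeff_vermaMatrix (s ε : Fin (N + 1) → ℤˣ) (μ : Fin (N + 1) → PowerSeries ℂ)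
    (i j : Fin (N + 1)) (r : ℕ) (a : Alg s ε) :
    PowerSeries.coeff r (vermaMatrix s ε μ i j) (Submodule.Quotient.mk a)
      = Submodule.Quotient.mk (bCoeff s ε i j r * a) := by
  rw [vermaMatrix, RingHom.mapMatrix_apply, Matrix.map_apply, PowerSeries.coeff_map, genMatrix,
    Matrix.of_apply, PowerSeries.coeff_mk]
  rfl

theorem isHighest_vermaMatrix {s ε : Fin (N + 1) → ℤˣ} {μ : Fin (N + 1) → PowerSeries ℂ}
    (h : Nontrivial (VermaModule s ε μ)) :
    IsHighest (vermaMatrix s ε μ) μ (Submodule.Quotient.mk (1 : Alg s ε)) where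
  ne_zero h0 := by
    rw [Submodule.Quotient.mk_eq_zero] at h0
    exact Submodule.Quotient.nontrivial_iff.1 h (Ideal.eq_top_of_isUnit_mem _ h0 isUnit_one)
  upper i j hij r := by
    revert r
    refine actsBy_zero_iff.2 fun r => ?_
    rw [coeff_vermaMatrix, mul_one, Submodule.Quotient.mk_eq_zero]
    exact Submodule.subset_span (Or.inl ⟨i, j, r, hij, rfl⟩)
  diag i r := by
    rw [coeff_vermaMatrix, mul_one, ← Submodule.Quotient.mk_smul, ← sub_eq_zero,
      ← Submodule.Quotient.mk_sub, Submodule.Quotient.mk_eq_zero]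
    refine Submodule.subset_span (Or.inr ⟨i, r, ?_⟩)
    rw [Algebra.algebraMap_eq_smul_one]

end Highest

/-! ### The highest weight of a dressed representation -/

section Vacuum

variable {V : Type*} [AddCommGroup V] [Module ℂ V] {s : Fin (N + 1) → ℤˣ} {θ : ℂ}

/-- A highest weight vector `vac` of weight `wt` for the operators `E_{ij}`, fixed by all `Z_k`. -/
structure IsVacuum (E : Matrix (Fin (N + 1)) (Fin (N + 1)) (Module.End ℂ V))
    (Z : Fin (N + 1) → Module.End ℂ V) (wt : Fin (N + 1) → ℂ) (vac : V) : Prop where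
  ne_zero : vac ≠ 0
  upper : ∀ i j, i < j → E i j vac = 0
  diag : ∀ i, E i i vac = wt i • vac
  fixed : ∀ k, Z k vac = vac

variable {E : Matrix (Fin (N + 1)) (Fin (N + 1)) (Module.End ℂ V)}
  {Z : Fin (N + 1) → Module.End ℂ V} {wt : Fin (N + 1) → ℂ} {vac : V}

theorem IsVacuum.comm (h : IsOscillator s θ E Z) (i j k l : Fin (N + 1)) (v : V) :
    E i j (E k l v) = (sgn s i k * sgn s i l * sgn s j k * sgn s j l) • E k l (E i j v)
      + (sgn s i j * sgn s i k * sgn s j k) • ((if k = j then E i l v else 0)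
        - (if i = l then E k j v else 0)) := by
  have h1 := congrArg (fun T : Module.End ℂ V => T v) (h.comm i j k l)
  simp only [LinearMap.sub_apply, LinearMap.smul_apply, Module.End.mul_apply] at h1
  rw [sub_eq_iff_eq_add'] at h1
  rw [h1]
  congr 2
  congr 1 <;> split_ifs <;> simp

theorem IsVacuum.grade (hv : IsVacuum E Z wt vac) (h : IsOscillator s θ E Z)
    (k i j : Fin (N + 1)) : Z k (E i j vac) = (sgn s k i * sgn s k j) • E i j vac := by
  have h1 := congrArg (fun T : Module.End ℂ V => T vac) (h.grade k i j)
  simpa only [LinearMap.smul_apply, Module.End.mul_apply, hv.fixed] using h1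

theorem IsVacuum.sq_apply (h : IsOscillator s θ E Z) (k : Fin (N + 1)) (v : V) :
    Z k (Z k v) = v := by
  have h1 := congrArg (fun T : Module.End ℂ V => T v) (h.sq k)
  simpa only [Module.End.mul_apply, Module.End.one_apply] using h1

/-- In the dressed matrix, the terms with an entry of `b(u)` below the diagonal vanish on the
highest weight vector. -/
theorem IsVacuum.lower_upper (hv : IsVacuum E Z wt vac) (h : IsOscillator s θ E Z)
    {i j a b : Fin (N + 1)} (hab : b < a) (hij : i ≤ j) : E i a (Z a (Z b (E b j vac))) = 0 := by
  rw [hv.grade h, map_zsmul, hv.grade h, map_zsmul, map_zsmul]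
  suffices h0 : E i a (E b j vac) = 0 by rw [h0, smul_zero, smul_zero]
  rcases lt_or_ge b j with hb | hb
  · rw [hv.upper b j hb, map_zero]
  · have hia : i < a := lt_of_le_of_lt (hij.trans hb) hab
    rw [IsVacuum.comm h, hv.upper i a hia, map_zero, smul_zero, hv.upper b a hab, if_neg hab.ne]
    simp

theorem IsVacuum.same_upper (hv : IsVacuum E Z wt vac) (h : IsOscillator s θ E Z)
    {i j : Fin (N + 1)} (a : Fin (N + 1)) (hij : i < j) : E i a (Z a (Z a (E a j vac))) = 0 := by
  rw [IsVacuum.sq_apply h]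
  rcases lt_or_ge a j with ha | ha
  · rw [hv.upper a j ha, map_zero]
  · have hia : i < a := lt_of_lt_of_le hij ha
    rw [IsVacuum.comm h, hv.upper i a hia, map_zero, smul_zero, hv.upper i j hij, if_neg hij.ne]
    simp

/-- The eigenvalue of `E_{ia} E_{ai}` on the vacuum. -/
noncomputable def pairWeight (s : Fin (N + 1) → ℤˣ) (wt : Fin (N + 1) → ℂ) (i a : Fin (N + 1)) : ℂ :=
  if a = i then wt i * wt i else if i < a then (s a : ℤ) * (wt i - wt a) else 0

theorem IsVacuum.same_diag (hv : IsVacuum E Z wt vac) (h : IsOscillator s θ E Z)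
    (i a : Fin (N + 1)) : E i a (Z a (Z a (E a i vac))) = pairWeight s wt i a • vac := by
  rw [IsVacuum.sq_apply h, pairWeight]
  split_ifs with h1 h2
  · subst h1
    rw [hv.diag, map_smul, hv.diag, smul_smul]
  · rw [IsVacuum.comm h, hv.upper i a h2, map_zero, smul_zero, if_pos rfl, if_pos rfl, hv.diag,
      hv.diag, sgn_mul_self, one_mul, sgn_self, zero_add, ← sub_smul, ← smul_assoc, zsmul_eq_mul]
  · have h3 : a < i := lt_of_le_of_ne (not_lt.1 h2) h1
    rw [hv.upper a i h3, map_zero, zero_smul]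

/-- Since `E² = θ E`, the eigenvalue `θ` is determined by the weight of the vacuum. -/
theorem IsVacuum.theta_eq (hv : IsVacuum E Z wt vac) (h : IsOscillator s θ E Z) {i : Fin (N + 1)}
    (hi : wt i ≠ 0) (h0 : ∀ a, i < a → wt a = 0) : θ = wt i + rhoSucc s i := by
  have h1 := congrArg (fun T : Module.End ℂ V => T vac) (h.quad i i)
  simp only [LinearMap.sum_apply, Module.End.mul_apply, LinearMap.smul_apply, hv.diag] at h1
  have h2 : ∀ a, E i a (E a i vac) = pairWeight s wt i a • vac := fun a => by
    rw [← hv.same_diag h, IsVacuum.sq_apply h]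
  simp only [h2, ← Finset.sum_smul, smul_smul] at h1
  have h3 := smul_left_injective ℂ hv.ne_zero h1
  have h4 : ∑ a, pairWeight s wt i a = wt i * wt i + wt i * rhoSucc s i := by
    have hsub : ∀ a ∉ insert i (Finset.Ioi i), pairWeight s wt i a = 0 := by
      intro a ha
      simp only [Finset.mem_insert, Finset.mem_Ioi, not_or] at ha
      rw [pairWeight, if_neg ha.1, if_neg ha.2]
    rw [← Finset.sum_subset (Finset.subset_univ (insert i (Finset.Ioi i))) (fun a _ => hsub a),
      Finset.sum_insert (by simp), pairWeight, if_pos rfl, rhoSucc, Int.cast_sum, Finset.mul_sum]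
    congr 1
    refine Finset.sum_congr rfl fun a ha => ?_
    rw [Finset.mem_Ioi] at ha
    rw [pairWeight, if_neg ha.ne', if_pos ha, h0 a ha, sub_zero, mul_comm]
  rw [h4] at h3
  apply mul_right_cancel₀ hi
  linear_combination -h3

end Vacuum

/-- The entries of the dressed matrix, with all constant operators collected around `b(u)`. -/
theorem dress_apply {D : Type*} [Ring D] [Algebra ℂ D] (p q : ℂ)
    (E : Matrix (Fin (N + 1)) (Fin (N + 1)) D) (Z : Fin (N + 1) → D)
    (b : Matrix (Fin (N + 1)) (Fin (N + 1)) (PowerSeries D)) (i j : Fin (N + 1)) :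
    let S := fun (A B : D) (F : PowerSeries D) => PowerSeries.C A * F * PowerSeries.C B
    dress p q E Z b i j
      = (S (Z i) (Z j) (b i j) + scalar _ (invShift p) * ∑ a, S (E i a * Z a) (Z j) (b a j))
        + (scalar _ (invShift q) * ∑ c, S (Z i) (Z c * E c j) (b i c)
        + scalar _ (invShift q) * (scalar _ (invShift p)
          * ∑ c, ∑ a, S (E i a * Z a) (Z c * E c j) (b a c))) := by
  intro S
  have h1 : ∀ c, (onePlus (invShift p) E * conj Z b) i c
      = S (Z i) (Z c) (b i c) + scalar _ (invShift p) * ∑ a, S (E i a * Z a) (Z c) (b a c) := by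
    intro c
    rw [onePlus, add_mul, one_mul, Matrix.add_apply, conj_apply, smul_mul_assoc, Matrix.smul_apply,
      Matrix.mul_apply, smul_eq_mul]
    congr 1
    congr 1
    refine Finset.sum_congr rfl fun a _ => ?_
    rw [conj_apply]
    simp only [S, map_mul, mul_assoc, RingHom.mapMatrix_apply, Matrix.map_apply]
  have h2 : ∀ A B F c, S A B F * PowerSeries.C (E c j) = S A (B * E c j) F := by
    intro A B F c
    simp only [S, map_mul, mul_assoc]
  have h0 : onePlus (invShift q) E = 1 + scalar D (invShift q) • PowerSeries.C.mapMatrix E := rfl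
  rw [dress, h0, mul_add, mul_one, Matrix.add_apply, h1]
  congr 1
  rw [Matrix.mul_apply]
  simp only [h1, Matrix.smul_apply, RingHom.mapMatrix_apply, Matrix.map_apply, smul_eq_mul]
  have h3 : ∀ c, (S (Z i) (Z c) (b i c) + scalar _ (invShift p) * ∑ a, S (E i a * Z a) (Z c) (b a c))
      * (scalar _ (invShift q) * PowerSeries.C (E c j))
      = scalar _ (invShift q) * S (Z i) (Z c * E c j) (b i c) + scalar _ (invShift q)
        * (scalar _ (invShift p) * ∑ a, S (E i a * Z a) (Z c * E c j) (b a c)) := by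
    intro c
    rw [← mul_assoc, ← scalar_commute, mul_assoc, add_mul, h2, mul_assoc, Finset.sum_mul, mul_add]
    simp only [h2]
  simp only [h3, Finset.sum_add_distrib, ← Finset.mul_sum]

section Tensor

variable {V M : Type*} [AddCommGroup V] [Module ℂ V] [AddCommGroup M] [Module ℂ M]

theorem tmul_ne_zero {v : V} {w : M} (hv : v ≠ 0) (hw : w ≠ 0) : v ⊗ₜ[ℂ] w ≠ 0 := by
  have h1 : ∃ f : Module.Dual ℂ V, f v ≠ 0 := by
    by_contra hne
    push Not at hne
    exact hv ((Module.forall_dual_apply_eq_zero_iff ℂ v).1 hne)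
  have h2 : ∃ f : Module.Dual ℂ M, f w ≠ 0 := by
    by_contra hne
    push Not at hne
    exact hw ((Module.forall_dual_apply_eq_zero_iff ℂ w).1 hne)
  obtain ⟨f, hf⟩ := h1
  obtain ⟨g, hg⟩ := h2
  intro h
  have h3 := congrArg (fun z => LinearMap.mul' ℂ ℂ (TensorProduct.map f g z)) h
  simp only [TensorProduct.map_tmul, LinearMap.mul'_apply, map_zero] at h3
  exact (mul_ne_zero hf hg) h3

variable {s ε : Fin (N + 1) → ℤˣ} {θ : ℂ}
  {E : Matrix (Fin (N + 1)) (Fin (N + 1)) (Module.End ℂ V)}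
  {Z : Fin (N + 1) → Module.End ℂ V} {wt : Fin (N + 1) → ℂ} {vac : V}
  {b : Matrix (Fin (N + 1)) (Fin (N + 1)) (PowerSeries (Module.End ℂ M))}
  {μ : Fin (N + 1) → PowerSeries ℂ} {w : M}

/-- The operators `E_{ij} ⊗ 1`. -/
noncomputable def leftMatrix (M : Type*) [AddCommGroup M] [Module ℂ M]
    (E : Matrix (Fin (N + 1)) (Fin (N + 1)) (Module.End ℂ V)) :
    Matrix (Fin (N + 1)) (Fin (N + 1)) (Module.End ℂ (V ⊗[ℂ] M)) :=
  Matrix.of fun i j => Module.End.rTensorAlgHom ℂ V M (E i j)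

/-- The operator series `1 ⊗ b_{ij}(u)`. -/
noncomputable def rightMatrix (V : Type*) [AddCommGroup V] [Module ℂ V]
    (b : Matrix (Fin (N + 1)) (Fin (N + 1)) (PowerSeries (Module.End ℂ M))) :
    Matrix (Fin (N + 1)) (Fin (N + 1)) (PowerSeries (Module.End ℂ (V ⊗[ℂ] M))) :=
  (PowerSeries.map (Module.End.lTensorAlgHom ℂ M V).toRingHom).mapMatrix b

/-- The dressed operators on `V ⊗ M`. -/
noncomputable def tensorDress (p q : ℂ) (E : Matrix (Fin (N + 1)) (Fin (N + 1)) (Module.End ℂ V))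
    (Z : Fin (N + 1) → Module.End ℂ V)
    (b : Matrix (Fin (N + 1)) (Fin (N + 1)) (PowerSeries (Module.End ℂ M))) :
    Matrix (Fin (N + 1)) (Fin (N + 1)) (PowerSeries (Module.End ℂ (V ⊗[ℂ] M))) :=
  dress p q (leftMatrix M E) (fun k => Module.End.rTensorAlgHom ℂ V M (Z k)) (rightMatrix V b)

theorem isRep_tensorDress {p q : ℂ} (hb : IsRep s ε b) (h : IsOscillator s θ E Z)
    (hpq : p + q = θ) : IsRep s ε (tensorDress p q E Z b) := by
  have hcomm : ∀ (A : Module.End ℂ V) (B : Module.End ℂ M),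
      Commute (Module.End.lTensorAlgHom ℂ M V B) (Module.End.rTensorAlgHom ℂ V M A) := by
    intro A B
    ext x y
    rfl
  refine (hb.map _).dress (h.map _) hpq ?_ ?_
  · intro i j k l r
    rw [RingHom.mapMatrix_apply, Matrix.map_apply, PowerSeries.coeff_map]
    exact hcomm _ _
  · intro i k l r
    rw [RingHom.mapMatrix_apply, Matrix.map_apply, PowerSeries.coeff_map]
    exact hcomm _ _

theorem coeff_sandwich (A B : Module.End ℂ V) (F : PowerSeries (Module.End ℂ M)) (r : ℕ) (v : V)
    (w : M) :
    PowerSeries.coeff r (PowerSeries.C (Module.End.rTensorAlgHom ℂ V M A)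
        * PowerSeries.map (Module.End.lTensorAlgHom ℂ M V).toRingHom F
        * PowerSeries.C (Module.End.rTensorAlgHom ℂ V M B)) (v ⊗ₜ[ℂ] w)
      = A (B v) ⊗ₜ[ℂ] (PowerSeries.coeff r F w) := by
  rw [PowerSeries.coeff_mul_C, PowerSeries.coeff_C_mul, PowerSeries.coeff_map]
  rfl

theorem actsBy_sandwich_zero {A B : Module.End ℂ V} {F : PowerSeries (Module.End ℂ M)} {v : V}
    {w : M} (h : A (B v) = 0 ∨ ActsBy w F 0) :
    ActsBy (v ⊗ₜ[ℂ] w) (PowerSeries.C (Module.End.rTensorAlgHom ℂ V M A)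
        * PowerSeries.map (Module.End.lTensorAlgHom ℂ M V).toRingHom F
        * PowerSeries.C (Module.End.rTensorAlgHom ℂ V M B)) 0 := by
  refine actsBy_zero_iff.2 fun r => ?_
  rw [coeff_sandwich]
  rcases h with h | h
  · rw [h, zero_tmul]
  · rw [actsBy_zero_iff.1 h, tmul_zero]

theorem actsBy_sandwich {A B : Module.End ℂ V} {F : PowerSeries (Module.End ℂ M)} {v : V}
    {w : M} {c : ℂ} {f : PowerSeries ℂ} (h : A (B v) = c • v) (hF : ActsBy w F f) :
    ActsBy (v ⊗ₜ[ℂ] w) (PowerSeries.C (Module.End.rTensorAlgHom ℂ V M A)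
        * PowerSeries.map (Module.End.lTensorAlgHom ℂ M V).toRingHom F
        * PowerSeries.C (Module.End.rTensorAlgHom ℂ V M B)) (PowerSeries.C c * f) := by
  intro r
  rw [coeff_sandwich, h, hF, PowerSeries.coeff_C_mul, smul_tmul_smul]

/-- The entries of the dressed matrix, with all operators on `V` collected around `b(u)`. -/
theorem tensorDress_apply (p q : ℂ) (E : Matrix (Fin (N + 1)) (Fin (N + 1)) (Module.End ℂ V))
    (Z : Fin (N + 1) → Module.End ℂ V)
    (b : Matrix (Fin (N + 1)) (Fin (N + 1)) (PowerSeries (Module.End ℂ M))) (i j : Fin (N + 1)) :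
    let S := fun (A B : Module.End ℂ V) (F : PowerSeries (Module.End ℂ M)) =>
      PowerSeries.C (Module.End.rTensorAlgHom ℂ V M A)
        * PowerSeries.map (Module.End.lTensorAlgHom ℂ M V).toRingHom F
        * PowerSeries.C (Module.End.rTensorAlgHom ℂ V M B)
    tensorDress p q E Z b i j
      = (S (Z i) (Z j) (b i j) + scalar _ (invShift p) * ∑ a, S (E i a * Z a) (Z j) (b a j))
        + (scalar _ (invShift q) * ∑ c, S (Z i) (Z c * E c j) (b i c)
        + scalar _ (invShift q) * (scalar _ (invShift p)
          * ∑ c, ∑ a, S (E i a * Z a) (Z c * E c j) (b a c))) := by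
  intro S
  have h := dress_apply p q (leftMatrix M E) (fun k => Module.End.rTensorAlgHom ℂ V M (Z k))
    (rightMatrix V b) i j
  simp only [leftMatrix, Matrix.of_apply, ← map_mul (Module.End.rTensorAlgHom ℂ V M)] at h
  exact h

/-- The weight of `vac ⊗ w` for the dressed operators. -/
noncomputable def dressWeight (s : Fin (N + 1) → ℤˣ) (p q : ℂ) (wt : Fin (N + 1) → ℂ)
    (μ : Fin (N + 1) → PowerSeries ℂ) (i : Fin (N + 1)) : PowerSeries ℂ :=
  μ i + invShift p * (PowerSeries.C (wt i) * μ i) + (invShift q * (PowerSeries.C (wt i) * μ i)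
    + invShift q * (invShift p * ∑ a, PowerSeries.C (pairWeight s wt i a) * μ a))

/-- The dressed representation has the highest weight vector `vac ⊗ w`. An entry of `b(u)` above the
diagonal kills `w`, one below the diagonal is multiplied by operators killing `vac`, and the
diagonal ones give the weight. -/
theorem IsHighest.tensorDress (p q : ℂ) (hw : IsHighest b μ w) (hv : IsVacuum E Z wt vac)
    (h : IsOscillator s θ E Z) :
    IsHighest (tensorDress p q E Z b) (dressWeight s p q wt μ) (vac ⊗ₜ[ℂ] w) where
  ne_zero := tmul_ne_zero hv.ne_zero hw.ne_zero
  upper i j hij := by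
    rw [tensorDress_apply]
    have e : (0 : PowerSeries ℂ) = (0 + invShift p * ∑ a : Fin (N + 1), 0)
        + (invShift q * ∑ a : Fin (N + 1), 0
          + invShift q * (invShift p * ∑ c : Fin (N + 1), ∑ a : Fin (N + 1), 0)) := by simp
    rw [e]
    refine ((actsBy_sandwich_zero ?_).add (ActsBy.scalar_mul (ActsBy.sum _ fun a _ => ?_) _)).add
      ((ActsBy.scalar_mul (ActsBy.sum _ fun a _ => ?_) _).add (ActsBy.scalar_mul
        (ActsBy.scalar_mul (ActsBy.sum _ fun c _ => ActsBy.sum _ fun a _ => ?_) _) _))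
    · exact Or.inr (hw.upper i j hij)
    · refine actsBy_sandwich_zero ?_
      rcases lt_or_ge a j with ha | ha
      · exact Or.inr (hw.upper a j ha)
      · left
        rw [Module.End.mul_apply, hv.fixed, hv.fixed, hv.upper i a (hij.trans_le ha)]
    · refine actsBy_sandwich_zero ?_
      rcases lt_or_ge i a with ha | ha
      · exact Or.inr (hw.upper i a ha)
      · left
        rw [Module.End.mul_apply, hv.upper a j (ha.trans_lt hij), map_zero, map_zero]
    · refine actsBy_sandwich_zero ?_
      rw [Module.End.mul_apply, Module.End.mul_apply]
      rcases lt_trichotomy a c with hac | rfl | hac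
      · exact Or.inr (hw.upper a c hac)
      · exact Or.inl (hv.same_upper h a hij)
      · exact Or.inl (hv.lower_upper h hac hij.le)
  diag i := by
    rw [tensorDress_apply]
    have e : dressWeight s p q wt μ i = (PowerSeries.C 1 * μ i
        + invShift p * ∑ a : Fin (N + 1), if a = i then PowerSeries.C (wt i) * μ i else 0)
        + (invShift q * ∑ a : Fin (N + 1), (if a = i then PowerSeries.C (wt i) * μ i else 0)
          + invShift q * (invShift p * ∑ c : Fin (N + 1), ∑ a : Fin (N + 1),
            if a = c then PowerSeries.C (pairWeight s wt i c) * μ c else 0)) := by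
      simp [dressWeight]
    rw [e]
    refine ((actsBy_sandwich ?_ (hw.diag i)).add
      (ActsBy.scalar_mul (ActsBy.sum _ fun a _ => ?_) _)).add
      ((ActsBy.scalar_mul (ActsBy.sum _ fun a _ => ?_) _).add (ActsBy.scalar_mul
        (ActsBy.scalar_mul (ActsBy.sum _ fun c _ => ActsBy.sum _ fun a _ => ?_) _) _))
    · rw [hv.fixed, hv.fixed, one_smul]
    · split_ifs with ha
      · subst ha
        refine actsBy_sandwich ?_ (hw.diag a)
        rw [Module.End.mul_apply, hv.fixed, hv.fixed, hv.diag]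
      · refine actsBy_sandwich_zero ?_
        rcases lt_or_ge a i with ha' | ha'
        · exact Or.inr (hw.upper a i ha')
        · left
          rw [Module.End.mul_apply, hv.fixed, hv.fixed, hv.upper i a (lt_of_le_of_ne ha' (Ne.symm ha))]
    · split_ifs with ha
      · subst ha
        refine actsBy_sandwich ?_ (hw.diag a)
        rw [Module.End.mul_apply, IsVacuum.sq_apply h, hv.diag]
      · refine actsBy_sandwich_zero ?_
        rcases lt_or_ge i a with ha' | ha'
        · exact Or.inr (hw.upper i a ha')
        · left
          rw [Module.End.mul_apply, hv.upper a i (lt_of_le_of_ne ha' ha), map_zero, map_zero]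
    · split_ifs with hac
      · subst hac
        refine actsBy_sandwich ?_ (hw.diag a)
        rw [Module.End.mul_apply, Module.End.mul_apply, hv.same_diag h]
      · refine actsBy_sandwich_zero ?_
        rw [Module.End.mul_apply, Module.End.mul_apply]
        rcases lt_or_gt_of_ne hac with hac | hac
        · exact Or.inr (hw.upper a c hac)
        · exact Or.inl (hv.lower_upper h hac le_rfl)

end Tensor

/-! ### Oscillator realization -/

/-- The commutation sign of the oscillators number `i` and `j`, which have parities `|i| + |h|` and
`|j| + |h|`; in particular the oscillator number `h` is always bosonic. -/
def modeSign (s : Fin (N + 1) → ℤˣ) (h i j : Fin (N + 1)) : ℤˣ :=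
  (-1) ^ ((parity s i + parity s h) * (parity s j + parity s h))

theorem modeSign_comm (s : Fin (N + 1) → ℤˣ) (h i j : Fin (N + 1)) :
    modeSign s h i j = modeSign s h j i := by
  rw [modeSign, modeSign, mul_comm]

/-- Creation operators `c` and annihilation operators `a` with the commutation signs
`modeSign`. -/
structure IsFock {A : Type*} [Ring A] (s : Fin (N + 1) → ℤˣ) (h : Fin (N + 1))
    (c a : Fin (N + 1) → A) : Prop where
  cc : ∀ i j, c i * c j = ((modeSign s h i j : ℤˣ) : ℤ) • (c j * c i)
  aa : ∀ i j, a i * a j = ((modeSign s h i j : ℤˣ) : ℤ) • (a j * a i)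
  ac : ∀ i j, a i * c j = (if i = j then 1 else 0) + ((modeSign s h i j : ℤˣ) : ℤ) • (c j * a i)

section Algebraic

variable {A : Type*} [Ring A] {s : Fin (N + 1) → ℤˣ} {h : Fin (N + 1)} {c a : Fin (N + 1) → A}

theorem unit_mul_self (u : ℤˣ) : (u : ℤ) * (u : ℤ) = 1 := by
  rcases Int.units_eq_one_or u with h | h <;> simp [h]

theorem IsFock.ca (H : IsFock s h c a) (i j : Fin (N + 1)) :
    c j * a i = ((modeSign s h i j : ℤˣ) : ℤ) • (a i * c j - if i = j then 1 else 0) := by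
  rw [H.ac, add_sub_cancel_left, smul_smul, unit_mul_self, one_smul]

/-- The number operator raises the degree of `c`. -/
theorem IsFock.number_c (H : IsFock s h c a) (i : Fin (N + 1)) :
    (∑ j, c j * a j) * c i = c i * (∑ j, c j * a j) + c i := by
  have h1 : ∀ j, c j * a j * c i = c i * (c j * a j) + if j = i then c j else 0 := by
    intro j
    rw [mul_assoc, H.ac, mul_add, mul_smul_comm, ← mul_assoc, H.cc j i, smul_mul_assoc, smul_smul,
      unit_mul_self, one_smul, mul_assoc, add_comm]
    split_ifs <;> simp
  rw [Finset.sum_mul, Finset.mul_sum]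
  simp only [h1, Finset.sum_add_distrib]
  simp

/-- The number operator lowers the degree of `a`. -/
theorem IsFock.number_a (H : IsFock s h c a) (i : Fin (N + 1)) :
    (∑ j, c j * a j) * a i = a i * (∑ j, c j * a j) - a i := by
  have h1 : ∀ j, c j * a j * a i = a i * (c j * a j) - if i = j then a j else 0 := by
    intro j
    rw [mul_assoc, H.aa, mul_smul_comm, ← mul_assoc, H.ca, smul_mul_assoc, smul_smul,
      modeSign_comm s h j i, unit_mul_self, one_smul, sub_mul, mul_assoc]
    split_ifs <;> simp
  rw [Finset.sum_mul, Finset.mul_sum]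
  simp only [h1, Finset.sum_sub_distrib]
  simp

/-- The operators `E_{ij} = s_j c_i a_j`. -/
def fockE (s : Fin (N + 1) → ℤˣ) (c a : Fin (N + 1) → A) : Matrix (Fin (N + 1)) (Fin (N + 1)) A :=
  Matrix.of fun i j => ((s j : ℤˣ) : ℤ) • (c i * a j)

theorem IsFock.number_E (H : IsFock s h c a) (i j : Fin (N + 1)) :
    (∑ l, c l * a l) * fockE s c a i j = fockE s c a i j * ∑ l, c l * a l := by
  simp only [fockE, Matrix.of_apply]
  rw [mul_smul_comm, smul_mul_assoc, ← mul_assoc, H.number_c, add_mul, mul_assoc, H.number_a,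
    mul_sub, mul_assoc]
  simp

theorem parity_sign (s : Fin (N + 1) → ℤˣ) (i : Fin (N + 1)) :
    ((s i : ℤˣ) : ℤ) = (-1) ^ parity s i := by
  rcases Int.units_eq_one_or (s i) with h | h <;> simp [parity, h]

/-- The operators `s_j c_i a_j` satisfy the relations of `𝔤𝔩` with the parity sequence `s`. -/
theorem IsFock.comm (H : IsFock s h c a) (i j k l : Fin (N + 1)) :
    fockE s c a i j * fockE s c a k l
      - (sgn s i k * sgn s i l * sgn s j k * sgn s j l) • (fockE s c a k l * fockE s c a i j)
    = (sgn s i j * sgn s i k * sgn s j k) • ((if k = j then fockE s c a i l else 0)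
        - (if i = l then fockE s c a k j else 0)) := by
  have h1 : ∀ i j k l, c i * a j * (c k * a l) = (if j = k then c i * a l else 0)
      + ((modeSign s h j k : ℤˣ) : ℤ) • (c i * c k * (a j * a l)) := by
    intro i j k l
    rw [mul_assoc, ← mul_assoc (a j), H.ac, add_mul, mul_add, smul_mul_assoc, mul_smul_comm]
    simp only [mul_assoc]
    split_ifs <;> simp
  simp only [fockE, Matrix.of_apply]
  rw [smul_mul_smul_comm, smul_mul_smul_comm, h1 i j k l, h1 k l i j, H.cc k i, H.aa l j,
    smul_mul_smul_comm]
  have hτ : ∀ i j, ((modeSign s h i j : ℤˣ) : ℤ)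
      = (-1) ^ ((parity s i + parity s h) * (parity s j + parity s h)) := by
    intro i j
    simp [modeSign]
  simp only [smul_add, smul_sub, smul_smul, hτ]
  have e1 : (sgn s i k * sgn s i l * sgn s j k * sgn s j l * (↑(s l) * ↑(s j))
      * ((-1) ^ ((parity s l + parity s h) * (parity s i + parity s h))
        * ((-1) ^ ((parity s k + parity s h) * (parity s i + parity s h))
        * (-1) ^ ((parity s l + parity s h) * (parity s j + parity s h)))) : ℤ)
      = ↑(s j) * ↑(s l) * (-1) ^ ((parity s j + parity s h) * (parity s k + parity s h)) := by
    simp only [parity_sign, sgn]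
    rcases parity_cases s i with hi | hi <;> rcases parity_cases s j with hj | hj <;>
    rcases parity_cases s k with hk | hk <;> rcases parity_cases s l with hl | hl <;>
    rcases parity_cases s h with hh | hh <;> simp [hi, hj, hk, hl, hh]
  rw [mul_assoc] at e1
  simp only [mul_assoc] at e1 ⊢
  rw [e1]
  have e2 : (↑(s j) * ↑(s l) : ℤ) • (if j = k then c i * a l else 0)
      = (sgn s i j * (sgn s i k * sgn s j k)) • (if k = j then (s l : ℤ) • (c i * a l) else 0) := by
    by_cases hjk : j = k
    · subst hjk
      rw [if_pos rfl, if_pos rfl, smul_smul]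
      congr 1
      simp only [parity_sign, sgn]
      rcases parity_cases s i with hi | hi <;> rcases parity_cases s j with hj | hj <;>
      rcases parity_cases s l with hl | hl <;> simp [hi, hj, hl]
    · rw [if_neg hjk, if_neg (Ne.symm hjk)]
      simp
  have e3 : (sgn s i k * (sgn s i l * (sgn s j k * (sgn s j l * (↑(s l) * ↑(s j))))) : ℤ)
        • (if l = i then c k * a j else 0)
      = (sgn s i j * (sgn s i k * sgn s j k)) • (if i = l then (s j : ℤ) • (c k * a j) else 0) := by
    by_cases hjk : l = i
    · subst hjk
      rw [if_pos rfl, if_pos rfl, smul_smul]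
      congr 1
      simp only [parity_sign, sgn]
      rcases parity_cases s k with hi | hi <;> rcases parity_cases s j with hj | hj <;>
      rcases parity_cases s l with hl | hl <;> simp [hi, hj, hl]
    · rw [if_neg hjk, if_neg (Ne.symm hjk)]
      simp
  rw [e2, e3]
  abel

/-- `E²` is `E` times a function of the number operator. -/
theorem IsFock.quad (H : IsFock s h c a) (i k : Fin (N + 1)) :
    ∑ j, fockE s c a i j * fockE s c a j k
      = fockE s c a i k * (((∑ j, ((s j : ℤˣ) : ℤ)) - ((s h : ℤˣ) : ℤ)) • (1 : A)
        + ((s h : ℤˣ) : ℤ) • ∑ j, c j * a j) := by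
  have h1 : ∀ j, ((s j : ℤˣ) : ℤ) • (a j * c j)
      = ((s j : ℤˣ) : ℤ) • (1 : A) + ((s h : ℤˣ) : ℤ) • (c j * a j) := by
    intro j
    rw [H.ac, if_pos rfl, smul_add, smul_smul]
    congr 2
    simp only [parity_sign, modeSign]
    rcases parity_cases s h with hi | hi <;> rcases parity_cases s j with hj | hj <;> simp [hi, hj]
  have h2 : ∀ j, fockE s c a i j * fockE s c a j k
      = ((s k : ℤˣ) : ℤ) • (c i * ((((s j : ℤˣ) : ℤ) • (a j * c j)) * a k)) := by
    intro j
    simp only [fockE, Matrix.of_apply]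
    rw [smul_mul_smul_comm, smul_mul_assoc, mul_smul_comm, smul_smul, mul_comm]
    simp only [mul_assoc]
  simp only [h2, h1]
  rw [← Finset.smul_sum, ← Finset.mul_sum, ← Finset.sum_mul, Finset.sum_add_distrib,
    ← Finset.sum_smul, ← Finset.smul_sum, add_mul, smul_mul_assoc _ (∑ j, c j * a j), H.number_a]
  simp only [fockE, Matrix.of_apply]
  simp only [mul_add, smul_add, smul_mul_assoc, mul_smul_comm, one_mul, mul_one, mul_sub,
    mul_assoc, smul_sub, sub_smul]
  module

end Algebraic

section Restrict

variable {U : Type*} [AddCommGroup U] [Module ℂ U] {s : Fin (N + 1) → ℤˣ} {h : Fin (N + 1)}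
  {c a : Fin (N + 1) → Module.End ℂ U} {Z : Fin (N + 1) → Module.End ℂ U}

/-- The sign with which `Z_k` commutes with the oscillators number `i`. -/
def gradeSign (s : Fin (N + 1) → ℤˣ) (h k i : Fin (N + 1)) : ℤˣ :=
  (-1) ^ (parity s k * (parity s i + parity s h))

theorem gradeSign_mul (s : Fin (N + 1) → ℤˣ) (h k i j : Fin (N + 1)) :
    ((gradeSign s h k i : ℤˣ) : ℤ) * ((gradeSign s h k j : ℤˣ) : ℤ) = sgn s k i * sgn s k j := by
  simp only [gradeSign, sgn]
  rcases parity_cases s i with hi | hi <;> rcases parity_cases s j with hj | hj <;>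
    rcases parity_cases s k with hk | hk <;> rcases parity_cases s h with hh | hh <;>
    simp [hi, hj, hk, hh]

/-- On an eigenspace of the number operator, `IsFock.quad` becomes `E² = θ E`. -/
theorem IsFock.exists_oscillator (H : IsFock s h c a) (hsq : ∀ k, Z k * Z k = 1)
    (hcomm : ∀ k l, Z k * Z l = Z l * Z k)
    (hc : ∀ k i, Z k * c i = ((gradeSign s h k i : ℤˣ) : ℤ) • (c i * Z k))
    (ha : ∀ k i, Z k * a i = ((gradeSign s h k i : ℤˣ) : ℤ) • (a i * Z k))
    {vac : U} (hvac : vac ≠ 0) (hZ : ∀ k, Z k vac = vac) {ν : Fin (N + 1) → ℂ}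
    (hν : ∀ i, c i (a i vac) = ν i • vac) (hclt : ∀ i, i < h → c i vac = 0)
    (hagt : ∀ i, h < i → a i vac = 0) :
    ∃ (V : Submodule ℂ U) (E : Matrix (Fin (N + 1)) (Fin (N + 1)) (Module.End ℂ V))
      (Z : Fin (N + 1) → Module.End ℂ V) (v : V) (θ : ℂ),
      IsOscillator s θ E Z ∧ IsVacuum E Z (fun i => (s i : ℤ) * ν i) v := by
  set K : Module.End ℂ U := ∑ j, c j * a j with hK
  set κ : ℂ := ∑ j, ν j with hκ
  set V := K.eigenspace κ with hV
  have hmem : ∀ v, v ∈ V ↔ K v = κ • v := fun v => Module.End.mem_eigenspace_iff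
  have hpres : ∀ T : Module.End ℂ U, K * T = T * K → ∀ v ∈ V, T v ∈ V := by
    intro T hT v hv
    rw [hmem] at hv ⊢
    have h1 := congrArg (fun S : Module.End ℂ U => S v) hT
    simp only [Module.End.mul_apply] at h1
    rw [h1, hv, map_smul]
  have hE : ∀ i j, ∀ v ∈ V, fockE s c a i j v ∈ V := fun i j => hpres _ (H.number_E i j)
  have hZE : ∀ k i j, Z k * (c i * a j)
      = (sgn s k i * sgn s k j) • (c i * a j * Z k) := by
    intro k i j
    rw [← mul_assoc, hc, smul_mul_assoc, mul_assoc (c i), ha, mul_smul_comm, smul_smul,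
      gradeSign_mul, mul_assoc]
  have hZV : ∀ k, ∀ v ∈ V, Z k v ∈ V := fun k => hpres _ <| by
    rw [hK, Finset.sum_mul, Finset.mul_sum]
    refine Finset.sum_congr rfl fun j _ => ?_
    rw [hZE, sgn_mul_self, one_smul]
  have hvV : vac ∈ V := by
    rw [hmem, hK, LinearMap.sum_apply, hκ, Finset.sum_smul]
    exact Finset.sum_congr rfl fun j _ => hν j
  refine ⟨V, Matrix.of fun i j => (fockE s c a i j).restrict (hE i j),
    fun k => (Z k).restrict (hZV k), ⟨vac, hvV⟩,
    (((∑ j, ((s j : ℤˣ) : ℤ)) - ((s h : ℤˣ) : ℤ) : ℤ) : ℂ) + ((s h : ℤˣ) : ℤ) * κ, ?_, ?_⟩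
  · constructor
    · intro i j k l
      ext ⟨v, hv⟩
      have h1 := congrArg (fun S : Module.End ℂ U => S v) (H.comm i j k l)
      split_ifs at h1 ⊢ <;> exact h1
    · intro i k
      ext ⟨v, hv⟩
      have h1 := congrArg (fun S : Module.End ℂ U => S v) (H.quad i k)
      simp only [LinearMap.sum_apply, Module.End.mul_apply, LinearMap.add_apply,
        LinearMap.smul_apply, Module.End.one_apply, ← hK] at h1
      rw [(hmem v).1 hv] at h1
      rw [LinearMap.sum_apply, AddSubmonoidClass.coe_finsetSum]
      refine Eq.trans h1 ?_
      rw [LinearMap.smul_apply, Submodule.coe_smul, ← Int.cast_smul_eq_zsmul ℂ,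
        ← Int.cast_smul_eq_zsmul ℂ, smul_smul, ← add_smul, map_smul, Int.cast_sub, Int.cast_sum]
      rfl
    · intro k
      ext ⟨v, hv⟩
      exact congrArg (fun S : Module.End ℂ U => S v) (hsq k)
    · intro k l
      ext ⟨v, hv⟩
      exact congrArg (fun S : Module.End ℂ U => S v) (hcomm k l)
    · intro k i j
      ext ⟨v, hv⟩
      have h1 : Z k * fockE s c a i j = (sgn s k i * sgn s k j) • (fockE s c a i j * Z k) := by
        simp only [fockE, Matrix.of_apply]
        rw [mul_smul_comm, hZE, smul_mul_assoc, smul_comm]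
      exact congrArg (fun S : Module.End ℂ U => S v) h1
  · constructor
    · intro h0
      exact hvac (congrArg Subtype.val h0)
    · intro i j hij
      apply Subtype.ext
      change ((s j : ℤˣ) : ℤ) • (c i * a j) vac = 0
      rcases lt_or_ge h j with hj | hj
      · rw [Module.End.mul_apply, hagt j hj, map_zero, smul_zero]
      · rw [H.ca, if_neg hij.ne', sub_zero, LinearMap.smul_apply, Module.End.mul_apply,
          hclt i (hij.trans_le hj), map_zero, smul_zero, smul_zero]
    · intro i
      apply Subtype.ext
      change ((s i : ℤˣ) : ℤ) • (c i * a i) vac = (((s i : ℤ) : ℂ) * ν i) • vac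
      rw [Module.End.mul_apply, hν, ← smul_assoc, zsmul_eq_mul]
    · intro k
      exact Subtype.ext (hZ k)

end Restrict

/-! ### Fock space -/

/-- The sign with which the oscillators number `j` pass those with a smaller number, on the
vector of multidegree `m`. -/
def tailSign (s : Fin (N + 1) → ℤˣ) (h j : Fin (N + 1)) (m : Fin (N + 1) → ℤ) : ℤˣ :=
  ∏ i ∈ Finset.Iio j, modeSign s h i j ^ m i

theorem zpow_odd (u : ℤˣ) {t : ℤ} (ht : Odd t) : u ^ t = u := by
  rcases Int.units_eq_one_or u with h | h
  · simp [h]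
  · rw [h, ht.neg_one_zpow]

theorem prod_zpow_add_single (u : Fin (N + 1) → ℤˣ) (A : Finset (Fin (N + 1)))
    (m : Fin (N + 1) → ℤ) {i : Fin (N + 1)} (hi : i ∈ A) {t : ℤ} (ht : Odd t) :
    ∏ k ∈ A, u k ^ (m + Pi.single i t : Fin (N + 1) → ℤ) k = u i * ∏ k ∈ A, u k ^ m k := by
  have h1 : ∀ k, u k ^ (m + (Pi.single i t : Fin (N + 1) → ℤ)) k
      = u k ^ (Pi.single i t : Fin (N + 1) → ℤ) k * u k ^ m k :=
    fun k => by rw [Pi.add_apply, zpow_add, mul_comm]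
  simp only [h1, Finset.prod_mul_distrib]
  congr 1
  rw [Finset.prod_eq_single_of_mem i hi]
  · rw [Pi.single_eq_same, zpow_odd _ ht]
  · intro k _ hk
    rw [Pi.single_eq_of_ne hk, zpow_zero]

theorem tailSign_of_lt (s : Fin (N + 1) → ℤˣ) (h : Fin (N + 1)) {i j : Fin (N + 1)} (hij : i < j)
    (m : Fin (N + 1) → ℤ) {t : ℤ} (ht : Odd t) :
    tailSign s h j (m + Pi.single i t) = modeSign s h i j * tailSign s h j m :=
  prod_zpow_add_single (fun i => modeSign s h i j) _ m (Finset.mem_Iio.2 hij) ht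

theorem tailSign_of_le (s : Fin (N + 1) → ℤˣ) (h : Fin (N + 1)) {i j : Fin (N + 1)} (hij : j ≤ i)
    (m : Fin (N + 1) → ℤ) (t : ℤ) :
    tailSign s h j (m + Pi.single i t) = tailSign s h j m := by
  refine Finset.prod_congr rfl fun k hk => ?_
  rw [Finset.mem_Iio] at hk
  rw [Pi.add_apply, Pi.single_eq_of_ne (hk.trans_le hij).ne, add_zero]

/-- The operator that shifts the degree number `j` by `-t`, with the weight `w` and the
sign `tailSign`. Vectors are arbitrary functions of the multidegree. -/
def modeOp (s : Fin (N + 1) → ℤˣ) (h j : Fin (N + 1)) (t : ℤ) (w : ℤ → ℂ) :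
    Module.End ℂ ((Fin (N + 1) → ℤ) → ℂ) where
  toFun f m := ((tailSign s h j m : ℤˣ) : ℤ) * w (m j) * f (m + Pi.single j t)
  map_add' f g := by
    ext m
    simp only [Pi.add_apply]
    ring
  map_smul' z f := by
    ext m
    simp only [Pi.smul_apply, smul_eq_mul, RingHom.id_apply]
    ring

theorem modeOp_apply (s : Fin (N + 1) → ℤˣ) (h j : Fin (N + 1)) (t : ℤ) (w : ℤ → ℂ)
    (f : (Fin (N + 1) → ℤ) → ℂ) (m : Fin (N + 1) → ℤ) :
    modeOp s h j t w f m
      = ((tailSign s h j m : ℤˣ) : ℤ) * w (m j) * f (m + Pi.single j t) := rfl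

theorem modeOp_exchange_lt (s : Fin (N + 1) → ℤˣ) (h : Fin (N + 1)) {i j : Fin (N + 1)}
    (hij : i < j) {t t' : ℤ} (ht : Odd t) (w w' : ℤ → ℂ) :
    modeOp s h i t w * modeOp s h j t' w'
      = ((modeSign s h i j : ℤˣ) : ℤ) • (modeOp s h j t' w' * modeOp s h i t w) := by
  ext f m
  rw [LinearMap.smul_apply, Pi.smul_apply, Module.End.mul_apply, Module.End.mul_apply,
    modeOp_apply, modeOp_apply, modeOp_apply, modeOp_apply, tailSign_of_lt s h hij m ht,
    tailSign_of_le s h hij.le, add_right_comm, zsmul_eq_mul, Pi.add_apply, Pi.add_apply,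
    Pi.single_eq_of_ne hij.ne, Pi.single_eq_of_ne hij.ne']
  push_cast
  ring_nf

theorem modeOp_exchange (s : Fin (N + 1) → ℤˣ) (h : Fin (N + 1)) {i j : Fin (N + 1)}
    (hij : i ≠ j) {t t' : ℤ} (ht : Odd t) (ht' : Odd t') (w w' : ℤ → ℂ) :
    modeOp s h i t w * modeOp s h j t' w'
      = ((modeSign s h i j : ℤˣ) : ℤ) • (modeOp s h j t' w' * modeOp s h i t w) := by
  rcases lt_or_gt_of_ne hij with h1 | h1
  · exact modeOp_exchange_lt s h h1 ht w w'
  · rw [modeOp_exchange_lt s h h1 ht' w' w, smul_smul, modeSign_comm s h i j, unit_mul_self,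
      one_smul]

theorem modeOp_same (s : Fin (N + 1) → ℤˣ) (h i : Fin (N + 1)) (t t' : ℤ) (w w' : ℤ → ℂ)
    (f : (Fin (N + 1) → ℤ) → ℂ) (m : Fin (N + 1) → ℤ) :
    modeOp s h i t w (modeOp s h i t' w' f) m
      = w (m i) * w' (m i + t) * f (m + Pi.single i (t + t')) := by
  have h1 : (((tailSign s h i m : ℤˣ) : ℤ) : ℂ) * ((tailSign s h i m : ℤˣ) : ℤ) = 1 := by
    exact_mod_cast unit_mul_self _
  rw [modeOp_apply, modeOp_apply, tailSign_of_le s h le_rfl, Pi.add_apply, Pi.single_eq_same,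
    add_assoc, ← Pi.single_add]
  linear_combination (w (m i) * w' (m i + t) * f (m + Pi.single i (t + t'))) * h1

theorem modeSign_self (s : Fin (N + 1) → ℤˣ) (h j : Fin (N + 1)) :
    modeSign s h j j = if s j = s h then 1 else -1 := by
  rcases Int.units_eq_one_or (s j) with hj | hj <;> rcases Int.units_eq_one_or (s h) with hh | hh <;>
    simp [modeSign, parity, hj, hh]
  decide

/-- The matrix coefficient of the creation operator number `j` from degree `n` to `n + 1`. The
degrees of the modes run over all integers, and the coefficients are chosen so that degree `0` is
annihilated by the creation operators before `h` and by the annihilation operators after `h`. -/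
noncomputable def raiseWeight (s : Fin (N + 1) → ℤˣ) (h j : Fin (N + 1)) (n : ℤ) : ℂ :=
  if s j = s h then (if j < h then n else 1) else if (j < h ↔ Odd n) then 1 else 0

/-- The matrix coefficient of the annihilation operator number `j` from degree `n` to `n - 1`.
The mode `h` has the free parameter `β`. -/
noncomputable def lowerWeight (s : Fin (N + 1) → ℤˣ) (h : Fin (N + 1)) (β : ℂ) (j : Fin (N + 1))
    (n : ℤ) : ℂ :=
  if s j = s h then (if j < h then 1 else if j = h then n + β else n)
  else if (j < h ↔ Even n) then 1 else 0

theorem raise_lower (s : Fin (N + 1) → ℤˣ) (h : Fin (N + 1)) (β : ℂ) (j : Fin (N + 1)) (n : ℤ) :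
    lowerWeight s h β j (n + 1) * raiseWeight s h j n
      = 1 + ((modeSign s h j j : ℤˣ) : ℤ) *
        (raiseWeight s h j (n - 1) * lowerWeight s h β j n) := by
  rw [modeSign_self]
  unfold lowerWeight raiseWeight
  by_cases h1 : s j = s h
  · by_cases h2 : j < h
    · simp [h1, h2]
    · by_cases h3 : j = h
      · simp [h3]; ring
      · simp [h1, h2, h3]; ring
  · by_cases h2 : j < h <;> rcases Int.even_or_odd n with h3 | h3
    all_goals
      have h4 := h3
      first | rw [← Int.not_odd_iff_even] at h4 | rw [← Int.not_even_iff_odd] at h4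
      simp [h1, h2, h3, h4, parity_simps]

theorem raise_raise {s : Fin (N + 1) → ℤˣ} {h j : Fin (N + 1)} (hj : s j ≠ s h) (n : ℤ) :
    raiseWeight s h j n * raiseWeight s h j (n - 1) = 0 := by
  unfold raiseWeight
  by_cases h2 : j < h <;> rcases Int.even_or_odd n with h3 | h3
  all_goals
    have h4 := h3
    first | rw [← Int.not_odd_iff_even] at h4 | rw [← Int.not_even_iff_odd] at h4
    simp [hj, h2, h3, h4, parity_simps]

theorem lower_lower {s : Fin (N + 1) → ℤˣ} {h j : Fin (N + 1)} (hj : s j ≠ s h) (β : ℂ) (n : ℤ) :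
    lowerWeight s h β j n * lowerWeight s h β j (n + 1) = 0 := by
  unfold lowerWeight
  by_cases h2 : j < h <;> rcases Int.even_or_odd n with h3 | h3
  all_goals
    have h4 := h3
    first | rw [← Int.not_odd_iff_even] at h4 | rw [← Int.not_even_iff_odd] at h4
    simp [hj, h2, h3, h4, parity_simps]

/-- The creation operators on functions on `ℤ ^ (N + 1)`. -/
noncomputable def raiseOp (s : Fin (N + 1) → ℤˣ) (h j : Fin (N + 1)) :
    Module.End ℂ ((Fin (N + 1) → ℤ) → ℂ) :=
  modeOp s h j (-1) fun n => raiseWeight s h j (n - 1)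

/-- The annihilation operators on functions on `ℤ ^ (N + 1)`. -/
noncomputable def lowerOp (s : Fin (N + 1) → ℤˣ) (h : Fin (N + 1)) (β : ℂ) (j : Fin (N + 1)) :
    Module.End ℂ ((Fin (N + 1) → ℤ) → ℂ) :=
  modeOp s h j 1 fun n => lowerWeight s h β j (n + 1)

theorem isFock (s : Fin (N + 1) → ℤˣ) (h : Fin (N + 1)) (β : ℂ) :
    IsFock s h (raiseOp s h) (lowerOp s h β) where
  cc i j := by
    by_cases hij : i = j
    · subst hij
      by_cases hi : s i = s h
      · rw [modeSign_self, if_pos hi]; simp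
      · have h0 : raiseOp s h i * raiseOp s h i = 0 := by
          ext f m
          rw [Module.End.mul_apply, raiseOp, modeOp_same, ← sub_eq_add_neg, raise_raise hi, zero_mul]
          rfl
        rw [h0, smul_zero]
    · exact modeOp_exchange s h hij (by decide) (by decide) _ _
  aa i j := by
    by_cases hij : i = j
    · subst hij
      by_cases hi : s i = s h
      · rw [modeSign_self, if_pos hi]; simp
      · have h0 : lowerOp s h β i * lowerOp s h β i = 0 := by
          ext f m
          rw [Module.End.mul_apply, lowerOp, modeOp_same, lower_lower hi, zero_mul]
          rfl
        rw [h0, smul_zero]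
    · exact modeOp_exchange s h hij (by decide) (by decide) _ _
  ac i j := by
    by_cases hij : i = j
    · subst hij
      ext f m
      rw [if_pos rfl, LinearMap.add_apply, LinearMap.smul_apply, Pi.add_apply, Pi.smul_apply,
        Module.End.mul_apply, Module.End.mul_apply, Module.End.one_apply, lowerOp, raiseOp,
        modeOp_same, modeOp_same, add_sub_cancel_right, raise_lower, zsmul_eq_mul]
      simp only [add_neg_cancel, neg_add_cancel, Pi.single_zero, add_zero]
      ring_nf
    · rw [if_neg hij, zero_add]
      exact modeOp_exchange s h hij (by decide) (by decide) _ _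

/-- The operator with eigenvalue `∏ i, gradeSign s h k i ^ m i` in multidegree `m`. -/
def gradeOp (s : Fin (N + 1) → ℤˣ) (h k : Fin (N + 1)) :
    Module.End ℂ ((Fin (N + 1) → ℤ) → ℂ) where
  toFun f m := ((∏ i, gradeSign s h k i ^ m i : ℤˣ) : ℤ) * f m
  map_add' f g := by
    ext m
    simp only [Pi.add_apply]
    ring
  map_smul' z f := by
    ext m
    simp only [Pi.smul_apply, smul_eq_mul, RingHom.id_apply]
    ring

theorem gradeOp_apply (s : Fin (N + 1) → ℤˣ) (h k : Fin (N + 1)) (f : (Fin (N + 1) → ℤ) → ℂ)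
    (m : Fin (N + 1) → ℤ) :
    gradeOp s h k f m = ((∏ i, gradeSign s h k i ^ m i : ℤˣ) : ℤ) * f m := rfl

theorem gradeOp_modeOp (s : Fin (N + 1) → ℤˣ) (h k i : Fin (N + 1)) {t : ℤ} (ht : Odd t)
    (w : ℤ → ℂ) :
    gradeOp s h k * modeOp s h i t w
      = ((gradeSign s h k i : ℤˣ) : ℤ) • (modeOp s h i t w * gradeOp s h k) := by
  ext f m
  rw [LinearMap.smul_apply, Pi.smul_apply, Module.End.mul_apply, Module.End.mul_apply,
    gradeOp_apply, modeOp_apply, modeOp_apply, gradeOp_apply, zsmul_eq_mul,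
    prod_zpow_add_single (gradeSign s h k) _ m (Finset.mem_univ i) ht]
  have h1 : (((gradeSign s h k i : ℤˣ) : ℤ) : ℂ) * ((gradeSign s h k i : ℤˣ) : ℤ) = 1 := by
    exact_mod_cast unit_mul_self _
  rw [Units.val_mul, Int.cast_mul]
  generalize (((∏ i, gradeSign s h k i ^ m i : ℤˣ) : ℤ) : ℂ) = z
  linear_combination (-z * ((tailSign s h i m : ℤˣ) : ℤ) * w (m i) * f (m + Pi.single i t)) * h1

/-- Oscillator operators whose vacuum has the prescribed weight `α` at `h` and weight zero
after `h`. The vacuum is the delta function at multidegree zero. -/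
theorem exists_vacuum (s : Fin (N + 1) → ℤˣ) (h : Fin (N + 1)) (α : ℂ) :
    ∃ (V : Submodule ℂ ((Fin (N + 1) → ℤ) → ℂ))
      (E : Matrix (Fin (N + 1)) (Fin (N + 1)) (Module.End ℂ V))
      (Z : Fin (N + 1) → Module.End ℂ V) (wt : Fin (N + 1) → ℂ) (vac : V) (θ : ℂ),
      IsOscillator s θ E Z ∧ IsVacuum E Z wt vac ∧ wt h = α ∧ ∀ i, h < i → wt i = 0 := by
  set β : ℂ := ((s h : ℤˣ) : ℤ) * α with hβ
  set vac : (Fin (N + 1) → ℤ) → ℂ := Pi.single 0 1 with hvac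
  have hlow : ∀ i, h < i → lowerWeight s h β i 0 = 0 := by
    intro i hi
    simp [lowerWeight, hi.not_gt, hi.ne']
  have hraise : ∀ i, i < h → raiseWeight s h i 0 = 0 := by
    intro i hi
    simp [raiseWeight, hi]
  have hsupp : ∀ (i : Fin (N + 1)) (t : ℤ) (m : Fin (N + 1) → ℤ), vac (m + Pi.single i t) ≠ 0 →
      m i + t = 0 := by
    intro i t m hm
    by_contra hne
    apply hm
    rw [hvac, Pi.single_eq_of_ne]
    intro h0
    have := congrFun h0 i
    rw [Pi.add_apply, Pi.single_eq_same] at this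
    exact hne this
  have f_sq : ∀ k, gradeOp s h k * gradeOp s h k = 1 := by
    intro k
    ext f m
    rw [Module.End.mul_apply, gradeOp_apply, gradeOp_apply, ← mul_assoc, ← Int.cast_mul,
      unit_mul_self, Int.cast_one, one_mul, Module.End.one_apply]
  have f_comm : ∀ k l, gradeOp s h k * gradeOp s h l = gradeOp s h l * gradeOp s h k := by
    intro k l
    ext f m
    simp only [Module.End.mul_apply, gradeOp_apply]
    ring
  have f_ne : vac ≠ 0 := by
    intro h0
    have := congrFun h0 0
    simp [hvac] at this
  have f_fix : ∀ k, gradeOp s h k vac = vac := by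
    intro k
    ext m
    rw [gradeOp_apply]
    by_cases hm : m = 0
    · subst hm; simp
    · simp [hvac, hm]
  have f_num : ∀ i, raiseOp s h i (lowerOp s h β i vac)
      = (raiseWeight s h i (-1) * lowerWeight s h β i 0) • vac := by
    intro i
    ext m
    rw [raiseOp, lowerOp, modeOp_same, Pi.smul_apply, smul_eq_mul, neg_add_cancel, Pi.single_zero,
      add_zero]
    by_cases hm : m = 0
    · subst hm; simp
    · simp [hvac, hm]
  have f_raise : ∀ i, i < h → raiseOp s h i vac = 0 := by
    intro i hi
    ext m
    rw [raiseOp, modeOp_apply]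
    by_cases h0 : vac (m + Pi.single i (-1)) = 0
    · rw [h0, mul_zero]; rfl
    · have := hsupp i (-1) m h0
      have h3 : m i - 1 = 0 := by linarith
      rw [h3, hraise i hi]; simp
  have f_lower : ∀ i, h < i → lowerOp s h β i vac = 0 := by
    intro i hi
    ext m
    rw [lowerOp, modeOp_apply]
    by_cases h0 : vac (m + Pi.single i 1) = 0
    · rw [h0, mul_zero]; rfl
    · have := hsupp i 1 m h0
      rw [this, hlow i hi]; simp
  obtain ⟨V, E, Z, v, θ, h1, h2⟩ := (isFock s h β).exists_oscillator (Z := gradeOp s h) (vac := vac)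
    (ν := fun i => raiseWeight s h i (-1) * lowerWeight s h β i 0) f_sq f_comm
    (fun k i => gradeOp_modeOp s h k i (by decide) _)
    (fun k i => gradeOp_modeOp s h k i (by decide) _)
    f_ne f_fix f_num f_raise f_lower
  refine ⟨V, E, Z, _, v, θ, h1, h2, ?_, ?_⟩
  · have h3 : (((s h : ℤˣ) : ℤ) : ℂ) * ((s h : ℤˣ) : ℤ) = 1 := by
      exact_mod_cast unit_mul_self _
    simp [raiseWeight, lowerWeight, hβ]
    linear_combination α * h3
  · intro i hi
    simp only [hlow i hi, mul_zero]

/-! ### Changing the highest weight by dressing -/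

/-- The sum `∑_{a > i} s_a μ_a`. -/
noncomputable def tailSum (s : Fin (N + 1) → ℤˣ) (μ : Fin (N + 1) → PowerSeries ℂ)
    (i : Fin (N + 1)) : PowerSeries ℂ :=
  ∑ a ∈ Finset.Ioi i, PowerSeries.C (((s a : ℤˣ) : ℤ) : ℂ) * μ a

/-- The series `u⁻¹ μ̃_i(u)`. -/
noncomputable def nu (s : Fin (N + 1) → ℤˣ) (μ : Fin (N + 1) → PowerSeries ℂ) (i : Fin (N + 1)) :
    PowerSeries ℂ :=
  (2 - PowerSeries.C (rhoSucc s i : ℂ) * PowerSeries.X) * μ i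
    + PowerSeries.X * tailSum s μ i

/-- The parameter `1 / (u - ρ_{h+1} / 2)`, on which the involution `u ↦ ρ_{h+1} - u` acts by the
sign. -/
noncomputable def centered (s : Fin (N + 1) → ℤˣ) (h : Fin (N + 1)) : PowerSeries ℂ :=
  invShift ((rhoSucc s h : ℂ) / 2)

variable {s ε : Fin (N + 1) → ℤˣ}

theorem intCast_end_apply {M : Type*} [AddCommGroup M] [Module ℂ M] (n : ℤ) (v : M) :
    (n : Module.End ℂ M) v = (n : ℂ) • v := by
  rw [← Module.algebraMap_end_apply (R := ℂ) (S := ℂ), map_intCast]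

/-- The constant terms of a highest weight are forced by the relation `b_{ii}^{(0)} = ε_i`. -/
theorem constantCoeff_of_nontrivial {μ : Fin (N + 1) → PowerSeries ℂ}
    (hμ : Nontrivial (VermaModule s ε μ)) (i : Fin (N + 1)) :
    PowerSeries.constantCoeff (μ i) = (((ε i : ℤˣ) : ℤ) : ℂ) := by
  have h1 := isHighest_vermaMatrix hμ
  have h2 := h1.diag i 0
  rw [PowerSeries.coeff_zero_eq_constantCoeff_apply, PowerSeries.coeff_zero_eq_constantCoeff_apply,
    (isRep_vermaMatrix s ε μ).const, if_pos rfl] at h2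
  have h3 : (((ε i : ℤˣ) : ℤ) : Module.End ℂ (VermaModule s ε μ)) (Submodule.Quotient.mk 1)
      = (((ε i : ℤˣ) : ℤ) : ℂ) • Submodule.Quotient.mk (1 : Alg s ε) := intCast_end_apply _ _
  rw [h3] at h2
  exact (smul_left_injective ℂ h1.ne_zero h2).symm

theorem dressWeight_of_gt {p q : ℂ} {wt : Fin (N + 1) → ℂ} {h : Fin (N + 1)}
    (h0 : ∀ i, h < i → wt i = 0) (μ : Fin (N + 1) → PowerSeries ℂ) {i : Fin (N + 1)} (hi : h < i) :
    dressWeight s p q wt μ i = μ i := by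
  have h1 : ∀ a, pairWeight s wt i a = 0 := by
    intro a
    rw [pairWeight, h0 i hi]
    split_ifs with h2 h3
    · simp
    · rw [h0 a (hi.trans h3)]; simp
    · rfl
  simp [dressWeight, h1, h0 i hi]

theorem dressWeight_self {p q α : ℂ} {wt : Fin (N + 1) → ℂ} {h : Fin (N + 1)} (hα : wt h = α)
    (h0 : ∀ i, h < i → wt i = 0) (μ : Fin (N + 1) → PowerSeries ℂ) :
    dressWeight s p q wt μ h
      = (1 + PowerSeries.C α * invShift p) * (1 + PowerSeries.C α * invShift q) * μ h
        + PowerSeries.C α * invShift p * invShift q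
          * tailSum s μ h := by
  have h4 : ∑ a, PowerSeries.C (pairWeight s wt h a) * μ a = PowerSeries.C (α * α) * μ h
      + PowerSeries.C α * tailSum s μ h := by
    have hsub : ∀ a ∉ insert h (Finset.Ioi h), PowerSeries.C (pairWeight s wt h a) * μ a = 0 := by
      intro a ha
      simp only [Finset.mem_insert, Finset.mem_Ioi, not_or] at ha
      rw [pairWeight, if_neg ha.1, if_neg ha.2, map_zero, zero_mul]
    rw [← Finset.sum_subset (Finset.subset_univ (insert h (Finset.Ioi h))) (fun a _ => hsub a),
      Finset.sum_insert (by simp), pairWeight, if_pos rfl, hα, tailSum, Finset.mul_sum]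
    congr 1
    refine Finset.sum_congr rfl fun a ha => ?_
    rw [Finset.mem_Ioi] at ha
    rw [pairWeight, if_neg ha.ne', if_pos ha, h0 a ha, hα, sub_zero, map_mul]
    ring
  rw [dressWeight, h4, hα, map_mul]
  ring

/-- Dressing multiplies `ν_h` by `(1 + β ζ) / (1 - β ζ)`, where `ζ` is the centered parameter, and
keeps all `μ_i` with `i > h`. -/
theorem exists_dressed {μ : Fin (N + 1) → PowerSeries ℂ} (hμ : Nontrivial (VermaModule s ε μ))
    (h : Fin (N + 1)) (β : ℂ) :
    ∃ μ' : Fin (N + 1) → PowerSeries ℂ, Nontrivial (VermaModule s ε μ') ∧ (∀ i, h < i → μ' i = μ i) ∧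
      nu s μ' h * (1 - PowerSeries.C β * centered s h)
        = nu s μ h * (1 + PowerSeries.C β * centered s h) := by
  by_cases hβ : β = 0
  · exact ⟨μ, hμ, fun _ _ => rfl, by simp [hβ]⟩
  obtain ⟨V, E, Z, wt, vac, θ, h1, h2, h3, h4⟩ := exists_vacuum s h β
  -- the sum `p + q` has to be `θ = β + ρ_{h+1}`, and this choice of `q` is invariant under the
  -- substitution `u ↦ ρ_{h+1} - u`
  set q : ℂ := (rhoSucc s h : ℂ) / 2 with hq
  set p : ℂ := β + q with hp
  have hθ : p + q = θ := by
    rw [h2.theta_eq h1 (h3 ▸ hβ) h4, h3, hp, hq]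
    ring
  refine ⟨dressWeight s p q wt μ, ((isHighest_vermaMatrix hμ).tensorDress p q h2 h1).nontrivial
    (isRep_tensorDress (isRep_vermaMatrix s ε μ) h1 hθ), fun i hi => dressWeight_of_gt h4 μ hi, ?_⟩
  have hsum : tailSum s (dressWeight s p q wt μ) h = tailSum s μ h :=
    Finset.sum_congr rfl fun a ha => by rw [dressWeight_of_gt h4 μ (Finset.mem_Ioi.1 ha)]
  have hc : PowerSeries.C (rhoSucc s h : ℂ) = 2 * PowerSeries.C q := by
    rw [hq, ← map_ofNat PowerSeries.C 2, ← map_mul]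
    congr 1
    ring
  rw [centered, ← hq, nu, nu, hsum, dressWeight_self h3 h4, hc]
  have ha := invShift_mul p
  have hb := invShift_mul q
  rw [hp, map_add, ← hp] at ha
  have hne : (1 - PowerSeries.C q * PowerSeries.X : PowerSeries ℂ) ≠ 0 := by
    intro h
    have := congrArg PowerSeries.constantCoeff h
    simp at this
  apply mul_left_cancel₀ hne
  generalize invShift p = a at *
  generalize invShift q = b at *
  generalize (PowerSeries.X : PowerSeries ℂ) = x at *
  generalize PowerSeries.C q = c at *
  generalize PowerSeries.C β = t at *
  generalize μ h = f at *
  generalize tailSum s μ h = m at *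
  linear_combination (2 * (1 - c * x) * (t * (1 + t * b) * f + t * b * m)) * ha
    + (-t * ((2 - 2 * c * x) * ((1 + t * a) * (1 + t * b) * f + t * a * b * m) + x * m)
      + 2 * ((1 - c * x) * t * f + t * x * m) - t * ((2 - 2 * c * x) * f + x * m)) * hb

theorem exists_dressed_multiset {μ : Fin (N + 1) → PowerSeries ℂ}
    (hμ : Nontrivial (VermaModule s ε μ)) (h : Fin (N + 1)) (L : Multiset ℂ) :
    ∃ μ' : Fin (N + 1) → PowerSeries ℂ, Nontrivial (VermaModule s ε μ') ∧ (∀ i, h < i → μ' i = μ i) ∧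
      nu s μ' h * (L.map fun β => 1 - PowerSeries.C β * centered s h).prod
        = nu s μ h * (L.map fun β => 1 + PowerSeries.C β * centered s h).prod := by
  induction L using Multiset.induction_on with
  | empty => exact ⟨μ, hμ, fun _ _ => rfl, by simp⟩
  | cons β L ih =>
    obtain ⟨μ₁, h1, h2, h3⟩ := ih
    obtain ⟨μ₂, h4, h5, h6⟩ := exists_dressed h1 h β
    refine ⟨μ₂, h4, fun i hi => (h5 i hi).trans (h2 i hi), ?_⟩
    rw [Multiset.map_cons, Multiset.map_cons, Multiset.prod_cons, Multiset.prod_cons, ← mul_assoc,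
      h6, mul_right_comm, h3]
    ring

/-- The highest weights of the one-dimensional representations. -/
theorem nontrivial_of_scalar {g : PowerSeries ℂ} (hg0 : PowerSeries.constantCoeff g = 1)
    (hg : g * negate g = 1) :
    Nontrivial (VermaModule s ε fun i => PowerSeries.C (((ε i : ℤˣ) : ℤ) : ℂ) * g) := by
  have h1 := isRep_diagonal (D := Module.End ℂ ℂ) s ε hg0 hg
  refine IsHighest.nontrivial (v := (1 : ℂ)) ⟨one_ne_zero, ?_, ?_⟩ h1
  · intro i j hij
    rw [Matrix.smul_apply, Matrix.diagonal_apply_ne _ hij.ne, smul_zero]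
    exact actsBy_zero_iff.2 fun r => by simp
  · intro i r
    have h2 : ((ε i : ℤ) : PowerSeries (Module.End ℂ ℂ))
        = PowerSeries.C (algebraMap ℂ (Module.End ℂ ℂ) ((ε i : ℤ) : ℂ)) := by simp
    rw [Matrix.smul_apply, Matrix.diagonal_apply_eq, smul_eq_mul, h2, PowerSeries.coeff_mul_C,
      PowerSeries.coeff_C_mul, scalar, PowerSeries.coeff_map, ← map_mul,
      Module.algebraMap_end_apply, mul_comm]

/-! ### Expectation values in the highest weight vector -/

section Expectation

variable {M : Type*} [AddCommGroup M] [Module ℂ M]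

/-- The underlying function of `expectation`. -/
noncomputable def expectationFun (φ : Module.Dual ℂ M) (v : M)
    (F : MvPowerSeries (Fin 2) (Module.End ℂ M)) : MvPowerSeries (Fin 2) ℂ :=
  fun m => φ (MvPowerSeries.coeff m F v)

theorem coeff_expectationFun (φ : Module.Dual ℂ M) (v : M)
    (F : MvPowerSeries (Fin 2) (Module.End ℂ M)) (m : Fin 2 →₀ ℕ) :
    MvPowerSeries.coeff m (expectationFun φ v F) = φ (MvPowerSeries.coeff m F v) := rfl

/-- The coefficientwise expectation value `φ (F v)` of an operator series `F`. -/
noncomputable def expectation (φ : Module.Dual ℂ M) (v : M) :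
    MvPowerSeries (Fin 2) (Module.End ℂ M) →ₗ[MvPowerSeries (Fin 2) ℂ] MvPowerSeries (Fin 2) ℂ where
  toFun := expectationFun φ v
  map_add' F G := by
    ext m
    simp only [map_add, coeff_expectationFun, LinearMap.add_apply]
  map_smul' r F := by
    classical
    ext m
    rw [RingHom.id_apply, smul_eq_mul, MvPowerSeries.coeff_mul, coeff_expectationFun,
      Algebra.smul_def, seriesAlgebra_algebraMap, MvPowerSeries.coeff_mul, LinearMap.sum_apply,
      map_sum]
    refine Finset.sum_congr rfl fun p _ => ?_
    rw [MvPowerSeries.coeff_map, Module.End.mul_apply, Module.algebraMap_end_apply, map_smul,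
      smul_eq_mul, coeff_expectationFun]

theorem coeff_expectation (φ : Module.Dual ℂ M) (v : M)
    (F : MvPowerSeries (Fin 2) (Module.End ℂ M)) (m : Fin 2 →₀ ℕ) :
    MvPowerSeries.coeff m (expectation φ v F) = φ (MvPowerSeries.coeff m F v) := rfl

theorem expectation_mul_embed (φ : Module.Dual ℂ M) {v : M} {F : PowerSeries (Module.End ℂ M)}
    {f : PowerSeries ℂ} (hF : ActsBy v F f) (G : MvPowerSeries (Fin 2) (Module.End ℂ M)) (k : Fin 2) :
    expectation φ v (G * embed k F) = expectation φ v G * embed k f := by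
  classical
  ext m
  rw [coeff_expectation, MvPowerSeries.coeff_mul, MvPowerSeries.coeff_mul, LinearMap.sum_apply,
    map_sum]
  refine Finset.sum_congr rfl fun p _ => ?_
  rw [coeff_expectation, Module.End.mul_apply, coeff_embed, coeff_embed]
  split_ifs
  · rw [hF, map_smul, map_smul, smul_eq_mul, mul_comm]
  · simp

theorem expectation_one {φ : Module.Dual ℂ M} {v : M} (h : φ v = 1) : expectation φ v 1 = 1 := by
  classical
  ext m
  rw [coeff_expectation, MvPowerSeries.coeff_one, MvPowerSeries.coeff_one]
  split_ifs <;> simp [h]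

theorem expectation_embed_mul_embed {φ : Module.Dual ℂ M} {v : M} (h : φ v = 1)
    {F G : PowerSeries (Module.End ℂ M)} {f g : PowerSeries ℂ} (hF : ActsBy v F f)
    (hG : ActsBy v G g) (k l : Fin 2) :
    expectation φ v (embed k F * embed l G) = embed k f * embed l g := by
  rw [expectation_mul_embed φ hG, ← one_mul (embed k F), expectation_mul_embed φ hF,
    expectation_one h, one_mul]

variable {s ε : Fin (N + 1) → ℤˣ}
  {b : Matrix (Fin (N + 1)) (Fin (N + 1)) (PowerSeries (Module.End ℂ M))}
  {μ : Fin (N + 1) → PowerSeries ℂ} {v : M}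

/-- The expectation value of `∑ a, b_{ia}(u) b_{ai}(v)`. -/
noncomputable def pairing (b : Matrix (Fin (N + 1)) (Fin (N + 1)) (PowerSeries (Module.End ℂ M)))
    (φ : Module.Dual ℂ M) (v : M) (i : Fin (N + 1)) : MvPowerSeries (Fin 2) ℂ :=
  expectation φ v (∑ a, embed 0 (b i a) * embed 1 (b a i))

/-- The reflection relation under the expectation value. -/
theorem IsRep.expectation_refl (hb : IsRep s ε b) (φ : Module.Dual ℂ M) (v : M)
    (i j k l : Fin (N + 1)) :
    let x : MvPowerSeries (Fin 2) ℂ := MvPowerSeries.X 0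
    let y : MvPowerSeries (Fin 2) ℂ := MvPowerSeries.X 1
    let U := fun i j => embed 0 (b i j)
    let V := fun i j => embed 1 (b i j)
    let τ : ℤ := (-1) ^ (parity s i * parity s j + parity s i * parity s k + parity s j * parity s k)
    let τ' : ℤ := (-1) ^ ((parity s i + parity s j) * (parity s k + parity s l))
    let Φ := expectation φ v
    (y ^ 2 - x ^ 2) * (Φ (U i j * V k l) - τ' * Φ (V k l * U i j))
      = x * y * (x + y) * (τ * (Φ (U k j * V i l) - Φ (V k j * U i l)))
        + x * y * (y - x) * (τ * ((if k = j then Φ (∑ a, U i a * V a l) else 0)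
            - (if i = l then Φ (∑ a, V k a * U a j) else 0)))
        - x ^ 2 * y ^ 2 * (if i = j then Φ (∑ a, U k a * V a l) - Φ (∑ a, V k a * U a l) else 0) := by
  intro x y U V τ τ' Φ
  have h1 := (reflectionEq_iff s _ _).1 hb.refl i j k l
  unfold ReflectionRel at h1
  simp only [X_eq_algebraMap (D := Module.End ℂ M), ← map_pow, ← map_mul, ← map_add, ← map_sub,
    ← Algebra.smul_def, neg_one_pow_mul] at h1
  have h2 := congrArg Φ h1
  have hite : ∀ (p : Prop) [Decidable p] (z : MvPowerSeries (Fin 2) (Module.End ℂ M)),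
      Φ (if p then z else 0) = if p then Φ z else 0 := fun p _ z => by split_ifs <;> simp
  simp only [map_sub, map_add, map_smul, map_zsmul, hite] at h2
  simp only [smul_eq_mul, zsmul_eq_mul, RingHom.mapMatrix_apply, Matrix.map_apply] at h2
  exact h2

theorem coeff_single_X (k l : Fin 2) :
    MvPowerSeries.coeff (Finsupp.single k 1) (MvPowerSeries.X l : MvPowerSeries (Fin 2) ℂ)
      = if k = l then 1 else 0 := by
  classical
  rw [MvPowerSeries.coeff_X]
  refine if_congr ?_ rfl rfl
  exact Finsupp.single_left_inj one_ne_zero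

theorem X_ne_zero (k : Fin 2) : (MvPowerSeries.X k : MvPowerSeries (Fin 2) ℂ) ≠ 0 := by
  intro h
  have h1 := congrArg (MvPowerSeries.coeff (Finsupp.single k 1)) h
  rw [coeff_single_X, if_pos rfl, map_zero] at h1
  exact one_ne_zero h1

/-- The expectation value of `∑ a, b_{ia}(u) b_{ai}(v)` is symmetric in `u` and `v`, since
`b_{ii}(u)` and `b_{ii}(v)` commute on the highest weight vector. -/
theorem IsHighest.pairing_symm (hv : IsHighest b μ v) (hb : IsRep s ε b) {φ : Module.Dual ℂ M}
    (hφ : φ v = 1) (i : Fin (N + 1)) :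
    expectation φ v (∑ a, embed 1 (b i a) * embed 0 (b a i)) = pairing b φ v i := by
  have h1 := hb.expectation_refl φ v i i i i
  simp only [if_true, expectation_embed_mul_embed hφ (hv.diag i) (hv.diag i)] at h1
  rw [← pairing] at h1
  generalize expectation φ v (∑ a, embed 1 (b i a) * embed 0 (b a i)) = B at *
  generalize pairing b φ v i = A at *
  have h2 : (MvPowerSeries.X 0 * MvPowerSeries.X 1 * ((MvPowerSeries.X 1 - MvPowerSeries.X 0)
      * (((s i : ℤˣ) : ℤ) : MvPowerSeries (Fin 2) ℂ) - MvPowerSeries.X 0 * MvPowerSeries.X 1))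
      * (B - A) = 0 := by
    rw [mul_comm (embed 1 (μ i))] at h1
    have h3 : (-1 : ℤ) ^ (parity s i * parity s i + parity s i * parity s i
        + parity s i * parity s i) = ((s i : ℤˣ) : ℤ) := by
      rw [parity_sign]
      rcases parity_cases s i with hi | hi <;> simp [hi]
    have h4 : (-1 : ℤ) ^ ((parity s i + parity s i) * (parity s i + parity s i)) = 1 := by
      rcases parity_cases s i with hi | hi <;> simp [hi]
    rw [h3, h4, Int.cast_one] at h1
    linear_combination h1
  rcases mul_eq_zero.1 h2 with h3 | h3
  · exfalso
    rcases mul_eq_zero.1 h3 with h4 | h4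
    · rcases mul_eq_zero.1 h4 with h4 | h4
      · exact X_ne_zero 0 h4
      · exact X_ne_zero 1 h4
    · have h5 := congrArg (MvPowerSeries.coeff (Finsupp.single 0 1)) h4
      rw [map_sub, mul_comm (_ - _), ← zsmul_eq_mul, map_zsmul, map_sub, coeff_single_X,
        coeff_single_X] at h5
      have h6 : MvPowerSeries.coeff (Finsupp.single (0 : Fin 2) 1)
          (MvPowerSeries.X 0 * MvPowerSeries.X 1 : MvPowerSeries (Fin 2) ℂ) = 0 := by
        classical
        rw [MvPowerSeries.X, MvPowerSeries.X, MvPowerSeries.monomial_mul_monomial,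
          MvPowerSeries.coeff_monomial_ne]
        intro h
        have := DFunLike.congr_fun h 1
        simp at this
      rw [h6] at h5
      rcases Int.units_eq_one_or (s i) with h | h <;> simp [h] at h5
  · exact sub_eq_zero.1 h3

theorem IsHighest.expectation_mul_upper (hv : IsHighest b μ v) (φ : Module.Dual ℂ M)
    {i j : Fin (N + 1)} (hij : i < j) (G : MvPowerSeries (Fin 2) (Module.End ℂ M)) (k : Fin 2) :
    expectation φ v (G * embed k (b i j)) = 0 := by
  rw [expectation_mul_embed φ (hv.upper i j hij), map_zero, mul_zero]

/-- Moving `b_{ia}(u)` past `b_{ai}(v)` in the pairing expresses it by the highest weight and by the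
pairings with larger index. -/
theorem IsHighest.pairing_eq (hv : IsHighest b μ v) (hb : IsRep s ε b) {φ : Module.Dual ℂ M}
    (hφ : φ v = 1) (i : Fin (N + 1)) :
    let x : MvPowerSeries (Fin 2) ℂ := MvPowerSeries.X 0
    let y : MvPowerSeries (Fin 2) ℂ := MvPowerSeries.X 1
    (y ^ 2 - x ^ 2) * (pairing b φ v i - embed 0 (μ i) * embed 1 (μ i))
      = x * y * (x + y) * (embed 0 (tailSum s μ i) * embed 1 (μ i)
          - embed 1 (tailSum s μ i) * embed 0 (μ i))
        + x * y * (y - x) * ((rhoSucc s i : ℤ) * pairing b φ v i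
          - ∑ a ∈ Finset.Ioi i, ((s a : ℤˣ) : ℤ) * pairing b φ v a) := by
  intro x y
  have h1 : ∀ a ∈ Finset.Ioi i,
      (y ^ 2 - x ^ 2) * expectation φ v (embed 0 (b i a) * embed 1 (b a i))
      = ((s a : ℤˣ) : ℤ) * (x * y * (x + y) * (embed 0 (μ a) * embed 1 (μ i)
          - embed 1 (μ a) * embed 0 (μ i)))
        + ((s a : ℤˣ) : ℤ) * (x * y * (y - x) * (pairing b φ v i - pairing b φ v a)) := by
    intro a ha
    rw [Finset.mem_Ioi] at ha
    have h2 := hb.expectation_refl φ v i a a i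
    simp only [if_true, if_neg ha.ne, expectation_embed_mul_embed hφ (hv.diag a) (hv.diag i),
      hv.expectation_mul_upper φ ha, hv.pairing_symm hb hφ a] at h2
    rw [← pairing] at h2
    have h3 : (-1 : ℤ) ^ (parity s i * parity s a + parity s i * parity s a
        + parity s a * parity s a) = ((s a : ℤˣ) : ℤ) := by
      rw [parity_sign]
      rcases parity_cases s i with hi | hi <;> rcases parity_cases s a with hj | hj <;>
        simp [hi, hj]
    rw [h3] at h2
    linear_combination h2
  have h4 : pairing b φ v i = embed 0 (μ i) * embed 1 (μ i)
      + ∑ a ∈ Finset.Ioi i, expectation φ v (embed 0 (b i a) * embed 1 (b a i)) := by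
    have hsub : ∀ a ∉ insert i (Finset.Ioi i),
        expectation φ v (embed 0 (b i a) * embed 1 (b a i)) = 0 := by
      intro a ha
      simp only [Finset.mem_insert, Finset.mem_Ioi, not_or, not_lt] at ha
      exact hv.expectation_mul_upper φ (lt_of_le_of_ne ha.2 ha.1) _ _
    rw [pairing, map_sum, ← Finset.sum_subset (Finset.subset_univ (insert i (Finset.Ioi i)))
      (fun a _ => hsub a), Finset.sum_insert (by simp),
      expectation_embed_mul_embed hφ (hv.diag i) (hv.diag i)]
  have h5 : (y ^ 2 - x ^ 2) * (pairing b φ v i - embed 0 (μ i) * embed 1 (μ i))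
      = ∑ a ∈ Finset.Ioi i, (y ^ 2 - x ^ 2) * expectation φ v (embed 0 (b i a) * embed 1 (b a i)) := by
    rw [← Finset.mul_sum]
    nth_rewrite 1 [h4]
    rw [add_sub_cancel_left]
  have h6 : ∀ k : Fin 2, embed k (tailSum s μ i)
      = ∑ a ∈ Finset.Ioi i, ((s a : ℤˣ) : ℤ) * embed k (μ a) := by
    intro k
    rw [tailSum, map_sum]
    refine Finset.sum_congr rfl fun a _ => ?_
    rw [map_mul, map_intCast, map_intCast]
  rw [h5, Finset.sum_congr rfl h1, Finset.sum_add_distrib, h6, h6, rhoSucc, Int.cast_sum,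
    Finset.sum_mul, Finset.sum_mul, Finset.sum_mul, ← Finset.sum_sub_distrib,
    ← Finset.sum_sub_distrib, Finset.mul_sum, Finset.mul_sum]
  congr 1 <;> refine Finset.sum_congr rfl fun a _ => ?_ <;> ring

end Expectation

/-! ### The substitution `v = ρ - u` -/

theorem affineInv_mul {σ : ℂ} (hσ : σ ≠ 0) (c : ℂ) :
    affineInv σ c * (PowerSeries.C σ + PowerSeries.C c * PowerSeries.X) = PowerSeries.X := by
  rw [affineInv, mul_assoc, PowerSeries.inv_mul_cancel, mul_one]
  simpa using hσ

theorem hasSubst_affineInv (σ c : ℂ) : PowerSeries.HasSubst (affineInv σ c) :=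
  PowerSeries.HasSubst.of_constantCoeff_zero' (by simp [affineInv])

/-- The substitution `u ↦ c - u` in series in `u⁻¹`. -/
noncomputable def reflect (c : ℂ) : PowerSeries ℂ →+* PowerSeries ℂ :=
  (PowerSeries.substAlgHom (hasSubst_affineInv (-1) c)).toRingHom

theorem reflect_apply (c : ℂ) (f : PowerSeries ℂ) : reflect c f = evalAffine (-1) c f := by
  rw [evalAffine, ← PowerSeries.coe_substAlgHom (hasSubst_affineInv (-1) c)]
  rfl

theorem reflect_X (c : ℂ) : reflect c PowerSeries.X = affineInv (-1) c := by
  rw [reflect_apply, evalAffine, PowerSeries.subst_X (hasSubst_affineInv _ _)]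

theorem reflect_C (c z : ℂ) : reflect c (PowerSeries.C z) = PowerSeries.C z := by
  rw [reflect_apply, evalAffine, PowerSeries.subst_C]
  rfl

/-- `1 / u` and `1 / (c - u)` have sum `c` times their product. -/
theorem X_add_reflect_X (c : ℂ) :
    PowerSeries.X + reflect c PowerSeries.X
      = PowerSeries.C c * (PowerSeries.X * reflect c PowerSeries.X) := by
  have h := affineInv_mul (neg_ne_zero.2 one_ne_zero) c
  rw [← reflect_X] at h
  rw [map_neg, map_one] at h
  linear_combination -h

theorem reflect_X_zero : reflect 0 PowerSeries.X = -PowerSeries.X := by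
  have h := X_add_reflect_X 0
  rw [map_zero, zero_mul] at h
  linear_combination h

theorem reflect_zero (f : PowerSeries ℂ) : reflect 0 f = negate f := by
  have h : affineInv (-1) 0 = (-1 : ℂ) • PowerSeries.X := by
    rw [← reflect_X, reflect_X_zero]
    simp
  rw [reflect_apply, evalAffine, h, ← PowerSeries.rescale_eq_subst]
  ext n
  rw [PowerSeries.coeff_rescale, coeff_negate]

theorem hasSubst_specialize (c : ℂ) :
    MvPowerSeries.HasSubst (![PowerSeries.X, affineInv (-1) c] : Fin 2 → PowerSeries ℂ) := by
  refine MvPowerSeries.hasSubst_of_constantCoeff_zero fun k => ?_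
  fin_cases k
  · exact PowerSeries.constantCoeff_X
  · change PowerSeries.constantCoeff (affineInv (-1) c) = 0
    simp [affineInv]

/-- The substitution `v = c - u` in series in `u⁻¹` and `v⁻¹`. -/
noncomputable def specialize (c : ℂ) : MvPowerSeries (Fin 2) ℂ →+* PowerSeries ℂ :=
  (MvPowerSeries.substAlgHom (hasSubst_specialize c)).toRingHom

theorem specialize_apply (c : ℂ) (F : MvPowerSeries (Fin 2) ℂ) :
    specialize c F = MvPowerSeries.subst ![PowerSeries.X, affineInv (-1) c] F := by
  rw [← MvPowerSeries.coe_substAlgHom (hasSubst_specialize c)]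
  rfl

theorem embed_eq_subst (k : Fin 2) (f : PowerSeries ℂ) :
    embed k f = PowerSeries.subst (MvPowerSeries.X k : MvPowerSeries (Fin 2) ℂ) f := by
  ext m
  rw [PowerSeries.coeff_subst_single, coeff_embed]

theorem specialize_embed (c : ℂ) (k : Fin 2) (f : PowerSeries ℂ) :
    specialize c (embed k f)
      = PowerSeries.subst ((![PowerSeries.X, affineInv (-1) c] : Fin 2 → PowerSeries ℂ) k) f := by
  rw [specialize_apply, embed_eq_subst, PowerSeries.subst,
    MvPowerSeries.subst_comp_subst_apply (PowerSeries.HasSubst.const (PowerSeries.HasSubst.X k))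
      (hasSubst_specialize c), PowerSeries.subst]
  congr 1
  funext _
  rw [MvPowerSeries.subst_X (hasSubst_specialize c)]

theorem specialize_embed_zero (c : ℂ) (f : PowerSeries ℂ) : specialize c (embed 0 f) = f := by
  rw [specialize_embed]
  exact PowerSeries.X_subst f

theorem specialize_embed_one (c : ℂ) (f : PowerSeries ℂ) :
    specialize c (embed 1 f) = reflect c f := by
  rw [specialize_embed, reflect_apply]
  rfl

theorem specialize_X_zero (c : ℂ) : specialize c (MvPowerSeries.X 0) = PowerSeries.X := by
  rw [← embed_X, specialize_embed_zero]

theorem specialize_X_one (c : ℂ) :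
    specialize c (MvPowerSeries.X 1) = reflect c PowerSeries.X := by
  rw [← embed_X, specialize_embed_one]

theorem coeff_specialize_zero (F : MvPowerSeries (Fin 2) ℂ) (n : ℕ) :
    PowerSeries.coeff n (specialize 0 F) = ∑ p ∈ Finset.HasAntidiagonal.antidiagonal n,
      (-1) ^ p.2 * MvPowerSeries.coeff (Finsupp.single 0 p.1 + Finsupp.single 1 p.2) F := by
  classical
  set e : ℕ × ℕ → (Fin 2 →₀ ℕ) := fun p => Finsupp.single 0 p.1 + Finsupp.single 1 p.2 with he
  have he0 : ∀ p, e p 0 = p.1 := fun p => by simp [he]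
  have he1 : ∀ p, e p 1 = p.2 := fun p => by simp [he]
  have hinj : Function.Injective e := fun p q h => by
    apply Prod.ext
    · rw [← he0, ← he0, h]
    · rw [← he1, ← he1, h]
  have hX : affineInv (-1) 0 = -PowerSeries.X := by rw [← reflect_X, reflect_X_zero]
  have hterm : ∀ d : Fin 2 →₀ ℕ, MvPowerSeries.coeff (Finsupp.single () n)
      (d.prod fun k m => (![PowerSeries.X, affineInv (-1) 0] : Fin 2 → PowerSeries ℂ) k ^ m)
      = if n = d 0 + d 1 then (-1) ^ d 1 else 0 := by
    intro d
    rw [Finsupp.prod_fintype _ _ (fun _ => pow_zero _), Fin.prod_univ_two]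
    change PowerSeries.coeff n (PowerSeries.X ^ d 0 * (affineInv (-1) 0) ^ d 1) = _
    rw [hX, neg_pow, mul_left_comm, ← pow_add, ← map_one PowerSeries.C, ← map_neg, ← map_pow,
      PowerSeries.coeff_C_mul, PowerSeries.coeff_X_pow]
    split_ifs <;> simp
  rw [specialize_apply]
  change MvPowerSeries.coeff (Finsupp.single () n) _ = _
  rw [MvPowerSeries.coeff_subst (hasSubst_specialize 0)]
  simp only [hterm]
  rw [finsum_eq_finsetSum_of_support_subset (s := (Finset.HasAntidiagonal.antidiagonal n).image e),
    Finset.sum_image (fun _ _ _ _ h => hinj h)]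
  · refine Finset.sum_congr rfl fun p hp => ?_
    rw [Finset.HasAntidiagonal.mem_antidiagonal] at hp
    rw [he0, he1, if_pos hp.symm, smul_eq_mul, mul_comm]
  · intro d hd
    rw [Function.mem_support] at hd
    have h1 : n = d 0 + d 1 := by
      by_contra hne
      exact hd (by rw [if_neg hne, smul_zero])
    rw [Finset.coe_image]
    refine ⟨(d 0, d 1), ?_, ?_⟩
    · simp [h1]
    · ext k
      fin_cases k
      · exact he0 _
      · exact he1 _

theorem coeff_embed_mul_embed {D : Type*} [Ring D] (f g : PowerSeries D) (r t : ℕ) :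
    MvPowerSeries.coeff (Finsupp.single 0 r + Finsupp.single 1 t) (embed 0 f * embed 1 g)
      = PowerSeries.coeff r f * PowerSeries.coeff t g := by
  classical
  rw [MvPowerSeries.coeff_mul, Finset.sum_eq_single (Finsupp.single 0 r, Finsupp.single 1 t)]
  · rw [coeff_embed, coeff_embed]
    simp
  · rintro ⟨p, q⟩ hpq hne
    rw [Finset.HasAntidiagonal.mem_antidiagonal] at hpq
    rw [coeff_embed, coeff_embed]
    by_cases h1 : p = Finsupp.single 0 (p 0)
    · by_cases h2 : q = Finsupp.single 1 (q 1)
      · exfalso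
        apply hne
        have e0 := DFunLike.congr_fun hpq 0
        have e1 := DFunLike.congr_fun hpq 1
        rw [h1, h2] at e0 e1
        simp at e0 e1
        rw [h1, h2, e0, e1]
      · simp [h2]
    · simp [h1]
  · intro h
    rw [Finset.HasAntidiagonal.mem_antidiagonal] at h
    exact absurd rfl h

/-! ### Necessity of the conditions -/

section Necessity

variable {M : Type*} [AddCommGroup M] [Module ℂ M] {s ε : Fin (N + 1) → ℤˣ}
  {b : Matrix (Fin (N + 1)) (Fin (N + 1)) (PowerSeries (Module.End ℂ M))}
  {μ : Fin (N + 1) → PowerSeries ℂ} {v : M}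

/-- By the unitary condition, the pairing is `1` at `v = -u`. -/
theorem IsRep.specialize_pairing (hb : IsRep s ε b) {φ : Module.Dual ℂ M} (hφ : φ v = 1)
    (i : Fin (N + 1)) : specialize 0 (pairing b φ v i) = 1 := by
  ext n
  have h1 := congrArg (fun F : PowerSeries (Module.End ℂ M) => φ (PowerSeries.coeff n F v))
    (congrFun (congrFun hb.unit i) i)
  simp only [Matrix.mul_apply, RingHom.mapMatrix_apply, Matrix.map_apply, Matrix.one_apply_eq] at h1
  rw [PowerSeries.coeff_one] at h1 ⊢
  have h2 : φ ((if n = 0 then (1 : Module.End ℂ M) else 0) v) = if n = 0 then 1 else 0 := by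
    split_ifs <;> simp [hφ]
  rw [← h2, ← h1, coeff_specialize_zero]
  simp only [pairing, coeff_expectation, map_sum, LinearMap.sum_apply, coeff_embed_mul_embed,
    PowerSeries.coeff_mul, coeff_negate, Finset.mul_sum]
  rw [Finset.sum_comm]
  refine Finset.sum_congr rfl fun a _ => Finset.sum_congr rfl fun p _ => ?_
  rcases neg_one_pow_eq_or ℂ p.2 with h | h <;> rcases Nat.even_or_odd p.2 with h' | h' <;>
    simp [h'.neg_one_pow]

theorem sum_Ioi_castSucc {A : Type*} [AddCommMonoid A] (f : Fin (N + 1) → A) (i : Fin N) :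
    ∑ a ∈ Finset.Ioi i.castSucc, f a = f i.succ + ∑ a ∈ Finset.Ioi i.succ, f a := by
  have h : Finset.Ioi i.castSucc = insert i.succ (Finset.Ioi i.succ) := by
    ext a
    simp only [Finset.mem_insert, Finset.mem_Ioi, Fin.lt_def, Fin.ext_iff, Fin.val_castSucc,
      Fin.val_succ]
    omega
  rw [h, Finset.sum_insert (by simp)]

theorem sum_Ioi_last {A : Type*} [AddCommMonoid A] (f : Fin (N + 1) → A) :
    ∑ a ∈ Finset.Ioi (Fin.last N), f a = 0 :=
  Finset.sum_eq_zero fun a ha => absurd (Finset.mem_Ioi.1 ha) (Fin.le_last a).not_gt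

theorem X_one_sub_X_zero_ne_zero :
    (MvPowerSeries.X 1 - MvPowerSeries.X 0 : MvPowerSeries (Fin 2) ℂ) ≠ 0 := by
  intro h
  have h5 := congrArg (MvPowerSeries.coeff (Finsupp.single 0 1)) h
  rw [map_sub, coeff_single_X, coeff_single_X] at h5
  simp at h5

theorem X_zero_add_X_one_ne_zero :
    (MvPowerSeries.X 0 + MvPowerSeries.X 1 : MvPowerSeries (Fin 2) ℂ) ≠ 0 := by
  intro h
  have h5 := congrArg (MvPowerSeries.coeff (Finsupp.single 0 1)) h
  rw [map_add, coeff_single_X, coeff_single_X] at h5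
  simp at h5

theorem exists_dual_eq_one {v : M} (hv : v ≠ 0) : ∃ φ : Module.Dual ℂ M, φ v = 1 := by
  have h1 : ∃ f : Module.Dual ℂ M, f v ≠ 0 := by
    by_contra hne
    push Not at hne
    exact hv ((Module.forall_dual_apply_eq_zero_iff ℂ v).1 hne)
  obtain ⟨f, hf⟩ := h1
  exact ⟨(f v)⁻¹ • f, by simp [hf]⟩

theorem IsHighest.last (hv : IsHighest b μ v) (hb : IsRep s ε b) :
    μ (Fin.last N) * reflect 0 (μ (Fin.last N)) = 1 := by
  obtain ⟨φ, hφ⟩ := exists_dual_eq_one hv.ne_zero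
  have h1 := hv.pairing_eq hb hφ (Fin.last N)
  simp only [tailSum, rhoSucc, sum_Ioi_last, map_zero, zero_mul, Int.cast_zero, sub_zero, mul_zero,
    add_zero] at h1
  have h2 : pairing b φ v (Fin.last N) = embed 0 (μ (Fin.last N)) * embed 1 (μ (Fin.last N)) := by
    rcases mul_eq_zero.1 h1 with h | h
    · exfalso
      have h' : (MvPowerSeries.X 1 - MvPowerSeries.X 0)
          * (MvPowerSeries.X 0 + MvPowerSeries.X 1 : MvPowerSeries (Fin 2) ℂ) = 0 := by
        rw [← h]; ring
      exact (mul_ne_zero X_one_sub_X_zero_ne_zero X_zero_add_X_one_ne_zero) h'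
    · exact sub_eq_zero.1 h
  have h3 := congrArg (specialize 0) h2
  rw [hb.specialize_pairing hφ, map_mul, specialize_embed_zero, specialize_embed_one] at h3
  exact h3.symm

/-- The condition relating `μ_i` and `μ_{i+1}`, in the form obtained from the pairings. -/
theorem IsHighest.balance (hv : IsHighest b μ v) (hb : IsRep s ε b) (i : Fin N) :
    let c : ℂ := rhoSucc s i.castSucc
    let x : PowerSeries ℂ := PowerSeries.X
    let y : PowerSeries ℂ := reflect c PowerSeries.X
    let G := fun a => (y - x) * (μ a * reflect c (μ a))
      + x * y * (tailSum s μ a * reflect c (μ a) - reflect c (tailSum s μ a) * μ a)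
    G i.castSucc = G i.succ := by
  obtain ⟨φ, hφ⟩ := exists_dual_eq_one hv.ne_zero
  have h1 := hv.pairing_eq hb hφ i.castSucc
  have h2 := hv.pairing_eq hb hφ i.succ
  have hρ : rhoSucc s i.castSucc = ((s i.succ : ℤˣ) : ℤ) + rhoSucc s i.succ :=
    sum_Ioi_castSucc _ i
  simp only [sum_Ioi_castSucc (fun a => (((s a : ℤˣ) : ℤ) : MvPowerSeries (Fin 2) ℂ)
    * pairing b φ v a)] at h1
  rw [show rhoSucc s i.succ = rhoSucc s i.castSucc - ((s i.succ : ℤˣ) : ℤ) by rw [hρ]; ring,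
    Int.cast_sub] at h2
  -- the difference of the two instances of `pairing_eq`, whose sums agree up to one summand
  have h3 : (MvPowerSeries.X 1 - MvPowerSeries.X 0) * ((MvPowerSeries.X 0 + MvPowerSeries.X 1
        - ((rhoSucc s i.castSucc : ℤ) : MvPowerSeries (Fin 2) ℂ) * (MvPowerSeries.X 0 * MvPowerSeries.X 1))
        * (pairing b φ v i.castSucc - pairing b φ v i.succ))
      = (MvPowerSeries.X 0 + MvPowerSeries.X 1) * (((MvPowerSeries.X 1 - MvPowerSeries.X 0)
          * (embed 0 (μ i.castSucc) * embed 1 (μ i.castSucc))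
        + MvPowerSeries.X 0 * MvPowerSeries.X 1
          * (embed 0 (tailSum s μ i.castSucc) * embed 1 (μ i.castSucc)
            - embed 1 (tailSum s μ i.castSucc) * embed 0 (μ i.castSucc)))
        - ((MvPowerSeries.X 1 - MvPowerSeries.X 0)
          * (embed 0 (μ i.succ) * embed 1 (μ i.succ))
        + MvPowerSeries.X 0 * MvPowerSeries.X 1
          * (embed 0 (tailSum s μ i.succ) * embed 1 (μ i.succ)
            - embed 1 (tailSum s μ i.succ) * embed 0 (μ i.succ)))) := by
    linear_combination h1 - h2
  intro c x y G
  have hxy : x + y = PowerSeries.C c * (x * y) := X_add_reflect_X c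
  rw [← sub_eq_zero]
  -- For `c ≠ 0` the factor `x + y - c x y` of the left-hand side of `h3` vanishes at `v = c - u`
  -- while `x + y` does not. For `c = 0` both are the same and cancel, and unitarity makes the rest of the
  -- left-hand side vanish.
  by_cases hc : c = 0
  · have hc' : rhoSucc s i.castSucc = 0 := Int.cast_eq_zero.1 hc
    rw [hc', Int.cast_zero, zero_mul, sub_zero, mul_left_comm] at h3
    have h4 := congrArg (specialize c) (mul_left_cancel₀ X_zero_add_X_one_ne_zero h3)
    simp only [map_mul, map_add, map_sub, specialize_X_zero, specialize_X_one,
      specialize_embed_zero, specialize_embed_one] at h4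
    rw [hc, hb.specialize_pairing hφ, hb.specialize_pairing hφ, sub_self, mul_zero, ← hc] at h4
    exact h4.symm
  · have h4 := congrArg (specialize c) h3
    simp only [map_mul, map_add, map_sub, specialize_X_zero, specialize_X_one,
      specialize_embed_zero, specialize_embed_one, map_intCast] at h4
    have h5 : ((rhoSucc s i.castSucc : ℤ) : PowerSeries ℂ) = PowerSeries.C c :=
      (map_intCast (PowerSeries.C (R := ℂ)) _).symm
    rw [h5, ← X_add_reflect_X c, sub_self, zero_mul, mul_zero] at h4
    rcases mul_eq_zero.1 h4.symm with h6 | h6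
    · exfalso
      rw [X_add_reflect_X] at h6
      have hy : reflect c PowerSeries.X ≠ 0 := by
        intro h
        have h7 := affineInv_mul (neg_ne_zero.2 one_ne_zero) c
        rw [← reflect_X, h, zero_mul] at h7
        exact PowerSeries.X_ne_zero h7.symm
      refine mul_ne_zero ?_ (mul_ne_zero PowerSeries.X_ne_zero hy) h6
      simpa using hc
    · exact h6

/-- The condition relating `μ̃_i` and `μ̃_{i+1}`, multiplied by `u⁻¹ (ρ_{i+1} - u)⁻¹`, as an
identity of power series in `u⁻¹`. -/
def IsBalanced (s : Fin (N + 1) → ℤˣ) (μ : Fin (N + 1) → PowerSeries ℂ) (i : Fin N) : Prop :=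
  nu s μ i.castSucc * reflect (rhoSucc s i.castSucc) (nu s μ i.castSucc)
    = nu s μ i.succ * reflect (rhoSucc s i.castSucc) (nu s μ i.succ)

/-- The series `ν_{i+1}` has the form of `ν_i` with `μ_{i+1}` in place of `μ_i`: the term with
`a = i + 1` of the sum makes up for the difference between `ρ_{i+1}` and `ρ_{i+2}`. -/
theorem nu_succ (s : Fin (N + 1) → ℤˣ) (μ : Fin (N + 1) → PowerSeries ℂ) (i : Fin N) :
    nu s μ i.succ = (2 - PowerSeries.C (rhoSucc s i.castSucc : ℂ) * PowerSeries.X) * μ i.succ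
      + PowerSeries.X * tailSum s μ i.castSucc := by
  have h1 : (rhoSucc s i.castSucc : ℂ) = ((s i.succ : ℤˣ) : ℤ) + rhoSucc s i.succ := by
    exact_mod_cast sum_Ioi_castSucc (fun a => ((s a : ℤˣ) : ℤ)) i
  have h2 : tailSum s μ i.castSucc
      = PowerSeries.C (((s i.succ : ℤˣ) : ℤ) : ℂ) * μ i.succ + tailSum s μ i.succ :=
    sum_Ioi_castSucc _ i
  rw [nu, h1, h2, map_add]
  ring

theorem isBalanced_of_nontrivial (hμ : Nontrivial (VermaModule s ε μ)) (i : Fin N) :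
    IsBalanced s μ i := by
  have h1 := (isHighest_vermaMatrix hμ).balance (isRep_vermaMatrix s ε μ) i
  dsimp only at h1
  have hm : tailSum s μ i.castSucc
      = PowerSeries.C (((s i.succ : ℤˣ) : ℤ) : ℂ) * μ i.succ + tailSum s μ i.succ :=
    sum_Ioi_castSucc _ i
  have hm' := congrArg (reflect (rhoSucc s i.castSucc)) hm
  have hxy := X_add_reflect_X (rhoSucc s i.castSucc : ℂ)
  rw [IsBalanced, nu_succ, nu]
  simp only [map_add, map_mul, map_sub, map_ofNat, reflect_C] at hm' ⊢
  have hx : (PowerSeries.X : PowerSeries ℂ) ≠ 0 := PowerSeries.X_ne_zero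
  have hy : reflect (rhoSucc s i.castSucc : ℂ) PowerSeries.X ≠ 0 := by
    intro h
    rw [h, add_zero, mul_zero, mul_zero] at hxy
    exact hx hxy
  apply mul_left_cancel₀ (mul_ne_zero hx hy)
  have hm2 : tailSum s μ i.succ
      = tailSum s μ i.castSucc - PowerSeries.C (((s i.succ : ℤˣ) : ℤ) : ℂ) * μ i.succ := by
    rw [hm]; ring
  have hm2' : reflect (rhoSucc s i.castSucc) (tailSum s μ i.succ)
      = reflect (rhoSucc s i.castSucc) (tailSum s μ i.castSucc)
        - PowerSeries.C (((s i.succ : ℤˣ) : ℤ) : ℂ) * reflect (rhoSucc s i.castSucc) (μ i.succ) := by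
    rw [hm']; ring
  rw [hm2', hm2] at h1
  generalize reflect (rhoSucc s i.castSucc : ℂ) PowerSeries.X = y at *
  generalize (PowerSeries.X : PowerSeries ℂ) = x at *
  generalize PowerSeries.C (rhoSucc s i.castSucc : ℂ) = c at *
  generalize reflect (rhoSucc s i.castSucc : ℂ) (tailSum s μ i.castSucc) = m' at *
  generalize tailSum s μ i.castSucc = m at *
  generalize reflect (rhoSucc s i.castSucc : ℂ) (μ i.castSucc) = f' at *
  generalize μ i.castSucc = f at *
  generalize reflect (rhoSucc s i.castSucc : ℂ) (μ i.succ) = g' at *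
  generalize μ i.succ = g at *
  -- up to the sign and the factor `y - x`, `G` is the product of the two values of `ν`, apart
  -- from a term that does not depend on `f`
  have key : ∀ f f' : PowerSeries ℂ, x * y * (((2 - c * x) * f + x * m) * ((2 - c * y) * f' + y * m'))
      = -(y - x) * ((y - x) * (f * f') + x * y * (m * f' - m' * f)) + x ^ 2 * y ^ 2 * (m * m') := by
    intro f f'
    have e1 : (2 - c * x) * y = y - x := by linear_combination hxy
    have e2 : (2 - c * y) * x = x - y := by linear_combination hxy
    linear_combination (f * (x * ((2 - c * y) * f' + y * m')) ) * e1
      + ((y - x) * f * f' + x * y * m * f') * e2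
  rw [key, key]
  linear_combination (-(y - x)) * h1

theorem last_of_nontrivial (hμ : Nontrivial (VermaModule s ε μ)) :
    μ (Fin.last N) * reflect 0 (μ (Fin.last N)) = 1 :=
  (isHighest_vermaMatrix hμ).last (isRep_vermaMatrix s ε μ)

end Necessity

/-! ### The conditions as identities of power series -/

section Laurent

variable {s : Fin (N + 1) → ℤˣ} {μ : Fin (N + 1) → PowerSeries ℂ}

theorem affineInv_mul_affine {σ : ℂ} (hσ : σ ≠ 0) (c : ℂ) :
    (affineInv σ c : LaurentSeries ℂ) * (HahnSeries.C σ * uL + HahnSeries.C c) = 1 := by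
  have h1 := congrArg (HahnSeries.ofPowerSeries ℤ ℂ) (affineInv_mul hσ c)
  have h2 : HahnSeries.ofPowerSeries ℤ ℂ PowerSeries.X * uL = 1 := by
    rw [HahnSeries.ofPowerSeries_X, uL, HahnSeries.single_mul_single]
    simp
  rw [map_mul, map_add, map_mul, HahnSeries.ofPowerSeries_C, HahnSeries.ofPowerSeries_C] at h1
  linear_combination uL * h1
    + (1 - HahnSeries.ofPowerSeries ℤ ℂ (affineInv σ c) * HahnSeries.C c) * h2

/-- Multiplying `μ̃_i(w)` by `w⁻¹`, where `w = σ u + c`, gives the value of `ν_i` at `w`. -/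
theorem affineInv_mul_tildeMu {σ : ℂ} (hσ : σ ≠ 0) (c : ℂ) (i : Fin (N + 1)) :
    (affineInv σ c : LaurentSeries ℂ) * tildeMu s μ i σ c
      = (PowerSeries.subst (affineInv σ c) (nu s μ i) : PowerSeries ℂ) := by
  set ψ : PowerSeries ℂ →ₐ[ℂ] PowerSeries ℂ := PowerSeries.substAlgHom (hasSubst_affineInv σ c)
  have hs : ∀ f : PowerSeries ℂ, PowerSeries.subst (affineInv σ c) f = ψ f := fun f => by
    rw [← PowerSeries.coe_substAlgHom (hasSubst_affineInv σ c)]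
  have hC : ∀ z : ℂ, ψ (PowerSeries.C z) = PowerSeries.C z := fun z => by
    rw [← hs, PowerSeries.subst_C]
    rfl
  have hX : ψ PowerSeries.X = affineInv σ c := by
    rw [← hs, PowerSeries.subst_X (hasSubst_affineInv σ c)]
  have h0 := affineInv_mul_affine hσ c
  unfold tildeMu evalAffine nu tailSum
  simp only [hs, map_add, map_mul, map_sub, map_sum, map_ofNat, hC, hX, HahnSeries.ofPowerSeries_C]
  linear_combination (2 * HahnSeries.ofPowerSeries ℤ ℂ (ψ (μ i))) * h0

theorem affineInv_one_zero : affineInv 1 0 = PowerSeries.X := by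
  simpa using affineInv_mul one_ne_zero 0

theorem tildeMu_iff_isBalanced (i : Fin N) :
    tildeMu s μ i.castSucc 1 0 * tildeMu s μ i.castSucc (-1) (rhoSucc s i.castSucc)
        = tildeMu s μ i.succ 1 0 * tildeMu s μ i.succ (-1) (rhoSucc s i.castSucc)
      ↔ IsBalanced s μ i := by
  set c : ℂ := (rhoSucc s i.castSucc : ℂ) with hc
  have h1 : ∀ a, HahnSeries.ofPowerSeries ℤ ℂ (affineInv 1 0) * tildeMu s μ a 1 0
      = HahnSeries.ofPowerSeries ℤ ℂ (nu s μ a) := fun a => by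
    rw [affineInv_mul_tildeMu one_ne_zero, affineInv_one_zero, PowerSeries.X_subst]
  have h2 : ∀ a, HahnSeries.ofPowerSeries ℤ ℂ (affineInv (-1) c) * tildeMu s μ a (-1) c
      = HahnSeries.ofPowerSeries ℤ ℂ (reflect c (nu s μ a)) := fun a => by
    rw [affineInv_mul_tildeMu (neg_ne_zero.2 one_ne_zero), reflect_apply, evalAffine]
  have hne : HahnSeries.ofPowerSeries ℤ ℂ (affineInv 1 0)
      * HahnSeries.ofPowerSeries ℤ ℂ (affineInv (-1) c) ≠ 0 :=
    mul_ne_zero (left_ne_zero_of_mul_eq_one (affineInv_mul_affine one_ne_zero 0))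
      (left_ne_zero_of_mul_eq_one (affineInv_mul_affine (neg_ne_zero.2 one_ne_zero) c))
  rw [IsBalanced, ← hc, ← (HahnSeries.ofPowerSeries_injective (Γ := ℤ)).eq_iff, map_mul, map_mul,
    ← h1, ← h1, ← h2, ← h2, mul_mul_mul_comm, mul_mul_mul_comm _ (tildeMu s μ i.succ 1 0)]
  exact (mul_right_inj' hne).symm

end Laurent

/-! ### Approximation of highest weights -/

section Approximation

variable {s ε : Fin (N + 1) → ℤˣ} {μ : Fin (N + 1) → PowerSeries ℂ}

/-- Reduction of series in `x` modulo `x ^ R`. -/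
noncomputable def trunc (R : ℕ) :
    PowerSeries ℂ →+* PowerSeries ℂ ⧸ Ideal.span {(PowerSeries.X : PowerSeries ℂ) ^ R} :=
  Ideal.Quotient.mk _

theorem trunc_eq_iff {R : ℕ} {f g : PowerSeries ℂ} :
    trunc R f = trunc R g ↔ PowerSeries.X ^ R ∣ f - g := by
  rw [trunc, Ideal.Quotient.eq, Ideal.mem_span_singleton]

theorem trunc_mono {R R' : ℕ} (h : R' ≤ R) {f g : PowerSeries ℂ} (hfg : trunc R f = trunc R g) :
    trunc R' f = trunc R' g :=
  trunc_eq_iff.2 ((pow_dvd_pow _ h).trans (trunc_eq_iff.1 hfg))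

theorem isUnit_trunc (R : ℕ) {f : PowerSeries ℂ} (hf : PowerSeries.constantCoeff f ≠ 0) :
    IsUnit (trunc R f) :=
  (PowerSeries.isUnit_iff_constantCoeff.2 (isUnit_iff_ne_zero.2 hf)).map _

theorem trunc_reflect {R : ℕ} {f g : PowerSeries ℂ} (c : ℂ) (h : trunc R f = trunc R g) :
    trunc R (reflect c f) = trunc R (reflect c g) := by
  rw [trunc_eq_iff] at h ⊢
  obtain ⟨k, hk⟩ := h
  rw [← map_sub, hk, map_mul, map_pow, reflect_X]
  exact (pow_dvd_pow_of_dvd (dvd_mul_right _ _) R).mul_right _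

/-- Membership in the defining left ideal of a Verma module involves only finitely many coefficients
of the highest weight. -/
theorem mem_vermaIdeal_of_trunc {x : Alg s ε} (hx : x ∈ vermaIdeal s ε μ) :
    ∃ R, ∀ μ' : Fin (N + 1) → PowerSeries ℂ, (∀ i, trunc R (μ' i) = trunc R (μ i)) →
      x ∈ vermaIdeal s ε μ' := by
  refine Submodule.span_induction ?_ ?_ ?_ ?_ hx
  · rintro x (⟨i, j, r, hij, rfl⟩ | ⟨i, r, rfl⟩)
    · exact ⟨0, fun μ' _ => Submodule.subset_span (Or.inl ⟨i, j, r, hij, rfl⟩)⟩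
    · refine ⟨r + 1, fun μ' h => Submodule.subset_span (Or.inr ⟨i, r, ?_⟩)⟩
      have h1 := PowerSeries.X_pow_dvd_iff.1 (trunc_eq_iff.1 (h i)) r (Nat.lt_succ_self r)
      rw [map_sub, sub_eq_zero] at h1
      rw [h1]
  · exact ⟨0, fun μ' _ => Submodule.zero_mem _⟩
  · rintro x y _ _ ⟨R₁, h1⟩ ⟨R₂, h2⟩
    exact ⟨max R₁ R₂, fun μ' h => Submodule.add_mem _
      (h1 μ' fun i => trunc_mono (le_max_left _ _) (h i))
      (h2 μ' fun i => trunc_mono (le_max_right _ _) (h i))⟩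
  · rintro a x _ ⟨R, h1⟩
    exact ⟨R, fun μ' h => Submodule.smul_mem _ _ (h1 μ' h)⟩

theorem nontrivial_of_approx (h : ∀ R, ∃ μ' : Fin (N + 1) → PowerSeries ℂ,
    Nontrivial (VermaModule s ε μ') ∧ ∀ i, trunc R (μ' i) = trunc R (μ i)) :
    Nontrivial (VermaModule s ε μ) := by
  apply Submodule.Quotient.nontrivial_iff.2
  intro htop
  obtain ⟨R, hR⟩ := mem_vermaIdeal_of_trunc (x := (1 : Alg s ε)) (μ := μ) (by rw [htop]; trivial)
  obtain ⟨μ', h1, h2⟩ := h R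
  exact Submodule.Quotient.nontrivial_iff.1 h1
    (Ideal.eq_top_of_isUnit_mem _ (hR μ' h2) isUnit_one)

/-- Modulo `x ^ R` every series is a polynomial in a series `ζ = x (1 + …)`. -/
theorem exists_polynomial {ζ k : PowerSeries ℂ} (hk : PowerSeries.constantCoeff k = 1)
    (hζ : ζ = PowerSeries.X * k) (g : PowerSeries ℂ) (R : ℕ) :
    ∃ Q : Polynomial ℂ, trunc R (Polynomial.aeval ζ Q) = trunc R g := by
  simp only [trunc_eq_iff]
  induction R with
  | zero => exact ⟨0, by simp⟩
  | succ R ih =>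
    obtain ⟨Q, r, hr⟩ := ih
    set z := PowerSeries.constantCoeff r with hz
    -- the coefficient of `x ^ R` is corrected by a multiple of `ζ ^ R = x ^ R (1 + …)`
    refine ⟨Q - Polynomial.C z * Polynomial.X ^ R, ?_⟩
    have h1 : PowerSeries.X ∣ r - PowerSeries.C z * k ^ R := by
      rw [PowerSeries.X_dvd_iff]
      simp [hk, hz]
    obtain ⟨t, ht⟩ := h1
    refine ⟨t, ?_⟩
    rw [map_sub, map_mul, map_pow, Polynomial.aeval_X, Polynomial.aeval_C,
      PowerSeries.algebraMap_apply, Algebra.algebraMap_self, RingHom.id_apply]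
    have h2 : ζ ^ R = PowerSeries.X ^ R * k ^ R := by rw [hζ, mul_pow]
    rw [h2]
    linear_combination hr + PowerSeries.X ^ R * ht

theorem exists_multiset_prod (Q : Polynomial ℂ) (hQ : Polynomial.eval 0 Q = 1)
    (ζ : PowerSeries ℂ) :
    ∃ L : Multiset ℂ, Polynomial.aeval ζ Q = (L.map fun β => 1 + PowerSeries.C β * ζ).prod := by
  have hroot : ∀ a ∈ Q.roots, a ≠ 0 := by
    rintro a ha rfl
    rw [Polynomial.mem_roots', Polynomial.IsRoot.def, hQ] at ha
    exact one_ne_zero ha.2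
  have h1 := (IsAlgClosed.splits Q).eq_prod_roots
  refine ⟨Q.roots.map fun a => -a⁻¹, ?_⟩
  have h2 : Polynomial.aeval ζ Q
      = PowerSeries.C Q.leadingCoeff * (Q.roots.map fun a => ζ - PowerSeries.C a).prod := by
    conv_lhs => rw [h1]
    rw [map_mul, Polynomial.aeval_C, map_multiset_prod, Multiset.map_map]
    congr 2
    refine Multiset.map_congr rfl fun a _ => ?_
    simp
  have h3 : PowerSeries.C Q.leadingCoeff * (Q.roots.map fun a => PowerSeries.C (-a)).prod = 1 := by
    have h4 := congrArg (Polynomial.eval 0) h1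
    rw [hQ, Polynomial.eval_mul, Polynomial.eval_C, Polynomial.eval_multiset_prod,
      Multiset.map_map] at h4
    rw [← map_one PowerSeries.C, h4, map_mul, map_multiset_prod, Multiset.map_map]
    congr 2
    refine Multiset.map_congr rfl fun a _ => ?_
    simp
  rw [h2, Multiset.map_map]
  refine Eq.trans ?_ ((congrArg (· * _) h3).trans (one_mul _))
  rw [mul_assoc, ← Multiset.prod_map_mul]
  congr 2
  refine Multiset.map_congr rfl fun a ha => ?_
  have h5 : PowerSeries.C a * PowerSeries.C a⁻¹ = 1 := by
    rw [← map_mul, mul_inv_cancel₀ (hroot a ha), map_one]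
  simp only [Function.comp_apply, map_neg]
  linear_combination -ζ * h5

theorem constantCoeff_reflect_X (c : ℂ) : PowerSeries.constantCoeff (reflect c PowerSeries.X) = 0 := by
  rw [reflect_X]
  simp [affineInv]

theorem reflect_centered (s : Fin (N + 1) → ℤˣ) (h : Fin (N + 1)) :
    reflect (rhoSucc s h) (centered s h) = -centered s h := by
  set c : ℂ := (rhoSucc s h : ℂ) with hc
  have h1 := invShift_mul (c / 2)
  have h2 := congrArg (reflect c) h1
  have h3 := X_add_reflect_X c
  simp only [map_mul, map_sub, map_one, reflect_C] at h2
  have hc2 : PowerSeries.C c = 2 * PowerSeries.C (c / 2) := by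
    rw [← map_ofNat PowerSeries.C 2, ← map_mul]
    congr 1
    ring
  rw [hc2] at h3
  have n1 : (1 - PowerSeries.C (c / 2) * PowerSeries.X : PowerSeries ℂ) ≠ 0 := by
    intro h
    have := congrArg PowerSeries.constantCoeff h
    simp at this
  have n2 : (1 - PowerSeries.C (c / 2) * reflect c PowerSeries.X : PowerSeries ℂ) ≠ 0 := by
    intro h
    have := congrArg PowerSeries.constantCoeff h
    simp [constantCoeff_reflect_X] at this
  rw [centered, ← hc]
  apply mul_left_cancel₀ (mul_ne_zero n1 n2)
  linear_combination (1 - PowerSeries.C (c / 2) * PowerSeries.X) * h2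
    + (1 - PowerSeries.C (c / 2) * reflect c PowerSeries.X) * h1 + h3

/-- A series `f` with `f(u) f(ρ - u) = 1` is approximated by quotients `q(u) / q(ρ - u)`, where
`q` is a product of linear factors in the centered parameter: take `q ≡ (1 + f) / 2`. -/
theorem exists_quotient (s : Fin (N + 1) → ℤˣ) (h : Fin (N + 1)) {f : PowerSeries ℂ}
    (hf0 : PowerSeries.constantCoeff f = 1) {R : ℕ}
    (hf : trunc (R + 1) (f * reflect (rhoSucc s h) f) = 1) :
    ∃ L : Multiset ℂ,
      trunc (R + 1) (f * (L.map fun β => 1 - PowerSeries.C β * centered s h).prod)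
        = trunc (R + 1) (L.map fun β => 1 + PowerSeries.C β * centered s h).prod := by
  obtain ⟨Q, hQ⟩ := exists_polynomial (ζ := centered s h) (k := (1 - PowerSeries.C
    ((rhoSucc s h : ℂ) / 2) * PowerSeries.X)⁻¹) (by simp) rfl (PowerSeries.C (1 / 2) * (1 + f)) (R + 1)
  have hQ0 : Polynomial.eval 0 Q = 1 := by
    have h1 := PowerSeries.X_pow_dvd_iff.1 (trunc_eq_iff.1 hQ) 0 (Nat.succ_pos R)
    rw [PowerSeries.coeff_zero_eq_constantCoeff_apply, map_sub, sub_eq_zero, map_mul, map_add, hf0,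
      PowerSeries.constantCoeff_C, map_one] at h1
    have h2 : PowerSeries.constantCoeff (Polynomial.aeval (centered s h) Q)
        = Polynomial.eval 0 Q := by
      rw [Polynomial.aeval_def, Polynomial.hom_eval₂, centered, constantCoeff_invShift,
        Polynomial.eval₂_at_zero, Polynomial.coeff_zero_eq_eval_zero]
      simp
    rw [← h2, h1]
    norm_num
  obtain ⟨L, hL⟩ := exists_multiset_prod Q hQ0 (centered s h)
  refine ⟨L, ?_⟩
  rw [hL] at hQ
  have h3 : reflect (rhoSucc s h) (L.map fun β => 1 + PowerSeries.C β * centered s h).prod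
      = (L.map fun β => 1 - PowerSeries.C β * centered s h).prod := by
    rw [map_multiset_prod, Multiset.map_map]
    congr 1
    refine Multiset.map_congr rfl fun β _ => ?_
    rw [Function.comp_apply, map_add, map_one, map_mul, reflect_C, reflect_centered]
    ring
  have h4 := trunc_reflect (rhoSucc s h : ℂ) hQ
  rw [h3, map_mul, reflect_C, map_add, map_one] at h4
  rw [hQ, map_mul, h4]
  rw [map_mul] at hf
  simp only [map_mul, map_add, map_one]
  linear_combination trunc (R + 1) (PowerSeries.C (1 / 2)) * hf

theorem constantCoeff_nu (i : Fin (N + 1)) :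
    PowerSeries.constantCoeff (nu s μ i) = 2 * PowerSeries.constantCoeff (μ i) := by
  rw [nu]
  simp [map_ofNat]

theorem trunc_nu_succ {μ' : Fin (N + 1) → PowerSeries ℂ} {R : ℕ} {i : Fin (N + 1)}
    (h : ∀ a, i ≤ a → trunc R (μ' a) = trunc R (μ a)) : trunc R (nu s μ' i) = trunc R (nu s μ i) := by
  simp only [nu, tailSum, map_add, map_mul, map_sum, h i le_rfl]
  congr 2
  exact Finset.sum_congr rfl fun a ha => by rw [h a (Finset.mem_Ioi.1 ha).le]

/-- One level of the approximation: the weight at `i` is corrected by dressing. -/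
theorem exists_approx_step (hε : ∀ i, PowerSeries.constantCoeff (μ i) = (((ε i : ℤˣ) : ℤ) : ℂ))
    {i : Fin N} (hbal : IsBalanced s μ i) {R : ℕ} {μ₁ : Fin (N + 1) → PowerSeries ℂ}
    (h1 : Nontrivial (VermaModule s ε μ₁))
    (h2 : ∀ a, i.succ ≤ a → trunc (R + 1) (μ₁ a) = trunc (R + 1) (μ a)) :
    ∃ μ₂ : Fin (N + 1) → PowerSeries ℂ, Nontrivial (VermaModule s ε μ₂) ∧
      ∀ a, i.castSucc ≤ a → trunc (R + 1) (μ₂ a) = trunc (R + 1) (μ a) := by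
  set j := i.castSucc with hj
  set c : ℂ := (rhoSucc s j : ℂ) with hc
  have hεj : (((ε j : ℤˣ) : ℤ) : ℂ) ≠ 0 := by
    rcases Int.units_eq_one_or (ε j) with h | h <;> simp [h]
  have hbal₁ := isBalanced_of_nontrivial h1 i
  rw [IsBalanced, ← hj, ← hc] at hbal hbal₁
  have hw : trunc (R + 1) (nu s μ₁ i.succ) = trunc (R + 1) (nu s μ i.succ) := trunc_nu_succ h2
  have hw' := trunc_reflect c hw
  have hν₁ : PowerSeries.constantCoeff (nu s μ₁ j) ≠ 0 := by
    rw [constantCoeff_nu, constantCoeff_of_nontrivial h1]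
    exact mul_ne_zero two_ne_zero hεj
  set f := nu s μ j * (nu s μ₁ j)⁻¹ with hf
  have hfν : f * nu s μ₁ j = nu s μ j := by
    rw [hf, mul_assoc, PowerSeries.inv_mul_cancel _ hν₁, mul_one]
  have hf0 : PowerSeries.constantCoeff f = 1 := by
    have h3 := congrArg PowerSeries.constantCoeff hfν
    rw [map_mul, constantCoeff_nu, constantCoeff_nu, hε, constantCoeff_of_nontrivial h1] at h3
    exact mul_right_cancel₀ (mul_ne_zero two_ne_zero hεj) (h3.trans (one_mul _).symm)
  -- both `ν_j` satisfy the balance condition, the one for `μ₁` because it is necessary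
  have hff : trunc (R + 1) (f * reflect c f) = 1 := by
    have h3 := congrArg (fun g => trunc (R + 1) g) hbal
    have h4 := congrArg (fun g => trunc (R + 1) g) hbal₁
    have h5 := congrArg (fun g => trunc (R + 1) g) (congrArg (reflect c) hfν)
    have h6 := congrArg (fun g => trunc (R + 1) g) hfν
    simp only [map_mul] at h3 h4 h5 h6 ⊢
    have hu : IsUnit (trunc (R + 1) (nu s μ₁ j) * trunc (R + 1) (reflect c (nu s μ₁ j))) := by
      refine (isUnit_trunc _ hν₁).mul (IsUnit.map _ (IsUnit.map _ ?_))
      exact PowerSeries.isUnit_iff_constantCoeff.2 (isUnit_iff_ne_zero.2 hν₁)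
    apply hu.mul_left_cancel
    rw [hw, hw'] at h4
    linear_combination h3 - h4
      + trunc (R + 1) (reflect c f) * trunc (R + 1) (reflect c (nu s μ₁ j)) * h6
      + trunc (R + 1) (nu s μ j) * h5
  obtain ⟨L, hL⟩ := exists_quotient s j hf0 hff
  obtain ⟨μ₂, h3, h4, h5⟩ := exists_dressed_multiset h1 j L
  have hgt : ∀ a, j < a → trunc (R + 1) (μ₂ a) = trunc (R + 1) (μ a) := fun a ha => by
    rw [h4 a ha]
    exact h2 a (by
      simpa only [Fin.le_def, Fin.lt_def, Fin.val_succ, hj, Fin.val_castSucc, Nat.succ_le_iff] using ha)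
  refine ⟨μ₂, h3, fun a ha => ?_⟩
  rcases ha.lt_or_eq with ha | rfl
  · exact hgt a ha
  have hL0 : PowerSeries.constantCoeff
      (L.map fun β => 1 - PowerSeries.C β * centered s j).prod ≠ 0 := by
    rw [map_multiset_prod, Multiset.map_map]
    refine Multiset.prod_ne_zero ?_
    intro hmem
    obtain ⟨β, _, hβ⟩ := Multiset.mem_map.1 hmem
    simp [centered, constantCoeff_invShift] at hβ
  have h6 : trunc (R + 1) (nu s μ₂ j) = trunc (R + 1) (nu s μ j) := by
    apply (isUnit_trunc (R + 1) hL0).mul_right_cancel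
    rw [← map_mul, h5, ← hfν, map_mul, ← hL]
    simp only [map_mul]
    ring
  have h7 : trunc (R + 1) (tailSum s μ₂ j) = trunc (R + 1) (tailSum s μ j) := by
    simp only [tailSum, map_sum, map_mul]
    exact Finset.sum_congr rfl fun a ha => by rw [hgt a (Finset.mem_Ioi.1 ha)]
  have h8 : PowerSeries.constantCoeff
      (2 - PowerSeries.C (rhoSucc s j : ℂ) * PowerSeries.X : PowerSeries ℂ) ≠ 0 := by
    simp [map_ofNat]
  apply (isUnit_trunc (R + 1) h8).mul_left_cancel
  rw [nu, nu, map_add, map_add, map_mul _ PowerSeries.X, map_mul _ PowerSeries.X, h7, map_mul,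
    map_mul] at h6
  exact add_right_cancel h6

/-- Highest weights satisfying the conditions are limits of highest weights of dressed
representations. -/
theorem nontrivial_of_isBalanced (hε : ∀ i, PowerSeries.constantCoeff (μ i) = (((ε i : ℤˣ) : ℤ) : ℂ))
    (hlast : μ (Fin.last N) * reflect 0 (μ (Fin.last N)) = 1) (hbal : ∀ i, IsBalanced s μ i) :
    Nontrivial (VermaModule s ε μ) := by
  refine nontrivial_of_approx fun R => ?_
  have key : ∀ h : Fin (N + 1), ∃ μ' : Fin (N + 1) → PowerSeries ℂ,
      Nontrivial (VermaModule s ε μ') ∧ ∀ a, h ≤ a → trunc (R + 1) (μ' a) = trunc (R + 1) (μ a) := by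
    intro h
    induction h using Fin.reverseInduction with
    | last =>
      set z : ℂ := (((ε (Fin.last N) : ℤˣ) : ℤ) : ℂ) with hz
      have hzz : z * z = 1 := by
        rw [hz]
        exact_mod_cast unit_mul_self _
      refine ⟨_, nontrivial_of_scalar (g := PowerSeries.C z * μ (Fin.last N)) ?_ ?_, fun a ha => ?_⟩
      · rw [map_mul, PowerSeries.constantCoeff_C, hε, ← hz, hzz]
      · rw [reflect_zero] at hlast
        rw [map_mul, negate_C, mul_mul_mul_comm, hlast, ← map_mul, hzz, map_one, one_mul]
      · rw [Fin.last_le_iff.1 ha, ← mul_assoc, ← map_mul, ← hz, hzz, map_one, one_mul]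
    | cast i ih =>
      obtain ⟨μ₁, h1, h2⟩ := ih
      exact exists_approx_step hε (hbal i) h1 h2
  obtain ⟨μ', h1, h2⟩ := key 0
  exact ⟨μ', h1, fun i => trunc_mono (Nat.le_succ R) (h2 i (Fin.zero_le i))⟩

end Approximation

end TwistedSuperYangian

theorem mainTheorem2 (N : ℕ) (s ε : Fin (N + 1) → ℤˣ) (μ : Fin (N + 1) → PowerSeries ℂ)
    (hμ : ∀ i, PowerSeries.constantCoeff (μ i) = (((ε i : ℤˣ) : ℤ) : ℂ)) :
    Nontrivial (TwistedSuperYangian.VermaModule s ε μ) ↔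
      (μ (Fin.last N) * TwistedSuperYangian.evalAffine (-1) 0 (μ (Fin.last N)) = 1 ∧
        ∀ i : Fin N,
          TwistedSuperYangian.tildeMu s μ i.castSucc 1 0 *
              TwistedSuperYangian.tildeMu s μ i.castSucc (-1)
                (TwistedSuperYangian.rhoSucc s i.castSucc) =
            TwistedSuperYangian.tildeMu s μ i.succ 1 0 *
              TwistedSuperYangian.tildeMu s μ i.succ (-1)
                (TwistedSuperYangian.rhoSucc s i.castSucc)) := by
  simp only [TwistedSuperYangian.tildeMu_iff_isBalanced, ← TwistedSuperYangian.reflect_apply]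
  exact ⟨fun h => ⟨TwistedSuperYangian.last_of_nontrivial h,
    TwistedSuperYangian.isBalanced_of_nontrivial h⟩,
    fun h => TwistedSuperYangian.nontrivial_of_isBalanced hμ h.1 h.2⟩
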